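/- Let $G$ be a Lie group with Lie algebra $\mathfrak g$ and let $\pi:P\to X$ be a smooth principal $G$-bundle (all manifolds being finite-dimensional, smooth, Hausdorff and second countable), with right action $R_g$ of $g\in G$ and fundamental vector fields $A^\#$, $A\in\mathfrak g$. Fix a trivializing cover $\{U_i\}_{i\in I}$ of $X$ by smooth $G$-equivariant local trivializations, with canonical sections $\sigma_i:U_i\to P$ and transition functions $\gamma_{ij}:U_i\cap U_j\to G$, $\sigma_j=\sigma_i\cdot\gamma_{ij}$. **Fields.** For a smooth representation of $G$ on a finite-dimensional real vector space $V$, an element $\phi\in\Omega^p(X;V_G)$, $V_G=P\times_G V$, is a family $\phi_i\in\Omega^p(U_i;V)$ with $\phi_j=\gamma_{ji}\cdot\phi_i$ on $U_i\cap U_j$; it corresponds, via $\phi_i=\sigma_i^*\widetilde\phi$, to a unique horizontal form $\widetilde\phi\in\Omega^p(P;V)$ with $R_g^*\widetilde\phi=g^{-1}\cdot\widetilde\phi$. A connection on $X$ is a family $\omega_i\in\Omega^1(U_i;\mathfrak g)$ with $\omega_j=\gamma_{ji}\,\omega_i\,\gamma_{ij}+\gamma_{ji}\,\mathrm d\gamma_{ij}$;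 it corresponds, via $\omega_i=\sigma_i^*\widetilde\omega$, to a unique connection form $\widetilde\omega$ on $P$ ($R_g^*\widetilde\omega=\mathrm{Ad}_{g^{-1}}\widetilde\omega$ and $\widetilde\omega(A^\#)=A$). **Covariant Lie derivatives.** A lift is an $\mathbb R$-linear map $\xi\mapsto\widetilde\xi$ from the vector fields $\mathcal X(X)$ to the $G$-invariant vector fields $\mathcal X(P)_G$ such that $\widetilde\xi$ projects to $\xi$. Its covariant Lie derivatives $\widetilde L_\xi\phi\in\Omega^p(X;V_G)$ and $\widetilde L_\xi\omega\in\Omega^1(X;P\times_G\mathfrak g)$ are the sections corresponding to $L_{\widetilde\xi}\widetilde\phi$ and $L_{\widetilde\xi}\widetilde\omega$ (which are horizontal and $G$-equivariant), where $L=\mathrm d\iota+\iota\,\mathrm d$. **Proposition.** Giving a lift is equivalent to giving either of the following data on $X$; that is, there are bijections between the set of lifts, the set of data (a), and the set of equivalence classes in (b), with the properties stated below. (a) A family of $\mathbb R$-linear maps $B_i:\mathcal X(X)\to\Omega^0(U_i;\mathfrak g)$ with $$B_j(\xi)=\gamma_{ji}\,B_i(\xi)\,\gamma_{ij}+\gamma_{ji}\,\iota_\xi\mathrm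 d\gamma_{ij}\quad\text{on }U_i\cap U_j.$$ The covariant Lie derivatives are then, for all $V,p,\phi,\omega,\xi$, given on each $U_i$ by $$\widetilde L_\xi\phi=L_\xi\phi+B_\xi\wedge\phi,\qquad \widetilde L_\xi\omega=L_\xi\omega-\mathrm d^\omega B_\xi .$$ (b) A pair $(\omega,\lambda)$ of a connection $\omega$ on $X$ and an $\mathbb R$-linear map $\lambda:\mathcal X(X)\to\Omega^0(X;P\times_G\mathfrak g)$, where $(\omega,\lambda)$ and $(\hat\omega,\hat\lambda)$ are identified if $\iota_\xi\omega-\lambda_\xi=\iota_\xi\hat\omega-\hat\lambda_\xi$ for all $\xi\in\mathcal X(X)$. The bijection from (b) to (a) is $B_\xi=\iota_\xi\omega-\lambda_\xi$; given $B$, every connection $\omega$ occurs in exactly one pair $(\omega,\lambda)$ of the class of $B$. For such pairs, $$\widetilde L_\xi\phi=\iota_\xi\mathrm d^\omega\phi+\mathrm d^\omega(\iota_\xi\phi)-\lambda_\xi\wedge\phi,\qquad \widetilde L_\xi\omega=\iota_\xi F_\omega+\mathrm d^\omega\lambda_\xi .$$ Here $\mathrm d^\omega\phi=\mathrm d\phi+\omega\wedge\phi$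 (with the bracket for $\mathfrak g$-valued forms), $F_\omega=\mathrm d\omega+\tfrac12[\omega\wedge\omega]$, and terms $\iota_\xi\phi$ are absent for $p=0$. Finally, pairs $(\omega,\lambda)$ on $X$ are in bijection, by pullback along the $\sigma_i$, with pairs $(\widetilde\omega,\widetilde\lambda)$ of a connection form on $P$ and an $\mathbb R$-linear map from $\mathcal X(X)$ to the $G$-equivariant functions $P\to\mathfrak g$. Each pair $(\widetilde\omega,\widetilde\lambda)$ determines a unique lift with $\iota_{\widetilde\xi}\widetilde\omega=\widetilde\lambda_\xi$ for all $\xi$, and this is the lift that corresponds to the class of $(\omega,\lambda)$. -/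

import Mathlib

open Set Bundle
open scoped Manifold ContDiff

noncomputable section

namespace CovLie

/-! ### Vector fields and differential forms on smooth manifolds

All manifolds are modelled on finite-dimensional real normed spaces `E`, with model `𝓘(ℝ, E)`.
In Mathlib the tangent space at every point of such a manifold is, by definition, a copy of `E`;
the value of a form at a point is therefore written as an alternating form on `E`. -/

section Forms

/-- The real vector space of smooth vector fields on `M`. -/
abbrev VF (E M : Type*) [NormedAddCommGroup E] [NormedSpace ℝ E] [TopologicalSpace M]
    [ChartedSpace E M] [IsManifold 𝓘(ℝ, E) ∞ M] : Type _ :=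
  ContMDiffSection 𝓘(ℝ, E) E ∞ (TangentSpace 𝓘(ℝ, E) : M → Type _)

/-- The vector field `ξ` as a function, its value at a point being a tangent vector there. -/
def VF.val {E M : Type*} [NormedAddCommGroup E] [NormedSpace ℝ E] [TopologicalSpace M]
    [ChartedSpace E M] [IsManifold 𝓘(ℝ, E) ∞ M] (ξ : VF E M) (x : M) : E :=
  ξ x

variable (E : Type*) [NormedAddCommGroup E] [NormedSpace ℝ E]
  (F : Type*) [NormedAddCommGroup F] [NormedSpace ℝ F]
  {M : Type*} [TopologicalSpace M] [ChartedSpace E M]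
  {N : Type*} [TopologicalSpace N] [ChartedSpace F N]
  {V : Type*} [NormedAddCommGroup V] [NormedSpace ℝ V]
  {W : Type*} [NormedAddCommGroup W] [NormedSpace ℝ W]
  {p : ℕ}

/-- The differential (tangent map) of `f : M → N` at `x`. -/
def tmap (f : M → N) (x : M) : E →L[ℝ] F :=
  mfderiv 𝓘(ℝ, E) 𝓘(ℝ, F) f x

/-- Not necessarily smooth `V`-valued differential `p`-forms on `M`. -/
abbrev Form (E M : Type*) [NormedAddCommGroup E] [NormedSpace ℝ E] (p : ℕ)
    (V : Type*) [NormedAddCommGroup V] [NormedSpace ℝ V] : Type _ :=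
  M → E [⋀^Fin p]→L[ℝ] V

/-- The pullback of the form `φ` along `f : M → N`. -/
def pull (f : M → N) (φ : Form F N p V) : Form E M p V :=
  fun x => (φ (f x)).compContinuousLinearMap (tmap E F f x)

variable {E}

/-- The coordinate expression of `φ` in the preferred chart around `x₀`. -/
def inChart (x₀ : M) (φ : Form E M p V) : Form E E p V :=
  pull E E (chartAt E x₀).symm φ

/-- `Ω^p(U; V)`, the space of smooth `V`-valued `p`-forms on the subset `U` of `M` (for `U` open).
Such a form is represented by its extension by zero to all of `M`, so that two elements are equal
exactly if they agree on `U`. For `U = univ` this is `Ω^p(M; V)`. -/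
def formsOn (E : Type*) {M : Type*} [NormedAddCommGroup E] [NormedSpace ℝ E] [TopologicalSpace M]
    [ChartedSpace E M] (p : ℕ) (V : Type*) [NormedAddCommGroup V] [NormedSpace ℝ V] (U : Set M) :
    Submodule ℝ (Form E M p V) where
  carrier := {φ | (∀ x₀ : M, ContDiffOn ℝ ∞ (inChart x₀ φ)
      ((chartAt E x₀).target ∩ (chartAt E x₀).symm ⁻¹' U)) ∧ ∀ x, x ∉ U → φ x = 0}
  zero_mem' := ⟨fun _ => contDiffOn_const (c := 0), fun _ _ => rfl⟩
  add_mem' := fun {φ ψ} hφ hψ =>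
    ⟨fun x₀ => (hφ.1 x₀).add (hψ.1 x₀), fun x hx => by simp [hφ.2 x hx, hψ.2 x hx]⟩
  smul_mem' := fun c φ hφ =>
    ⟨fun x₀ => (hφ.1 x₀).const_smul c, fun x hx => by simp [hφ.2 x hx]⟩

/-- The exterior derivative, computed at `x` in the preferred chart around `x`. -/
def d (φ : Form E M p V) : Form E M (p + 1) V :=
  fun x => (extDeriv (inChart x φ) (chartAt E x x)).compContinuousLinearMap
    (tmap E E (chartAt E x) x)

/-- The contraction `ι_ξ` with a vector field. -/
def contr (ξ : M → E) (φ : Form E M (p + 1) V) : Form E M p V :=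
  fun x => (φ x).curryLeft (ξ x)

/-- The Lie derivative `L_ξ = d ∘ ι_ξ + ι_ξ ∘ d` (the first term is absent on `0`-forms). -/
def lieD (ξ : M → E) : {p : ℕ} → Form E M p V → Form E M p V
  | 0, φ => contr ξ (d φ)
  | _ + 1, φ => d (contr ξ φ) + contr ξ (d φ)

/-- `f ∧ φ` for a `W`-valued `0`-form `f` and a `V`-valued `p`-form `φ`, with respect to a bilinear
action `b` of `W` on `V`. -/
def wedge₀ (b : W →L[ℝ] V →L[ℝ] V) (f : Form E M 0 W) (φ : Form E M p V) : Form E M p V :=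
  fun x => (b (f x ![])).compContinuousAlternatingMap (φ x)

/-- `θ ∧ φ` for a `W`-valued `1`-form `θ` and a `V`-valued `p`-form `φ`, that is
`(θ ∧ φ)(v₀, …, v_p) = ∑ₖ (-1)ᵏ b (θ vₖ) (φ (v₀, …, v̂ₖ, …, v_p))`. -/
def wedge₁ (b : W →L[ℝ] V →L[ℝ] V) (θ : Form E M 1 W) (φ : Form E M p V) :
    Form E M (p + 1) V :=
  fun x => ContinuousAlternatingMap.alternatizeUncurryFin
    ((ContinuousLinearMap.compContinuousAlternatingMapCLM ℝ E V V (Fin p)).flip (φ x) ∘L b ∘L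
      (ContinuousAlternatingMap.ofSubsingleton ℝ E W (0 : Fin 1)).symm (θ x))

/-- The covariant derivative `d^θ φ = dφ + θ ∧ φ`. -/
def dcov (b : W →L[ℝ] V →L[ℝ] V) (θ : Form E M 1 W) (φ : Form E M p V) : Form E M (p + 1) V :=
  d φ + wedge₁ b θ φ

/-- The operator `ι_ξ ∘ d^θ + d^θ ∘ ι_ξ` (the second term is absent on `0`-forms). -/
def lieCov (b : W →L[ℝ] V →L[ℝ] V) (θ : Form E M 1 W) (ξ : M → E) :
    {p : ℕ} → Form E M p V → Form E M p V
  | 0, φ => contr ξ (dcov b θ φ)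
  | _ + 1, φ => contr ξ (dcov b θ φ) + dcov b θ (contr ξ φ)

/-- The curvature `F_θ = dθ + ½ [θ ∧ θ]`, for a bilinear bracket `b`. -/
def curv (b : W →L[ℝ] W →L[ℝ] W) (θ : Form E M 1 W) : Form E M 2 W :=
  d θ + (1 / 2 : ℝ) • wedge₁ b θ θ

end Forms

/-! ### Lie groups

The Lie algebra `𝔤` of a Lie group `G` is its tangent space at `1`, here the model space `EG`,
with the bracket of left-invariant vector fields (`GroupLieAlgebra` in Mathlib). -/

section LieGroups

variable (EG : Type*) [NormedAddCommGroup EG] [NormedSpace ℝ EG]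
  {G : Type*} [TopologicalSpace G] [ChartedSpace EG G] [Group G]

/-- The differential at `h` of left multiplication by `g`. -/
def leftMul (g h : G) : EG →L[ℝ] EG := tmap EG EG (fun k : G => g * k) h

/-- The adjoint representation of `G` on its Lie algebra, `A ↦ g · A · g⁻¹`. -/
def Ad (g : G) : EG →L[ℝ] EG := tmap EG EG (fun k : G => g * k * g⁻¹) 1

variable (G) in
/-- The Lie bracket of the Lie algebra of `G`, as a continuous bilinear map. -/
def bracket [FiniteDimensional ℝ EG] [LieGroup 𝓘(ℝ, EG) ∞ G] : EG →L[ℝ] EG →L[ℝ] EG :=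
  haveI : LieGroup 𝓘(ℝ, EG) (minSmoothness ℝ 3) G := by
    rw [minSmoothness_of_isRCLikeNormedField]; infer_instance
  haveI : CompleteSpace EG := FiniteDimensional.complete ℝ EG
  LinearMap.toContinuousBilinearMap (𝕜 := ℝ) (E := EG) (F := EG) (G := EG)
    (LinearMap.mk₂ ℝ (M := GroupLieAlgebra 𝓘(ℝ, EG) G) (Nₗ := GroupLieAlgebra 𝓘(ℝ, EG) G)
      (Pₗ := GroupLieAlgebra 𝓘(ℝ, EG) G) (fun A C => ⁅A, C⁆)
      add_lie smul_lie lie_add (fun c A C => lie_smul c A C))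

theorem bracket_apply [FiniteDimensional ℝ EG] [LieGroup 𝓘(ℝ, EG) ∞ G]
    (A C : GroupLieAlgebra 𝓘(ℝ, EG) G) : bracket EG G A C = ⁅A, C⁆ := rfl

/-- The derived representation `𝔤 → End V` of a representation `ρ` of `G` on `V`. -/
def derivedRep {V : Type*} [NormedAddCommGroup V] [NormedSpace ℝ V] (ρ : G →* (V →L[ℝ] V)) :
    EG →L[ℝ] V →L[ℝ] V :=
  tmap EG (V →L[ℝ] V) (fun g => ρ g) 1

end LieGroups

/-! ### Principal bundles -/

section Bundles

/-- A smooth principal `G`-bundle `proj : P → X`: a smooth right action of `G` on `P` which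
preserves the fibres, such that around every point of `X` there is a smooth `G`-equivariant local
trivialization `proj ⁻¹' U ≃ U × G`. -/
structure PrincipalBundle (EX EG EP X G P : Type*)
    [NormedAddCommGroup EX] [NormedSpace ℝ EX] [NormedAddCommGroup EG] [NormedSpace ℝ EG]
    [NormedAddCommGroup EP] [NormedSpace ℝ EP]
    [TopologicalSpace X] [ChartedSpace EX X] [TopologicalSpace G] [ChartedSpace EG G] [Group G]
    [TopologicalSpace P] [ChartedSpace EP P] where
  proj : P → X
  act : P → G → P
  act_one : ∀ u, act u 1 = u
  act_mul : ∀ u g h, act u (g * h) = act (act u g) h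
  proj_act : ∀ u g, proj (act u g) = proj u
  contMDiff_proj : ContMDiff 𝓘(ℝ, EP) 𝓘(ℝ, EX) ∞ proj
  contMDiff_act : ContMDiff (𝓘(ℝ, EP).prod 𝓘(ℝ, EG)) 𝓘(ℝ, EP) ∞ (fun q : P × G => act q.1 q.2)
  locallyTrivial : ∀ x : X, ∃ e : Trivialization G proj, x ∈ e.baseSet ∧
    ContMDiffOn 𝓘(ℝ, EP) (𝓘(ℝ, EX).prod 𝓘(ℝ, EG)) ∞ e e.source ∧
    ContMDiffOn (𝓘(ℝ, EX).prod 𝓘(ℝ, EG)) 𝓘(ℝ, EP) ∞ e.toOpenPartialHomeomorph.symm e.target ∧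
    ∀ u ∈ e.source, ∀ g, (e (act u g)).2 = (e u).2 * g

variable {EX EG EP X G P : Type*}
  [NormedAddCommGroup EX] [NormedSpace ℝ EX] [NormedAddCommGroup EG] [NormedSpace ℝ EG]
  [NormedAddCommGroup EP] [NormedSpace ℝ EP]
  [TopologicalSpace X] [ChartedSpace EX X] [TopologicalSpace G] [ChartedSpace EG G] [Group G]
  [TopologicalSpace P] [ChartedSpace EP P]
  {V : Type*} [NormedAddCommGroup V] [NormedSpace ℝ V] {p : ℕ}

namespace PrincipalBundle

variable (B : PrincipalBundle EX EG EP X G P)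

/-- The value at `u` of the fundamental vector field `A^#` generated by `A ∈ 𝔤`. -/
def fundamental (u : P) (A : EG) : EP := tmap EG EP (fun g => B.act u g) 1 A

/-- The horizontal and `G`-equivariant `V`-valued `p`-forms on `P`, for an action `a` of `G`
on `V`: contraction with vertical vectors vanishes, and `R_g^* φ = a(g⁻¹) φ`. -/
def tensorialForms (a : G → V →L[ℝ] V) (p : ℕ) : Submodule ℝ (Form EP P p V) where
  carrier := {φ | φ ∈ formsOn EP p V (univ : Set P) ∧
    (∀ (u : P) (v : Fin p → EP), (∃ k, tmap EP EX B.proj u (v k) = 0) → φ u v = 0) ∧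
    ∀ (g : G) (u : P), pull EP EP (fun u => B.act u g) φ u =
      (a g⁻¹).compContinuousAlternatingMap (φ u)}
  zero_mem' := ⟨zero_mem _, fun _ _ _ => rfl, fun g u => by ext v; simp [pull]⟩
  add_mem' := fun {φ ψ} hφ hψ => ⟨add_mem hφ.1 hψ.1,
    fun u v h => by simp [hφ.2.1 u v h, hψ.2.1 u v h], fun g u => by
      have h₁ := hφ.2.2 g u
      have h₂ := hψ.2.2 g u
      ext v
      have h₃ := DFunLike.congr_fun h₁ v
      have h₄ := DFunLike.congr_fun h₂ v
      clear hφ hψ h₁ h₂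
      simp only [pull, ContinuousAlternatingMap.compContinuousLinearMap_apply,
        ContinuousLinearMap.compContinuousAlternatingMap_coe, Function.comp_apply, Pi.add_apply,
        ContinuousAlternatingMap.add_apply, map_add] at h₃ h₄ ⊢
      rw [h₃, h₄]⟩
  smul_mem' := fun c φ hφ => ⟨Submodule.smul_mem _ c hφ.1,
    fun u v h => by simp [hφ.2.1 u v h], fun g u => by
      have h₁ := hφ.2.2 g u
      ext v
      have h₃ := DFunLike.congr_fun h₁ v
      clear hφ h₁
      simp only [pull, ContinuousAlternatingMap.compContinuousLinearMap_apply,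
        ContinuousLinearMap.compContinuousAlternatingMap_coe, Function.comp_apply, Pi.smul_apply,
        ContinuousAlternatingMap.smul_apply, map_smul] at h₃ ⊢
      rw [h₃]⟩

/-- The connection `1`-forms on `P`. -/
def connections : Set (Form EP P 1 EG) :=
  {θ | θ ∈ formsOn EP 1 EG (univ : Set P) ∧
    (∀ (g : G) (u : P), pull EP EP (fun u => B.act u g) θ u =
      (Ad EG g⁻¹).compContinuousAlternatingMap (θ u)) ∧
    ∀ (u : P) (A : EG), θ u ![B.fundamental u A] = A}

variable [IsManifold 𝓘(ℝ, EX) ∞ X] [IsManifold 𝓘(ℝ, EP) ∞ P]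

/-- The real vector space of `G`-invariant vector fields on `P`. -/
def invariantVF : Submodule ℝ (VF EP P) where
  carrier := {Z | ∀ (g : G) (u : P),
    tmap EP EP (fun u => B.act u g) u (Z.val u) = Z.val (B.act u g)}
  zero_mem' := fun g u => map_zero _
  add_mem' := fun {Z Z'} h h' g u => by
    have := congrArg₂ (· + ·) (h g u) (h' g u)
    exact (map_add _ _ _).trans this
  smul_mem' := fun c Z h g u => by
    have := congrArg (c • ·) (h g u)
    exact (map_smul _ _ _).trans this

/-- The `ℝ`-linear lifts of vector fields on `X` to `G`-invariant vector fields on `P`. -/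
def lifts : Set (VF EX X →ₗ[ℝ] B.invariantVF) :=
  {l | ∀ (ξ : VF EX X) (u : P), tmap EP EX B.proj u ((l ξ).1.val u) = ξ.val (B.proj u)}

/-- Pairs `(θ, l)` of a connection on `P` and an `ℝ`-linear map `l` from vector fields on `X` to
`G`-equivariant functions `P → 𝔤`. -/
abbrev TotalPair : Type _ := B.connections × (VF EX X →ₗ[ℝ] B.tensorialForms (Ad EG) 0)

end PrincipalBundle

/-- A trivializing cover of a principal bundle: a family of smooth `G`-equivariant local
trivializations whose domains cover the base. -/
structure TrivCover (B : PrincipalBundle EX EG EP X G P) (ι : Type*) where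
  triv : ι → Trivialization G B.proj
  contMDiffOn : ∀ i, ContMDiffOn 𝓘(ℝ, EP) (𝓘(ℝ, EX).prod 𝓘(ℝ, EG)) ∞ (triv i) (triv i).source
  contMDiffOn_symm : ∀ i, ContMDiffOn (𝓘(ℝ, EX).prod 𝓘(ℝ, EG)) 𝓘(ℝ, EP) ∞
    (triv i).toOpenPartialHomeomorph.symm (triv i).target
  equivariant : ∀ i, ∀ u ∈ (triv i).source, ∀ g, (triv i (B.act u g)).2 = (triv i u).2 * g
  covers : ∀ x : X, ∃ i, x ∈ (triv i).baseSet

namespace TrivCover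

variable {B : PrincipalBundle EX EG EP X G P} {ι : Type*} (T : TrivCover B ι)

/-- The open set `U_i`. -/
def U (i : ι) : Set X := (T.triv i).baseSet

/-- The canonical local section `σ_i : U_i → P` (with irrelevant values off `U_i`). -/
def sec (i : ι) (x : X) : P := (T.triv i).toOpenPartialHomeomorph.symm (x, 1)

/-- The transition function `γ_ij : U_i ∩ U_j → G`, with `σ_j = σ_i · γ_ij`. -/
def trans (i j : ι) (x : X) : G := (T.triv i (T.sec j x)).2

/-- `γ_ji · ι_v dγ_ij`, an element of `𝔤`, for a tangent vector `v` at a point `x` of `X`. -/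
def gaugeTerm (i j : ι) (x : X) (v : EX) : EG :=
  leftMul EG (T.trans j i x) (T.trans i j x) (tmap EX EG (T.trans i j) x v)

/-- `Ω^p(X; V_G)`, the `p`-forms on `X` with values in the vector bundle `V_G = P ×_G V` associated
to an action `a` of `G` on `V`: families of `φ_i ∈ Ω^p(U_i; V)` with `φ_j = γ_ji · φ_i` on overlaps.
For the adjoint representation this is `Ω^p(X; P ×_G 𝔤)`. -/
def assocForms (a : G → V →L[ℝ] V) (p : ℕ) : Submodule ℝ (ι → Form EX X p V) where
  carrier := {φ | (∀ i, φ i ∈ formsOn EX p V (T.U i)) ∧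
    ∀ i j, ∀ x ∈ T.U i ∩ T.U j,
      φ j x = (a (T.trans j i x)).compContinuousAlternatingMap (φ i x)}
  zero_mem' := ⟨fun _ => zero_mem _, fun i j x _ => by ext v; simp⟩
  add_mem' := fun {φ ψ} hφ hψ => ⟨fun i => add_mem (hφ.1 i) (hψ.1 i), fun i j x hx => by
    ext v; simp [hφ.2 i j x hx, hψ.2 i j x hx]⟩
  smul_mem' := fun c φ hφ => ⟨fun i => Submodule.smul_mem _ c (hφ.1 i), fun i j x hx => by
    ext v; simp [hφ.2 i j x hx]⟩

/-- Families of local gauge fields `θ_i ∈ Ω¹(U_i; 𝔤)` with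
`θ_j = γ_ji · θ_i · γ_ij + γ_ji · dγ_ij` on overlaps. -/
def gaugeFields : Set (ι → Form EX X 1 EG) :=
  {θ | (∀ i, θ i ∈ formsOn EX 1 EG (T.U i)) ∧
    ∀ i j, ∀ x ∈ T.U i ∩ T.U j, ∀ v : EX,
      θ j x ![v] = Ad EG (T.trans j i x) (θ i x ![v]) + T.gaugeTerm i j x v}

/-- The family `φ` of local forms consists of the pullbacks `σ_i^* φ'` of the form `φ'` on `P`. -/
def Represents (φ : ι → Form EX X p V) (φ' : Form EP P p V) : Prop :=
  ∀ i, ∀ x ∈ T.U i, φ i x = pull EX EP (T.sec i) φ' x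

variable [IsManifold 𝓘(ℝ, EX) ∞ X] [IsManifold 𝓘(ℝ, EP) ∞ P]

/-- Families of `ℝ`-linear maps `b_i` from vector fields on `X` to `Ω⁰(U_i; 𝔤)` with
`b_j(ξ) = γ_ji · b_i(ξ) · γ_ij + γ_ji · ι_ξ dγ_ij` on overlaps. -/
def corrections : Set ((i : ι) → VF EX X →ₗ[ℝ] formsOn EX 0 EG (T.U i)) :=
  {b | ∀ i j, ∀ ξ : VF EX X, ∀ x ∈ T.U i ∩ T.U j,
    (b j ξ).1 x ![] = Ad EG (T.trans j i x) ((b i ξ).1 x ![]) + T.gaugeTerm i j x (ξ.val x)}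

/-- Pairs `(θ, l)` of a family of local gauge fields on `X` and an `ℝ`-linear map `l` from vector
fields on `X` to sections of the adjoint bundle. -/
abbrev BasePair : Type _ := T.gaugeFields × (VF EX X →ₗ[ℝ] T.assocForms (Ad EG) 0)

/-- The local `0`-form `ι_ξ θ - l_ξ` on `U_i` attached to a pair `(θ, l)`. -/
def BasePair.diff {T : TrivCover B ι} (q : T.BasePair) (ξ : VF EX X) (i : ι) : Form EX X 0 EG :=
  contr ξ.val (q.1.1 i) - (q.2 ξ).1 i

/-- Two pairs are equivalent if `ι_ξ θ - l_ξ = ι_ξ θ' - l'_ξ` for all `ξ`. -/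
def pairSetoid : Setoid T.BasePair where
  r q q' := ∀ ξ i, ∀ x ∈ T.U i, q.diff ξ i x = q'.diff ξ i x
  iseqv := ⟨fun _ _ _ _ _ => rfl, fun h ξ i x hx => (h ξ i x hx).symm,
    fun h h' ξ i x hx => (h ξ i x hx).trans (h' ξ i x hx)⟩

/-- The covariant Lie derivative of a matter field `φ` along `ξ` for the lift `l` is `ψ`: the
horizontal `G`-equivariant form `φ'` on `P` corresponding to `φ` has a horizontal `G`-equivariant
Lie derivative along the lift of `ξ`, and `ψ` corresponds to it. -/
def IsCovLieMatter (l : B.lifts) (a : G → V →L[ℝ] V) (ξ : VF EX X)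
    (φ ψ : T.assocForms a p) : Prop :=
  ∃ φ' ∈ B.tensorialForms a p, T.Represents φ.1 φ' ∧
    lieD (l.1 ξ).1.val φ' ∈ B.tensorialForms a p ∧ T.Represents ψ.1 (lieD (l.1 ξ).1.val φ')

/-- The covariant Lie derivative of a connection `θ` on `X` along `ξ` for the lift `l` is `ψ`: the
connection form `θ'` on `P` corresponding to `θ` has a horizontal `G`-equivariant Lie derivative
along the lift of `ξ`, and `ψ` corresponds to it. -/
def IsCovLieConnection (l : B.lifts) (ξ : VF EX X) (θ : T.gaugeFields)
    (ψ : T.assocForms (Ad EG) 1) : Prop :=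
  ∃ θ' ∈ B.connections, T.Represents θ.1 θ' ∧
    lieD (l.1 ξ).1.val θ' ∈ B.tensorialForms (Ad EG) 1 ∧
    T.Represents ψ.1 (lieD (l.1 ξ).1.val θ')

end TrivCover

end Bundles

end CovLie
end

noncomputable section

namespace CovLie

open Filter Topology

/-! ### Tangent maps, pullbacks and charts -/

section TangentMaps

variable {E : Type*} [NormedAddCommGroup E] [NormedSpace ℝ E]
  {F : Type*} [NormedAddCommGroup F] [NormedSpace ℝ F]
  {H : Type*} [NormedAddCommGroup H] [NormedSpace ℝ H]
  {M : Type*} [TopologicalSpace M] [ChartedSpace E M]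
  {N : Type*} [TopologicalSpace N] [ChartedSpace F N]
  {O : Type*} [TopologicalSpace O] [ChartedSpace H O]
  {V : Type*} [NormedAddCommGroup V] [NormedSpace ℝ V]
  {p : ℕ}

/-! A connection form θ on P splits tangent spaces: (dπ, θ) is an isomorphism of T_uP onto T_{π(u)}X
⊕ 𝔤. With θ fixed, an invariant field ξ~ over ξ is therefore the same as its vertical component λ_ξ
= θ(ξ~), an equivariant 𝔤-valued function, and a lift is the same as a linear map λ (`liftsEquiv`).
Connections exist because the local Maurer-Cartan forms g_i⁻¹ dg_i can be averaged with a partition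
of unity (`nonempty_connections`). Horizontal equivariant forms descend along the canonical sections
(`tensorialEquiv`). Connections form an affine space over such forms, so they descend too
(`connectionEquiv`).

On the base, B_ξ = ι_ξ ω - λ_ξ trades λ for B, since the inhomogeneous terms of B and of ω agree
(`correctionEquiv`). The bijection from lifts to B is built from a chosen connection but does not
depend on it: at σ_i(x) the fundamental vector generated by B_ξ(x) is dσ_i(ξ) - ξ~
(`fundamental_liftCorrection`). Applying any other connection form to this identity gives B_ξ = ι_ξ
ω - λ_ξ for that connection, which makes the three descriptions compatible.

For the Lie derivatives, dι + ιd is pulled back along σ_i with ξ~ replaced by dσ_i(ξ) - B_ξ^#. The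
part dσ_i(ξ) gives L_ξ of the local form. The vertical part rests on ι_{A^#} dφ = -ρ'(A) φ
(`d_apply_fundamental`), which is equivariance differentiated along an orbit. It holds for
horizontal forms and also for connection forms, because θ(A^#) is constant; `QuasiTensorial`
isolates what the two have in common. For a connection, ρ' is the bracket (`tmap_Ad_apply`), and
θ(B_ξ^#) = B_ξ contributes the further term -dB_ξ. The formulas in terms of (ω, λ) then follow from
the sign rule for contracting ω ∧ φ (`contr_wedge₁_add`). -/

theorem tmap_comp {g : N → O} {f : M → N} {x : M}
    (hg : MDifferentiableAt 𝓘(ℝ, F) 𝓘(ℝ, H) g (f x))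
    (hf : MDifferentiableAt 𝓘(ℝ, E) 𝓘(ℝ, F) f x) :
    tmap E H (fun y => g (f y)) x = (tmap F H g (f x)).comp (tmap E F f x) :=
  mfderiv_comp x hg hf

theorem tmap_comp_apply {g : N → O} {f : M → N} {x : M}
    (hg : MDifferentiableAt 𝓘(ℝ, F) 𝓘(ℝ, H) g (f x))
    (hf : MDifferentiableAt 𝓘(ℝ, E) 𝓘(ℝ, F) f x) (v : E) :
    tmap E H (fun y => g (f y)) x v = tmap F H g (f x) (tmap E F f x v) :=
  DFunLike.congr_fun (tmap_comp hg hf) v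

theorem tmap_congr {f g : M → N} {x : M} (h : f =ᶠ[𝓝 x] g) : tmap E F f x = tmap E F g x :=
  h.mfderiv_eq

theorem tmap_id (x : M) : tmap E E (fun y : M => y) x = ContinuousLinearMap.id ℝ E :=
  mfderiv_id

theorem tmap_const (c : N) (x : M) : tmap E F (fun _ : M => c) x = 0 :=
  mfderiv_const

theorem tmap_eq_fderiv (f : E → F) (x : E) : tmap E F f x = fderiv ℝ f x :=
  mfderiv_eq_fderiv

theorem pull_apply (f : M → N) (φ : Form F N p V) (x : M) (v : Fin p → E) :
    pull E F f φ x v = φ (f x) (fun k => tmap E F f x (v k)) := rfl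

theorem pull_congr {f g : M → N} {x : M} (h : f =ᶠ[𝓝 x] g) (φ : Form F N p V) :
    pull E F f φ x = pull E F g φ x := by
  simp only [pull, tmap_congr h, h.self_of_nhds]

theorem pull_comp {g : N → O} {f : M → N} {x : M}
    (hg : MDifferentiableAt 𝓘(ℝ, F) 𝓘(ℝ, H) g (f x))
    (hf : MDifferentiableAt 𝓘(ℝ, E) 𝓘(ℝ, F) f x) (φ : Form H O p V) :
    pull E H (fun y => g (f y)) φ x = pull E F f (pull F H g φ) x := by
  ext v
  simp only [pull_apply, tmap_comp hg hf]
  rfl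

/-- For a map smooth at a point, the neighbourhood on which it is C^n may shrink as n grows. The
chain rule needs only n = 1, and C¹ at a point does spread to a neighbourhood. -/
theorem eventually_mdifferentiableAt [IsManifold 𝓘(ℝ, E) ∞ M] [IsManifold 𝓘(ℝ, F) ∞ N]
    {f : M → N} {x : M} (hf : ContMDiffAt 𝓘(ℝ, E) 𝓘(ℝ, F) ∞ f x) :
    ∀ᶠ y in 𝓝 x, MDifferentiableAt 𝓘(ℝ, E) 𝓘(ℝ, F) f y := by
  have : IsManifold 𝓘(ℝ, E) 1 M := IsManifold.of_le (n := ∞) (by simp)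
  have : IsManifold 𝓘(ℝ, F) 1 N := IsManifold.of_le (n := ∞) (by simp)
  have h1 : ContMDiffAt 𝓘(ℝ, E) 𝓘(ℝ, F) 1 f x := hf.of_le (by simp)
  filter_upwards [(contMDiffAt_iff_contMDiffAt_nhds (by simp)).1 h1] with y hy
  exact hy.mdifferentiableAt (by simp)

variable [IsManifold 𝓘(ℝ, E) ∞ M] [IsManifold 𝓘(ℝ, F) ∞ N]

theorem contMDiffAt_chartAt {x₀ x : M} (hx : x ∈ (chartAt E x₀).source) :
    ContMDiffAt 𝓘(ℝ, E) 𝓘(ℝ, E) ∞ (chartAt E x₀) x :=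
  (contMDiffOn_chart (x := x₀)).contMDiffAt ((chartAt E x₀).open_source.mem_nhds hx)

theorem contMDiffAt_chartAt_symm {x₀ : M} {y : E} (hy : y ∈ (chartAt E x₀).target) :
    ContMDiffAt 𝓘(ℝ, E) 𝓘(ℝ, E) ∞ (chartAt E x₀).symm y :=
  (contMDiffOn_chart_symm (x := x₀)).contMDiffAt ((chartAt E x₀).open_target.mem_nhds hy)

theorem mdifferentiableAt_chartAt {x₀ x : M} (hx : x ∈ (chartAt E x₀).source) :
    MDifferentiableAt 𝓘(ℝ, E) 𝓘(ℝ, E) (chartAt E x₀) x :=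
  (contMDiffAt_chartAt hx).mdifferentiableAt (by simp)

theorem mdifferentiableAt_chartAt_symm {x₀ : M} {y : E} (hy : y ∈ (chartAt E x₀).target) :
    MDifferentiableAt 𝓘(ℝ, E) 𝓘(ℝ, E) (chartAt E x₀).symm y :=
  (contMDiffAt_chartAt_symm hy).mdifferentiableAt (by simp)

theorem tmap_chart_symm_tmap_chart {x₀ x : M} (hx : x ∈ (chartAt E x₀).source) (v : E) :
    tmap E E (chartAt E x₀).symm (chartAt E x₀ x) (tmap E E (chartAt E x₀) x v) = v := by
  rw [← tmap_comp_apply (g := (chartAt E x₀).symm) (f := chartAt E x₀)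
    (mdifferentiableAt_chartAt_symm ((chartAt E x₀).map_source hx)) (mdifferentiableAt_chartAt hx),
    tmap_congr (g := fun y => y), tmap_id]
  · rfl
  · filter_upwards [(chartAt E x₀).open_source.mem_nhds hx] with y hy
    exact (chartAt E x₀).left_inv hy

theorem tmap_chart_tmap_chart_symm {x₀ : M} {y : E} (hy : y ∈ (chartAt E x₀).target) (v : E) :
    tmap E E (chartAt E x₀) ((chartAt E x₀).symm y) (tmap E E (chartAt E x₀).symm y v) = v := by
  rw [← tmap_comp_apply (f := (chartAt E x₀).symm) (g := chartAt E x₀)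
    (mdifferentiableAt_chartAt ((chartAt E x₀).map_target hy)) (mdifferentiableAt_chartAt_symm hy),
    tmap_congr (g := fun y => y), tmap_id]
  · rfl
  · filter_upwards [(chartAt E x₀).open_target.mem_nhds hy] with y hy
    exact (chartAt E x₀).right_inv hy

end TangentMaps

/-! ### Smooth families of alternating forms -/

section AlternatingSmoothness

variable {E : Type*} [NormedAddCommGroup E] [NormedSpace ℝ E]
  {F : Type*} [NormedAddCommGroup F] [NormedSpace ℝ F]
  {V : Type*} [NormedAddCommGroup V] [NormedSpace ℝ V]
  {p : ℕ}

set_option synthInstance.maxHeartbeats 200000 in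
theorem contDiff_curryLeft {n : WithTop ℕ∞} : ContDiff ℝ n
    (ContinuousAlternatingMap.curryLeft :
      E [⋀^Fin (p + 1)]→L[ℝ] V → (E →L[ℝ] E [⋀^Fin p]→L[ℝ] V)) := by
  apply IsBoundedLinearMap.contDiff
  refine ⟨⟨fun _ _ => rfl, fun _ _ => rfl⟩, 1, one_pos, fun x => ?_⟩
  rw [one_mul]
  exact ((ContinuousAlternatingMap.curryLeftLI (𝕜 := ℝ) (E := E) (F := V) (n := p)).norm_map x).le

set_option synthInstance.maxHeartbeats 200000 in
theorem contDiffAt_curryLeft {n : WithTop ℕ∞} {ψ : F → E [⋀^Fin (p + 1)]→L[ℝ] V} {w : F → E} {y : F}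
    (hψ : ContDiffAt ℝ n ψ y) (hw : ContDiffAt ℝ n w y) :
    ContDiffAt ℝ n (fun z => (ψ z).curryLeft (w z)) y := by
  exact (contDiff_curryLeft.contDiffAt.comp y hψ).clm_apply hw

/-- Currying off one argument at a time reduces the evaluation to that of continuous linear maps, by
induction on the degree. -/
theorem contDiffAt_alternating_apply {n : WithTop ℕ∞} : ∀ {p : ℕ}
    {ψ : F → E [⋀^Fin p]→L[ℝ] V} {w : Fin p → F → E} {y : F}, ContDiffAt ℝ n ψ y →
    (∀ k, ContDiffAt ℝ n (w k) y) → ContDiffAt ℝ n (fun z => ψ z (fun k => w k z)) y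
  | 0, ψ, w, y, hψ, _ => by
    have h := (ContinuousAlternatingMap.constOfIsEmptyLIE ℝ E V
      (Fin 0)).symm.toContinuousLinearEquiv.contDiff.contDiffAt.comp y hψ
    refine h.congr_of_eventuallyEq (Eventually.of_forall fun z => ?_)
    exact congrArg (ψ z) (Subsingleton.elim _ _)
  | p + 1, ψ, w, y, hψ, hw => by
    have h := contDiffAt_alternating_apply (contDiffAt_curryLeft hψ (hw 0))
      (fun k => hw (Fin.succ k))
    refine h.congr_of_eventuallyEq (Eventually.of_forall fun z => ?_)
    simp only [ContinuousAlternatingMap.curryLeft_apply_apply]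
    congr 1
    ext k
    refine Fin.cases ?_ (fun k => ?_) k <;> rfl

variable [FiniteDimensional ℝ E]

/-- A form is determined by its values on tuples of basis vectors. This evaluation is linear and
injective, and in finite dimension its linear left inverse is continuous, so the form is recovered
smoothly from its values. -/
theorem contDiffAt_alternating [FiniteDimensional ℝ V] {n : WithTop ℕ∞}
    {ψ : F → E [⋀^Fin p]→L[ℝ] V} {y : F} (h : ∀ v, ContDiffAt ℝ n (fun z => ψ z v) y) :
    ContDiffAt ℝ n ψ y := by
  let b := Module.finBasis ℝ E
  let L : (E [⋀^Fin p]→L[ℝ] V) →ₗ[ℝ] ((Fin p → Fin (Module.finrank ℝ E)) → V) :=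
    { toFun := fun f s => f (fun k => b (s k))
      map_add' := fun _ _ => rfl
      map_smul' := fun _ _ => rfl }
  have hL : LinearMap.ker L = ⊥ := LinearMap.ker_eq_bot.2 fun f g h => by
    apply ContinuousAlternatingMap.toAlternatingMap_injective
    exact Module.Basis.ext_alternating b fun s _ => congrFun h s
  obtain ⟨K, hK⟩ := L.exists_leftInverse_of_injective hL
  have h1 : ContDiffAt ℝ n (fun z => L (ψ z)) y := contDiffAt_pi.2 fun s => h _
  have h2 := (LinearMap.toContinuousLinearMap K).contDiff.contDiffAt.comp y h1
  refine h2.congr_of_eventuallyEq (Eventually.of_forall fun z => ?_)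
  exact (LinearMap.congr_fun hK (ψ z)).symm

theorem contDiffAt_compContinuousLinearMap [FiniteDimensional ℝ V]
    {H : Type*} [NormedAddCommGroup H] [NormedSpace ℝ H] {n : WithTop ℕ∞}
    {ψ : F → H [⋀^Fin p]→L[ℝ] V} {A : F → E →L[ℝ] H} {y : F}
    (hψ : ContDiffAt ℝ n ψ y) (hA : ContDiffAt ℝ n A y) :
    ContDiffAt ℝ n (fun z => (ψ z).compContinuousLinearMap (A z)) y :=
  contDiffAt_alternating fun v => contDiffAt_alternating_apply
    (w := fun k z => A z (v k)) hψ fun _ => hA.clm_apply contDiffAt_const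

theorem contDiffAt_compContinuousAlternatingMap [FiniteDimensional ℝ V]
    {n : WithTop ℕ∞} {ψ : F → E [⋀^Fin p]→L[ℝ] V} {A : F → V →L[ℝ] V} {y : F}
    (hψ : ContDiffAt ℝ n ψ y) (hA : ContDiffAt ℝ n A y) :
    ContDiffAt ℝ n (fun z => (A z).compContinuousAlternatingMap (ψ z)) y :=
  contDiffAt_alternating fun v => hA.clm_apply
    (contDiffAt_alternating_apply (w := fun k _ => v k) hψ fun _ => contDiffAt_const)

end AlternatingSmoothness

/-! ### Smooth forms on manifolds: charts, exterior derivative, pullback -/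

section SmoothForms

variable {E : Type*} [NormedAddCommGroup E] [NormedSpace ℝ E]
  {F : Type*} [NormedAddCommGroup F] [NormedSpace ℝ F]
  {M : Type*} [TopologicalSpace M] [ChartedSpace E M]
  {N : Type*} [TopologicalSpace N] [ChartedSpace F N]
  {V : Type*} [NormedAddCommGroup V] [NormedSpace ℝ V]
  {p : ℕ}

/-- Smoothness of a differential form at a point, in the preferred chart there. -/
def FormSmoothAt (φ : Form E M p V) (x : M) : Prop :=
  ContDiffAt ℝ ∞ (inChart x φ) (chartAt E x x)

/-- The coordinate expression of a vector field in the preferred chart around `x₀`. -/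
def vfInChart (x₀ : M) (Z : M → E) (y : E) : E :=
  tmap E E (chartAt E x₀) ((chartAt E x₀).symm y) (Z ((chartAt E x₀).symm y))

theorem d_eq_pull (φ : Form E M p V) (x : M) :
    d φ x = pull E E (chartAt E x) (extDeriv (inChart x φ)) x := rfl

theorem inChart_congr {φ ψ : Form E M p V} {x : M} (h : φ =ᶠ[𝓝 x] ψ) :
    inChart x φ =ᶠ[𝓝 (chartAt E x x)] inChart x ψ := by
  have hc : Tendsto (chartAt E x).symm (𝓝 (chartAt E x x)) (𝓝 x) := by
    have := (chartAt E x).continuousAt_symm ((chartAt E x).map_source (mem_chart_source E x))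
    rw [ContinuousAt, (chartAt E x).left_inv (mem_chart_source E x)] at this
    exact this
  filter_upwards [hc.eventually h] with y hy
  simp only [inChart, pull, hy]

theorem d_congr {φ ψ : Form E M p V} {x : M} (h : φ =ᶠ[𝓝 x] ψ) : d φ x = d ψ x := by
  simp only [d, (inChart_congr h).extDeriv_eq]

theorem FormSmoothAt.congr {φ ψ : Form E M p V} {x : M} (hφ : FormSmoothAt φ x)
    (h : ψ =ᶠ[𝓝 x] φ) : FormSmoothAt ψ x :=
  ContDiffAt.congr_of_eventuallyEq hφ (inChart_congr h)

theorem FormSmoothAt.add {φ ψ : Form E M p V} {x : M} (hφ : FormSmoothAt φ x)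
    (hψ : FormSmoothAt ψ x) : FormSmoothAt (φ + ψ) x :=
  ContDiffAt.add hφ hψ

theorem FormSmoothAt.neg {φ : Form E M p V} {x : M} (hφ : FormSmoothAt φ x) :
    FormSmoothAt (-φ) x := by
  refine ContDiffAt.congr_of_eventuallyEq (ContDiffAt.neg hφ) (Eventually.of_forall fun y => ?_)
  ext v
  simp [inChart, pull_apply]

theorem d_add {φ ψ : Form E M p V} {x : M} (hφ : FormSmoothAt φ x) (hψ : FormSmoothAt ψ x) :
    d (φ + ψ) x = d φ x + d ψ x := by
  have h := extDeriv_add (hφ.differentiableAt (by simp)) (hψ.differentiableAt (by simp))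
  ext v
  exact DFunLike.congr_fun h _

theorem d_neg (φ : Form E M p V) (x : M) : d (-φ) x = -d φ x := by
  have h := extDeriv_smul (x := chartAt E x x) (-1 : ℝ) (inChart x φ)
  have h' : inChart x (-φ) = (-1 : ℝ) • inChart x φ := by
    funext y
    ext v
    simp [inChart, pull_apply]
  ext v
  rw [d, h', h]
  simp [d]

theorem d_sub {φ ψ : Form E M p V} {x : M} (hφ : FormSmoothAt φ x) (hψ : FormSmoothAt ψ x) :
    d (φ - ψ) x = d φ x - d ψ x := by
  rw [sub_eq_add_neg, d_add hφ hψ.neg, d_neg, sub_eq_add_neg]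

variable [IsManifold 𝓘(ℝ, E) ∞ M] [IsManifold 𝓘(ℝ, F) ∞ N]

/-- Near `y`, the pullback along `f` is the pullback of the coordinate expression along the
coordinate expression of `f`. -/
theorem pull_eventuallyEq_pull_inChart {f : N → M} {y : N}
    (hf : ContMDiffAt 𝓘(ℝ, F) 𝓘(ℝ, E) ∞ f y) {x₀ : M} (hx : f y ∈ (chartAt E x₀).source)
    (φ : Form E M p V) :
    pull F E f φ =ᶠ[𝓝 y] pull F E (fun z => chartAt E x₀ (f z)) (inChart x₀ φ) := by
  have hs := hf.continuousAt.preimage_mem_nhds ((chartAt E x₀).open_source.mem_nhds hx)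
  filter_upwards [eventually_mdifferentiableAt hf, eventually_mem_nhds_iff.2 hs] with z hz hzs
  have hz' : f z ∈ (chartAt E x₀).source := mem_of_mem_nhds (s := f ⁻¹' _) hzs
  rw [inChart, ← pull_comp (f := fun z => chartAt E x₀ (f z))
    (mdifferentiableAt_chartAt_symm ((chartAt E x₀).map_source hz'))
    ((mdifferentiableAt_chartAt hz').comp z hz)]
  apply pull_congr
  filter_upwards [hzs] with w hw
  exact ((chartAt E x₀).left_inv hw).symm

section Vector

variable [FiniteDimensional ℝ F] [FiniteDimensional ℝ V]

theorem contDiffAt_pull_vector {H : Type*} [NormedAddCommGroup H] [NormedSpace ℝ H]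
    {f : F → H} {y : F} (hf : ContDiffAt ℝ ∞ f y)
    {ψ : H → H [⋀^Fin p]→L[ℝ] V} (hψ : ContDiffAt ℝ ∞ ψ (f y)) :
    ContDiffAt ℝ ∞ (pull F H f ψ) y := by
  have h1 : ContDiffAt ℝ ∞ (fderiv ℝ f) y := hf.fderiv_right (by simp)
  have h2 := contDiffAt_compContinuousLinearMap (ContDiffAt.comp y hψ hf) h1
  refine h2.congr_of_eventuallyEq (Eventually.of_forall fun z => ?_)
  simp only [pull, tmap_eq_fderiv, Function.comp]

theorem contDiffAt_pull {f : F → M} {y : F} (hf : ContMDiffAt 𝓘(ℝ, F) 𝓘(ℝ, E) ∞ f y)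
    {φ : Form E M p V} (hφ : FormSmoothAt φ (f y)) : ContDiffAt ℝ ∞ (pull F E f φ) y := by
  have hc : ContDiffAt ℝ ∞ (fun z => chartAt E (f y) (f z)) y :=
    (ContMDiffAt.comp y (contMDiffAt_chartAt (mem_chart_source E (f y))) hf).contDiffAt
  exact (contDiffAt_pull_vector hc hφ).congr_of_eventuallyEq
    (pull_eventuallyEq_pull_inChart hf (mem_chart_source E (f y)) φ)

/-- Through the chart at `f y` the pullback becomes one between vector spaces, where it commutes
with the exterior derivative. The chain rule then absorbs the derivative of the chart. -/
theorem extDeriv_pull {f : F → M} {y : F} (hf : ContMDiffAt 𝓘(ℝ, F) 𝓘(ℝ, E) ∞ f y)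
    {φ : Form E M p V} (hφ : FormSmoothAt φ (f y)) :
    extDeriv (pull F E f φ) y = pull F E f (d φ) y := by
  have hc : ContDiffAt ℝ ∞ (fun z => chartAt E (f y) (f z)) y :=
    (ContMDiffAt.comp y (contMDiffAt_chartAt (mem_chart_source E (f y))) hf).contDiffAt
  rw [(pull_eventuallyEq_pull_inChart hf (mem_chart_source E (f y)) φ).extDeriv_eq]
  have h := _root_.extDeriv_pullback (E := F)
    (show DifferentiableAt ℝ (inChart (f y) φ) _ from hφ.differentiableAt (by simp)) hc (by
    rw [minSmoothness_of_isRCLikeNormedField]; exact WithTop.coe_le_coe.2 (le_top : (2 : ℕ∞) ≤ ⊤))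
  have h' : pull F E (fun z => chartAt E (f y) (f z)) (inChart (f y) φ) =
      fun x => (inChart (f y) φ (chartAt E (f y) (f x))).compContinuousLinearMap
        (fderiv ℝ (fun z => chartAt E (f y) (f z)) x) := by
    funext x
    simp only [pull, tmap_eq_fderiv]
  rw [h', h]
  ext v
  rw [pull_apply, d, ← tmap_eq_fderiv, tmap_comp
    (mdifferentiableAt_chartAt (mem_chart_source E (f y))) (hf.mdifferentiableAt (by simp))]
  rfl

end Vector

theorem inChart_pull_eventuallyEq {f : N → M} {y y₀ : N} (hy : y ∈ (chartAt F y₀).source)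
    (hf : ContMDiffAt 𝓘(ℝ, F) 𝓘(ℝ, E) ∞ f y) (φ : Form E M p V) :
    inChart y₀ (pull F E f φ) =ᶠ[𝓝 (chartAt F y₀ y)]
      pull F E (fun z => f ((chartAt F y₀).symm z)) φ := by
  have hs : ContinuousAt (chartAt F y₀).symm (chartAt F y₀ y) :=
    (chartAt F y₀).continuousAt_symm ((chartAt F y₀).map_source hy)
  have h1 := eventually_mdifferentiableAt hf
  rw [← (chartAt F y₀).left_inv hy] at h1
  filter_upwards [hs.eventually h1,
    (chartAt F y₀).open_target.mem_nhds ((chartAt F y₀).map_source hy)] with z hz hzt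
  exact (pull_comp hz (mdifferentiableAt_chartAt_symm hzt) φ).symm

section

variable [FiniteDimensional ℝ F] [FiniteDimensional ℝ V]

theorem contDiffAt_inChart_pull {f : N → M} {y y₀ : N} (hy : y ∈ (chartAt F y₀).source)
    (hf : ContMDiffAt 𝓘(ℝ, F) 𝓘(ℝ, E) ∞ f y) {φ : Form E M p V} (hφ : FormSmoothAt φ (f y)) :
    ContDiffAt ℝ ∞ (inChart y₀ (pull F E f φ)) (chartAt F y₀ y) := by
  refine (contDiffAt_pull ?_ ?_).congr_of_eventuallyEq (inChart_pull_eventuallyEq hy hf φ)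
  · refine ContMDiffAt.comp _ ?_ (contMDiffAt_chartAt_symm ((chartAt F y₀).map_source hy))
    rwa [(chartAt F y₀).left_inv hy]
  · rwa [(chartAt F y₀).left_inv hy]

theorem FormSmoothAt.pull {f : N → M} {y : N}
    (hf : ContMDiffAt 𝓘(ℝ, F) 𝓘(ℝ, E) ∞ f y) {φ : Form E M p V} (hφ : FormSmoothAt φ (f y)) :
    FormSmoothAt (CovLie.pull F E f φ) y :=
  contDiffAt_inChart_pull (mem_chart_source F y) hf hφ

end

section

variable [FiniteDimensional ℝ E] [FiniteDimensional ℝ V]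

theorem FormSmoothAt.contDiffAt_inChart {φ : Form E M p V} {x x₀ : M} (hφ : FormSmoothAt φ x)
    (hx : x ∈ (chartAt E x₀).source) : ContDiffAt ℝ ∞ (inChart x₀ φ) (chartAt E x₀ x) := by
  refine contDiffAt_pull (contMDiffAt_chartAt_symm ((chartAt E x₀).map_source hx)) ?_
  rwa [(chartAt E x₀).left_inv hx]

/-- `formsOn` tests every preferred chart. Since a change of chart is a pullback along a smooth map,
testing each point in its own chart is enough. -/
theorem mem_formsOn_iff {φ : Form E M p V} {U : Set M} (hU : IsOpen U) :
    φ ∈ formsOn E p V U ↔ (∀ x ∈ U, FormSmoothAt φ x) ∧ ∀ x, x ∉ U → φ x = 0 := by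
  refine and_congr_left fun _ => ⟨fun h x hx => ?_, fun h x₀ => ?_⟩
  · refine (h x).contDiffAt (((chartAt E x).isOpen_inter_preimage_symm hU).mem_nhds
      ⟨(chartAt E x).map_source (mem_chart_source E x), ?_⟩)
    rwa [mem_preimage, (chartAt E x).left_inv (mem_chart_source E x)]
  · rintro y ⟨hy, hyU⟩
    have := (h _ hyU).contDiffAt_inChart ((chartAt E x₀).map_target hy)
    rw [(chartAt E x₀).right_inv hy] at this
    exact this.contDiffWithinAt

theorem inChart_d_eventuallyEq {φ : Form E M p V} {x : M} (h : ∀ᶠ y in 𝓝 x, FormSmoothAt φ y) :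
    inChart x (d φ) =ᶠ[𝓝 (chartAt E x x)] extDeriv (inChart x φ) := by
  have hx' := (chartAt E x).map_source (mem_chart_source E x)
  have hs := (chartAt E x).continuousAt_symm hx'
  rw [← (chartAt E x).left_inv (mem_chart_source E x)] at h
  filter_upwards [hs.eventually h, (chartAt E x).open_target.mem_nhds hx'] with y hy hyt
  exact (extDeriv_pull (contMDiffAt_chartAt_symm hyt) hy).symm

set_option synthInstance.maxHeartbeats 200000 in
theorem FormSmoothAt.d {φ : Form E M p V} {x : M} (h : ∀ᶠ y in 𝓝 x, FormSmoothAt φ y) :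
    FormSmoothAt (d φ) x := by
  refine ContDiffAt.congr_of_eventuallyEq ?_ (inChart_d_eventuallyEq h)
  have h1 : ContDiffAt ℝ ∞ (fderiv ℝ (inChart x φ)) (chartAt E x x) :=
    ContDiffAt.fderiv_right h.self_of_nhds (by simp)
  exact (ContinuousAlternatingMap.alternatizeUncurryFinCLM ℝ E V).contDiff.contDiffAt.comp _ h1

theorem FormSmoothAt.contr {φ : Form E M (p + 1) V} {x : M} {Z : M → E} (hφ : FormSmoothAt φ x)
    (hZ : ContDiffAt ℝ ∞ (vfInChart x Z) (chartAt E x x)) : FormSmoothAt (contr Z φ) x := by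
  refine (contDiffAt_curryLeft hφ hZ).congr_of_eventuallyEq ?_
  filter_upwards [(chartAt E x).open_target.mem_nhds
    ((chartAt E x).map_source (mem_chart_source E x))] with y hy
  ext v
  have h := tmap_chart_symm_tmap_chart ((chartAt E x).map_target hy) (Z ((chartAt E x).symm y))
  rw [(chartAt E x).right_inv hy] at h
  simp only [inChart, pull_apply, CovLie.contr, ContinuousAlternatingMap.curryLeft_apply_apply,
    vfInChart]
  congr 1
  ext k
  refine Fin.cases ?_ (fun k => ?_) k
  · exact h.symm
  · rfl

theorem FormSmoothAt.comp_clm {φ : Form E M p V} {x : M} (hφ : FormSmoothAt φ x)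
    {A : M → V →L[ℝ] V} (hA : ContMDiffAt 𝓘(ℝ, E) 𝓘(ℝ, V →L[ℝ] V) ∞ A x) :
    FormSmoothAt (fun y => (A y).compContinuousAlternatingMap (φ y)) x := by
  have hx' := (chartAt E x).map_source (mem_chart_source E x)
  have h1 : ContDiffAt ℝ ∞ (fun y => A ((chartAt E x).symm y)) (chartAt E x x) := by
    refine (ContMDiffAt.comp (chartAt E x x) ?_ (contMDiffAt_chartAt_symm hx')).contDiffAt
    rwa [(chartAt E x).left_inv (mem_chart_source E x)]
  exact contDiffAt_compContinuousAlternatingMap hφ h1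

theorem FormSmoothAt.smul {φ : Form E M p V} {x : M} (hφ : FormSmoothAt φ x)
    {f : M → ℝ} (hf : ContMDiffAt 𝓘(ℝ, E) 𝓘(ℝ, ℝ) ∞ f x) :
    FormSmoothAt (fun y => f y • φ y) x := by
  have hx' := (chartAt E x).map_source (mem_chart_source E x)
  have h1 : ContDiffAt ℝ ∞ (fun y => f ((chartAt E x).symm y)) (chartAt E x x) := by
    refine (ContMDiffAt.comp (chartAt E x x) ?_ (contMDiffAt_chartAt_symm hx')).contDiffAt
    rwa [(chartAt E x).left_inv (mem_chart_source E x)]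
  exact ContDiffAt.smul h1 hφ

end

/-- Reduces to `extDeriv_pull` by composing `f` with the inverse of the preferred chart at `y`. -/
theorem d_pull [FiniteDimensional ℝ F] [FiniteDimensional ℝ V] {f : N → M} {y : N}
    (hf : ContMDiffAt 𝓘(ℝ, F) 𝓘(ℝ, E) ∞ f y)
    {φ : Form E M p V} (hφ : FormSmoothAt φ (f y)) :
    d (pull F E f φ) y = pull F E f (d φ) y := by
  have hy := mem_chart_source F y
  have hy' := (chartAt F y).map_source hy
  have hl : (chartAt F y).symm (chartAt F y y) = y := (chartAt F y).left_inv hy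
  have hc : ContMDiffAt 𝓘(ℝ, F) 𝓘(ℝ, E) ∞ (fun z => f ((chartAt F y).symm z))
      (chartAt F y y) := by
    refine ContMDiffAt.comp _ ?_ (contMDiffAt_chartAt_symm hy')
    rwa [hl]
  have h1 : extDeriv (inChart y (pull F E f φ)) (chartAt F y y) =
      pull F E (fun z => f ((chartAt F y).symm z)) (d φ) (chartAt F y y) := by
    rw [(inChart_pull_eventuallyEq hy hf φ).extDeriv_eq, extDeriv_pull hc (by rwa [hl])]
  have h2 : d (pull F E f φ) y = pull F F (chartAt F y)
      (pull F E (fun z => f ((chartAt F y).symm z)) (d φ)) y := by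
    rw [d_eq_pull]
    simp only [pull] at h1 ⊢
    rw [h1]
  rw [h2, ← pull_comp (hc.mdifferentiableAt (by simp)) (mdifferentiableAt_chartAt hy)]
  apply pull_congr
  filter_upwards [(chartAt F y).open_source.mem_nhds hy] with z hz
  rw [(chartAt F y).left_inv hz]

end SmoothForms

/-! ### Charts at their base points, and partial derivatives -/

section ChartAtSelf

variable {E : Type*} [NormedAddCommGroup E] [NormedSpace ℝ E]
  {M : Type*} [TopologicalSpace M] [ChartedSpace E M] [IsManifold 𝓘(ℝ, E) ∞ M]

/-- The tangent space at `x` is identified with `E` through the preferred chart at `x` itself, so in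
this identification the chart has derivative the identity. -/
theorem tmap_chart_self (x : M) : tmap E E (chartAt E x) x = ContinuousLinearMap.id ℝ E := by
  have : IsManifold 𝓘(ℝ, E) 1 M := IsManifold.of_le (n := ∞) (by simp)
  exact mfderiv_extChartAt_self (I := 𝓘(ℝ, E)) (x := x)

theorem tmap_chart_symm_self (x : M) :
    tmap E E (chartAt E x).symm (chartAt E x x) = ContinuousLinearMap.id ℝ E := by
  ext v
  have h := tmap_chart_symm_tmap_chart (mem_chart_source E x) v
  rwa [tmap_chart_self] at h

end ChartAtSelf

section PartialDerivatives

variable {E : Type*} [NormedAddCommGroup E] [NormedSpace ℝ E]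
  {F : Type*} [NormedAddCommGroup F] [NormedSpace ℝ F]
  {H : Type*} [NormedAddCommGroup H] [NormedSpace ℝ H]

theorem fderiv_partial_right {m : E × F → H} {z : E} {y : F} (h : DifferentiableAt ℝ m (z, y)) :
    fderiv ℝ (fun w => m (z, w)) y = (fderiv ℝ m (z, y)).comp (.inr ℝ E F) :=
  (HasFDerivAt.comp (f := fun w => (z, w)) y h.hasFDerivAt
    (hasFDerivAt_prodMk_right z y)).fderiv

theorem fderiv_partial_left {m : E × F → H} {z : E} {y : F} (h : DifferentiableAt ℝ m (z, y)) :
    fderiv ℝ (fun w => m (w, y)) z = (fderiv ℝ m (z, y)).comp (.inl ℝ E F) :=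
  (HasFDerivAt.comp (f := fun w => (w, y)) z h.hasFDerivAt
    (hasFDerivAt_prodMk_left z y)).fderiv

end PartialDerivatives

/-! ### Lie groups: translations and the adjoint representation -/

section LieGroups

variable (EG : Type*) [NormedAddCommGroup EG] [NormedSpace ℝ EG]
  {G : Type*} [TopologicalSpace G] [ChartedSpace EG G] [Group G]

/-- A smooth representation of `G` on `V`. -/
structure SmoothRep {V : Type*} [NormedAddCommGroup V] [NormedSpace ℝ V]
    (a : G → V →L[ℝ] V) : Prop where
  one : a 1 = ContinuousLinearMap.id ℝ V
  mul : ∀ g h, a (g * h) = (a g).comp (a h)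
  smooth : ContMDiff 𝓘(ℝ, EG) 𝓘(ℝ, V →L[ℝ] V) ∞ a

variable {EG} in
theorem SmoothRep.inv_apply_apply {V : Type*} [NormedAddCommGroup V] [NormedSpace ℝ V]
    {a : G → V →L[ℝ] V} (ha : SmoothRep EG a) (g : G) (v : V) : a g⁻¹ (a g v) = v := by
  rw [← ContinuousLinearMap.comp_apply, ← ha.mul, inv_mul_cancel, ha.one]
  rfl

variable [LieGroup 𝓘(ℝ, EG) ∞ G]

theorem mdifferentiableAt_mul_left (g h : G) :
    MDifferentiableAt 𝓘(ℝ, EG) 𝓘(ℝ, EG) (fun k : G => g * k) h :=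
  (contMDiff_mul_left (I := 𝓘(ℝ, EG)) (n := ∞) (a := g)).mdifferentiableAt (by simp)

theorem mdifferentiableAt_mul_right (g h : G) :
    MDifferentiableAt 𝓘(ℝ, EG) 𝓘(ℝ, EG) (fun k : G => k * g) h :=
  (contMDiff_mul_right (I := 𝓘(ℝ, EG)) (n := ∞) (a := g)).mdifferentiableAt (by simp)

theorem contMDiff_conj (g : G) :
    ContMDiff 𝓘(ℝ, EG) 𝓘(ℝ, EG) ∞ (fun k : G => g * k * g⁻¹) :=
  (contMDiff_mul_right (a := g⁻¹)).comp contMDiff_mul_left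

theorem mdifferentiableAt_conj (g h : G) :
    MDifferentiableAt 𝓘(ℝ, EG) 𝓘(ℝ, EG) (fun k : G => g * k * g⁻¹) h :=
  (contMDiff_conj EG g).mdifferentiableAt (by simp)

theorem leftMul_one (h : G) : leftMul EG 1 h = ContinuousLinearMap.id ℝ EG := by
  simp only [leftMul, one_mul, tmap_id]

theorem leftMul_leftMul (g h k : G) (v : EG) :
    leftMul EG g (h * k) (leftMul EG h k v) = leftMul EG (g * h) k v := by
  simp only [leftMul, mul_assoc]
  exact (tmap_comp_apply (g := fun l : G => g * l) (f := fun l : G => h * l)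
    (mdifferentiableAt_mul_left EG _ _) (mdifferentiableAt_mul_left EG _ _) v).symm

theorem leftMul_inv_leftMul (g h : G) (v : EG) :
    leftMul EG g⁻¹ (g * h) (leftMul EG g h v) = v := by
  rw [leftMul_leftMul, inv_mul_cancel, leftMul_one]
  rfl

theorem tmap_mul_left {E M : Type*} [NormedAddCommGroup E] [NormedSpace ℝ E] [TopologicalSpace M]
    [ChartedSpace E M] {f : M → G} {x : M} (hf : MDifferentiableAt 𝓘(ℝ, E) 𝓘(ℝ, EG) f x) (g : G)
    (v : E) : tmap E EG (fun y => g * f y) x v = leftMul EG g (f x) (tmap E EG f x v) :=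
  tmap_comp_apply (mdifferentiableAt_mul_left EG _ _) hf v

theorem Ad_one : Ad EG (1 : G) = ContinuousLinearMap.id ℝ EG := by
  simp only [Ad, one_mul, inv_one, mul_one, tmap_id]

theorem Ad_mul (g h : G) : Ad EG (g * h) = (Ad EG g).comp (Ad EG h) := by
  have h1 : (fun k : G => g * h * k * (g * h)⁻¹) = fun k : G => g * (h * k * h⁻¹) * g⁻¹ := by
    funext k
    group
  have h2 := tmap_comp (g := fun k : G => g * k * g⁻¹) (f := fun k : G => h * k * h⁻¹) (x := 1)
    (mdifferentiableAt_conj EG _ _) (mdifferentiableAt_conj EG _ _)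
  simp only [mul_one, mul_inv_cancel] at h2
  rw [Ad, h1, h2]
  rfl

/-- The Maurer-Cartan form transforms under right translations by the adjoint representation. -/
theorem leftMul_inv_tmap_mul_right (g h : G) (v : EG) :
    leftMul EG (g * h)⁻¹ (g * h) (tmap EG EG (fun k : G => k * h) g v) =
      Ad EG h⁻¹ (leftMul EG g⁻¹ g v) := by
  have h1 := tmap_comp_apply (g := fun k : G => (g * h)⁻¹ * k) (f := fun k : G => k * h) (x := g)
    (mdifferentiableAt_mul_left EG _ _) (mdifferentiableAt_mul_right EG _ _) v
  have h2 := tmap_comp_apply (g := fun k : G => h⁻¹ * k * h⁻¹⁻¹) (f := fun k : G => g⁻¹ * k)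
    (x := g) (mdifferentiableAt_conj EG _ _) (mdifferentiableAt_mul_left EG _ _) v
  rw [inv_mul_cancel] at h2
  have h3 : (fun k : G => (g * h)⁻¹ * (k * h)) = fun k : G => h⁻¹ * (g⁻¹ * k) * h⁻¹⁻¹ := by
    funext k
    group
  rw [h3, h2] at h1
  exact h1.symm

/-- The product of two elements near `g₀` and `h₀`, in the chart around `k₀`. -/
def mulInChart (g₀ h₀ k₀ : G) (z : EG × EG) : EG :=
  chartAt EG k₀ ((chartAt EG g₀).symm z.1 * (chartAt EG h₀).symm z.2)

/-- The chart at `1`, evaluated at `1`. -/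
def chartOne (G : Type*) [TopologicalSpace G] [ChartedSpace EG G] [Group G] : EG :=
  chartAt EG (1 : G) 1

theorem chartOne_mem_target : chartOne EG G ∈ (chartAt EG (1 : G)).target :=
  (chartAt EG (1 : G)).map_source (mem_chart_source EG 1)

theorem chartAt_symm_chartOne : (chartAt EG (1 : G)).symm (chartOne EG G) = 1 :=
  (chartAt EG (1 : G)).left_inv (mem_chart_source EG 1)

theorem contMDiffAt_chart_symm_fst {z : EG × EG} {g₀ : G} (hz : z.1 ∈ (chartAt EG g₀).target) :
    ContMDiffAt 𝓘(ℝ, EG × EG) 𝓘(ℝ, EG) ∞ (fun w : EG × EG => (chartAt EG g₀).symm w.1) z :=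
  ContMDiffAt.comp z (contMDiffAt_chartAt_symm hz) contDiff_fst.contMDiff.contMDiffAt

theorem contMDiffAt_chart_symm_snd {z : EG × EG} {g₀ : G} (hz : z.2 ∈ (chartAt EG g₀).target) :
    ContMDiffAt 𝓘(ℝ, EG × EG) 𝓘(ℝ, EG) ∞ (fun w : EG × EG => (chartAt EG g₀).symm w.2) z :=
  ContMDiffAt.comp z (contMDiffAt_chartAt_symm hz) contDiff_snd.contMDiff.contMDiffAt

/-- In charts `Ad g` is the partial derivative in k, at k = 1, of the jointly smooth map g k g⁻¹.
Such a partial derivative depends smoothly on g. -/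
theorem contMDiff_Ad [FiniteDimensional ℝ EG] :
    ContMDiff 𝓘(ℝ, EG) 𝓘(ℝ, EG →L[ℝ] EG) ∞ (Ad EG : G → EG →L[ℝ] EG) := by
  intro g₀
  let z₀ := chartAt EG g₀ g₀
  have hz₀ : z₀ ∈ (chartAt EG g₀).target := (chartAt EG g₀).map_source (mem_chart_source EG g₀)
  let m : EG × EG → EG := fun w => chartAt EG (1 : G) ((chartAt EG g₀).symm w.1 *
    (chartAt EG (1 : G)).symm w.2 * ((chartAt EG g₀).symm w.1)⁻¹)
  have hm : ∀ z ∈ (chartAt EG g₀).target, ContDiffAt ℝ ∞ m (z, chartOne EG G) := by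
    intro z hz
    have h1 := contMDiffAt_chart_symm_fst EG (z := (z, chartOne EG G)) (g₀ := g₀) hz
    have h2 := contMDiffAt_chart_symm_snd EG (z := (z, chartOne EG G)) (g₀ := (1 : G))
      (chartOne_mem_target EG)
    refine (ContMDiffAt.comp (z, chartOne EG G) (contMDiffAt_chartAt ?_)
      ((h1.mul h2).mul h1.inv)).contDiffAt
    simp [chartAt_symm_chartOne]
  have hA : ∀ z ∈ (chartAt EG g₀).target, Ad EG ((chartAt EG g₀).symm z) =
      (fderiv ℝ m (z, chartOne EG G)).comp (.inr ℝ EG EG) := by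
    intro z hz
    rw [← fderiv_partial_right ((hm z hz).differentiableAt (by simp)), ← tmap_eq_fderiv]
    set g := (chartAt EG g₀).symm z
    have h1 := tmap_comp (g := chartAt EG (1 : G)) (f := fun y => g * (chartAt EG (1 : G)).symm y *
      g⁻¹) (x := chartOne EG G) (mdifferentiableAt_chartAt (by simp [chartAt_symm_chartOne]))
      (MDifferentiableAt.comp _ (mdifferentiableAt_conj EG g _)
        (mdifferentiableAt_chartAt_symm (chartOne_mem_target EG)))
    have h2 := tmap_comp (g := fun k => g * k * g⁻¹) (f := (chartAt EG (1 : G)).symm)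
      (x := chartOne EG G) (mdifferentiableAt_conj EG g _)
        (mdifferentiableAt_chartAt_symm (chartOne_mem_target EG))
    have h3 := tmap_chart_symm_self (E := EG) (1 : G)
    have h4 := tmap_chart_self (E := EG) (1 : G)
    rw [h2] at h1
    simp only [chartAt_symm_chartOne, mul_one, mul_inv_cancel] at h1
    rw [h4] at h1
    change _ = tmap EG EG (fun y => chartAt EG (1 : G) (g * (chartAt EG (1 : G)).symm y * g⁻¹)) _
    rw [h1]
    erw [h3]
    rfl
  have h1 : ContDiffAt ℝ ∞ (fun z => (fderiv ℝ m (z, chartOne EG G)).comp (.inr ℝ EG EG)) z₀ := by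
    have h2 : ContDiffAt ℝ ∞ (fderiv ℝ m) (z₀, chartOne EG G) :=
      (hm z₀ hz₀).fderiv_right (by simp)
    have h3 : ContDiffAt ℝ ∞ (fun z => fderiv ℝ m (z, chartOne EG G)) z₀ :=
      ContDiffAt.comp z₀ h2 (contDiffAt_id.prodMk contDiffAt_const)
    exact h3.clm_comp contDiffAt_const
  have h2 : ContDiffAt ℝ ∞ (fun z => Ad EG ((chartAt EG g₀).symm z)) z₀ := by
    refine h1.congr_of_eventuallyEq ?_
    filter_upwards [(chartAt EG g₀).open_target.mem_nhds hz₀] with z hz using hA z hz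
  have h3 := ContMDiffAt.comp g₀ (g := fun z => Ad EG ((chartAt EG g₀).symm z))
    h2.contMDiffAt (contMDiffAt_chartAt (mem_chart_source EG g₀))
  refine h3.congr_of_eventuallyEq ?_
  filter_upwards [(chartAt EG g₀).open_source.mem_nhds (mem_chart_source EG g₀)] with g hg
  exact congrArg (Ad EG) ((chartAt EG g₀).left_inv hg).symm

theorem smoothRep_Ad [FiniteDimensional ℝ EG] : SmoothRep EG (Ad EG : G → EG →L[ℝ] EG) :=
  ⟨Ad_one EG, Ad_mul EG, contMDiff_Ad EG⟩

end LieGroups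

open VectorField

/-! ### The Lie bracket as derivative of the adjoint representation -/

section LieBracket

variable {E : Type*} [NormedAddCommGroup E] [NormedSpace ℝ E]
  {M : Type*} [TopologicalSpace M] [ChartedSpace E M] [IsManifold 𝓘(ℝ, E) ∞ M]

theorem mpullbackWithin_chart_symm (V : M → E) {x : M} {z : E} (hz : z ∈ (chartAt E x).target) :
    mpullbackWithin 𝓘(ℝ, E) 𝓘(ℝ, E) (extChartAt 𝓘(ℝ, E) x).symm
      (V : Π x : M, TangentSpace 𝓘(ℝ, E) x) (range 𝓘(ℝ, E)) z = vfInChart x V z := by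
  have h1 : mfderivWithin 𝓘(ℝ, E) 𝓘(ℝ, E) (extChartAt 𝓘(ℝ, E) x).symm (range 𝓘(ℝ, E)) z =
      tmap E E (chartAt E x).symm z := by
    rw [modelWithCornersSelf_coe, range_id, mfderivWithin_univ]
    rfl
  have h2 : (tmap E E (chartAt E x).symm z).inverse =
      tmap E E (chartAt E x) ((chartAt E x).symm z) := by
    refine ContinuousLinearMap.inverse_eq ?_ ?_
    · ext v
      have := tmap_chart_symm_tmap_chart ((chartAt E x).map_target hz) v
      rwa [(chartAt E x).right_inv hz] at this
    · ext v
      exact tmap_chart_tmap_chart_symm hz v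
  exact (congrArg (fun T : E →L[ℝ] E => T.inverse (V ((chartAt E x).symm z))) h1).trans
    (DFunLike.congr_fun h2 _)

/-- The bracket is computed in the preferred chart at `x`. As that chart has derivative the identity
at `x`, nothing remains of the transport back to the manifold. -/
theorem mlieBracket_eq (V W : M → E) (x : M) :
    mlieBracket 𝓘(ℝ, E) (V : Π x : M, TangentSpace 𝓘(ℝ, E) x)
      (W : Π x : M, TangentSpace 𝓘(ℝ, E) x) x =
      fderiv ℝ (vfInChart x W) (chartAt E x x) (V x) -
        fderiv ℝ (vfInChart x V) (chartAt E x x) (W x) := by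
  have ht := (chartAt E x).open_target.mem_nhds ((chartAt E x).map_source (mem_chart_source E x))
  have hV : ∀ V : M → E, mpullbackWithin 𝓘(ℝ, E) 𝓘(ℝ, E) (extChartAt 𝓘(ℝ, E) x).symm
      (V : Π x : M, TangentSpace 𝓘(ℝ, E) x) (range 𝓘(ℝ, E)) =ᶠ[𝓝 (chartAt E x x)]
        vfInChart x V := fun V => by
    filter_upwards [ht] with z hz using mpullbackWithin_chart_symm V hz
  have hv : ∀ V : M → E, vfInChart x V (chartAt E x x) = V x := fun V => by
    rw [vfInChart, (chartAt E x).left_inv (mem_chart_source E x), tmap_chart_self]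
    rfl
  have h0 : mfderiv 𝓘(ℝ, E) 𝓘(ℝ, E) (extChartAt 𝓘(ℝ, E) x) x = ContinuousLinearMap.id ℝ E :=
    tmap_chart_self x
  have h1 : ∀ (v w : E → E) (s : Set E), s = univ → v =ᶠ[𝓝 (chartAt E x x)] vfInChart x V →
      w =ᶠ[𝓝 (chartAt E x x)] vfInChart x W → lieBracketWithin ℝ v w s (chartAt E x x) =
        fderiv ℝ (vfInChart x W) (chartAt E x x) (V x) -
          fderiv ℝ (vfInChart x V) (chartAt E x x) (W x) := by
    rintro v w s rfl h h'
    rw [lieBracketWithin_univ, h.lieBracket_vectorField_eq h', lieBracket, hv, hv]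
  have h2 := h1 _ _ ((extChartAt 𝓘(ℝ, E) x).symm ⁻¹' univ ∩ range 𝓘(ℝ, E)) (by simp) (hV V) (hV W)
  have h3 : (ContinuousLinearMap.id ℝ E).inverse = ContinuousLinearMap.id ℝ E :=
    ContinuousLinearMap.inverse_id
  refine (mlieBracketWithin_apply (I := 𝓘(ℝ, E)) (V := V) (W := W) (s := univ) (x₀ := x)).trans
    (Eq.trans ?_ h2)
  exact (congrArg (fun T : E →L[ℝ] E => T.inverse _) h0).trans (DFunLike.congr_fun h3 _)

end LieBracket

section Bracket

variable (EG : Type*) [NormedAddCommGroup EG] [NormedSpace ℝ EG]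
  {G : Type*} [TopologicalSpace G] [ChartedSpace EG G] [Group G] [LieGroup 𝓘(ℝ, EG) ∞ G]

theorem contDiffAt_mulInChart_one {z y : EG} (hz : z ∈ (chartAt EG (1 : G)).target)
    (hy : y ∈ (chartAt EG (1 : G)).target)
    (h : (chartAt EG (1 : G)).symm z * (chartAt EG (1 : G)).symm y ∈ (chartAt EG (1 : G)).source) :
    ContDiffAt ℝ ∞ (mulInChart EG (1 : G) 1 1) (z, y) := by
  have h1 := contMDiffAt_chart_symm_fst EG (z := (z, y)) (g₀ := (1 : G)) hz
  have h2 := contMDiffAt_chart_symm_snd EG (z := (z, y)) (g₀ := (1 : G)) hy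
  exact (ContMDiffAt.comp (z, y) (contMDiffAt_chartAt h) (h1.mul h2)).contDiffAt

/-- Expresses the left-invariant field generated by `A` through the derivative of the multiplication
in its second factor, so that brackets of such fields become second derivatives of the
multiplication. -/
theorem tmap_chart_leftMul {g : G} (hg : g ∈ (chartAt EG (1 : G)).source) (A : EG) :
    tmap EG EG (chartAt EG (1 : G)) g (leftMul EG g 1 A) =
      fderiv ℝ (mulInChart EG (1 : G) 1 1) (chartAt EG (1 : G) g, chartOne EG G) (0, A) := by
  have hz := (chartAt EG (1 : G)).map_source hg
  have hm := contDiffAt_mulInChart_one EG hz (chartOne_mem_target EG) (G := G) (by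
    rwa [chartAt_symm_chartOne, mul_one, (chartAt EG (1 : G)).left_inv hg])
  have h0 := DFunLike.congr_fun (fderiv_partial_right (hm.differentiableAt (by simp))) A
  have h1 := tmap_comp_apply (g := chartAt EG (1 : G))
    (f := fun y => g * (chartAt EG (1 : G)).symm y) (x := chartOne EG G)
    (mdifferentiableAt_chartAt (by rwa [chartAt_symm_chartOne, mul_one]))
    (MDifferentiableAt.comp _ (mdifferentiableAt_mul_left EG g _)
      (mdifferentiableAt_chartAt_symm (chartOne_mem_target EG))) A
  have h2 := tmap_comp_apply (g := fun k => g * k) (f := (chartAt EG (1 : G)).symm)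
    (x := chartOne EG G) (mdifferentiableAt_mul_left EG g _)
    (mdifferentiableAt_chartAt_symm (chartOne_mem_target EG)) A
  have h3 : tmap EG EG (chartAt EG (1 : G)).symm (chartOne EG G) A = A :=
    DFunLike.congr_fun (tmap_chart_symm_self (E := EG) (1 : G)) A
  rw [h2, h3, chartAt_symm_chartOne, mul_one, tmap_eq_fderiv] at h1
  rw [leftMul, ← h1, ← tmap_eq_fderiv]
  rw [← tmap_eq_fderiv] at h0
  refine Eq.trans ?_ h0
  simp only [mulInChart, (chartAt EG (1 : G)).left_inv hg, tmap_eq_fderiv]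

/-- The counterpart for the first factor; `tmap_Ad_apply` compares the two expressions. -/
theorem tmap_chart_rightMul {g : G} (hg : g ∈ (chartAt EG (1 : G)).source) (A : EG) :
    tmap EG EG (chartAt EG (1 : G)) g (tmap EG EG (fun k : G => k * g) 1 A) =
      fderiv ℝ (mulInChart EG (1 : G) 1 1) (chartOne EG G, chartAt EG (1 : G) g) (A, 0) := by
  have hz := (chartAt EG (1 : G)).map_source hg
  have hm := contDiffAt_mulInChart_one EG (chartOne_mem_target EG) hz (G := G) (by
    rwa [chartAt_symm_chartOne, one_mul, (chartAt EG (1 : G)).left_inv hg])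
  have h0 := DFunLike.congr_fun (fderiv_partial_left (hm.differentiableAt (by simp))) A
  have h1 := tmap_comp_apply (g := chartAt EG (1 : G))
    (f := fun y => (chartAt EG (1 : G)).symm y * g) (x := chartOne EG G)
    (mdifferentiableAt_chartAt (by rwa [chartAt_symm_chartOne, one_mul]))
    (MDifferentiableAt.comp _ (mdifferentiableAt_mul_right EG g _)
      (mdifferentiableAt_chartAt_symm (chartOne_mem_target EG))) A
  have h2 := tmap_comp_apply (g := fun k => k * g) (f := (chartAt EG (1 : G)).symm)
    (x := chartOne EG G) (mdifferentiableAt_mul_right EG g _)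
    (mdifferentiableAt_chartAt_symm (chartOne_mem_target EG)) A
  have h3 : tmap EG EG (chartAt EG (1 : G)).symm (chartOne EG G) A = A :=
    DFunLike.congr_fun (tmap_chart_symm_self (E := EG) (1 : G)) A
  rw [h2, h3, chartAt_symm_chartOne, one_mul, tmap_eq_fderiv] at h1
  rw [← h1, ← tmap_eq_fderiv]
  rw [← tmap_eq_fderiv] at h0
  refine Eq.trans ?_ h0
  simp only [mulInChart, (chartAt EG (1 : G)).left_inv hg, tmap_eq_fderiv]

variable [FiniteDimensional ℝ EG]

/-- The derivative at `1` of the adjoint representation is the Lie bracket. -/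
theorem tmap_Ad_apply (A C : EG) :
    tmap EG (EG →L[ℝ] EG) (Ad EG : G → EG →L[ℝ] EG) 1 A C = bracket EG G A C := by
  set y₀ := chartOne EG G with hy₀
  let m := mulInChart EG (1 : G) 1 1
  have ht : (chartAt EG (1 : G)).target ∈ 𝓝 y₀ :=
    (chartAt EG (1 : G)).open_target.mem_nhds (chartOne_mem_target EG)
  have hm : ContDiffAt ℝ ∞ m (y₀, y₀) :=
    contDiffAt_mulInChart_one EG (chartOne_mem_target EG) (chartOne_mem_target EG)
      (by simp [hy₀, chartAt_symm_chartOne])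
  have hdm : DifferentiableAt ℝ (fderiv ℝ m) (y₀, y₀) :=
    (hm.fderiv_right (m := ∞) (by simp)).differentiableAt (by simp)
  -- the second derivatives
  have hL : ∀ A C, HasFDerivAt (fun z => fderiv ℝ m (z, y₀) (A, C))
      (((fderiv ℝ (fderiv ℝ m) (y₀, y₀)).comp (.inl ℝ EG EG)).flip (A, C)) y₀ := fun A C => by
    have h1 : HasFDerivAt (fun z => fderiv ℝ m (z, y₀))
        ((fderiv ℝ (fderiv ℝ m) (y₀, y₀)).comp (.inl ℝ EG EG)) y₀ :=
      HasFDerivAt.comp (f := fun z => (z, y₀)) y₀ hdm.hasFDerivAt (hasFDerivAt_prodMk_left y₀ y₀)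
    simpa using h1.clm_apply (hasFDerivAt_const (A, C) y₀)
  have hR : HasFDerivAt (fun z => (fderiv ℝ m (y₀, z)).comp (.inl ℝ EG EG))
      (((ContinuousLinearMap.compL ℝ EG (EG × EG) EG).flip (.inl ℝ EG EG)).comp
        ((fderiv ℝ (fderiv ℝ m) (y₀, y₀)).comp (.inr ℝ EG EG))) y₀ := by
    have h1 : HasFDerivAt (fun z => fderiv ℝ m (y₀, z))
        ((fderiv ℝ (fderiv ℝ m) (y₀, y₀)).comp (.inr ℝ EG EG)) y₀ :=
      HasFDerivAt.comp (f := fun z => (y₀, z)) y₀ hdm.hasFDerivAt (hasFDerivAt_prodMk_right y₀ y₀)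
    exact ((ContinuousLinearMap.compL ℝ EG (EG × EG) EG).flip
      (.inl ℝ EG EG)).hasFDerivAt.comp y₀ h1
  have hsymm : ∀ v w, fderiv ℝ (fderiv ℝ m) (y₀, y₀) v w = fderiv ℝ (fderiv ℝ m) (y₀, y₀) w v := by
    have := hm.isSymmSndFDerivAt (by
      rw [minSmoothness_of_isRCLikeNormedField]
      exact WithTop.coe_le_coe.2 (le_top : (2 : ℕ∞) ≤ ⊤))
    exact fun v w => this v w
  -- invariant vector fields in the chart
  have hinv : ∀ C, vfInChart (1 : G) (fun g => leftMul EG g 1 C) =ᶠ[𝓝 y₀]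
      fun z => fderiv ℝ m (z, y₀) (0, C) := fun C => by
    filter_upwards [ht] with z hz
    have h := tmap_chart_leftMul EG ((chartAt EG (1 : G)).map_target hz) C
    rw [(chartAt EG (1 : G)).right_inv hz] at h
    exact h
  have hbr : bracket EG G A C = fderiv ℝ (fderiv ℝ m) (y₀, y₀) (A, 0) (0, C) -
      fderiv ℝ (fderiv ℝ m) (y₀, y₀) (C, 0) (0, A) := by
    have h1 := mlieBracket_eq (fun g : G => leftMul EG g 1 A) (fun g : G => leftMul EG g 1 C) 1
    have h2 : ∀ A, leftMul EG (1 : G) 1 A = A := fun A => by rw [leftMul_one]; rfl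
    rw [h2, h2, show chartAt EG (1 : G) 1 = y₀ from rfl, (hinv A).fderiv_eq, (hinv C).fderiv_eq,
      (hL 0 C).fderiv, (hL 0 A).fderiv] at h1
    exact h1
  -- the adjoint representation in the chart
  have hAd : HasFDerivAt (fun z => Ad EG ((chartAt EG (1 : G)).symm z))
      (tmap EG (EG →L[ℝ] EG) (Ad EG : G → EG →L[ℝ] EG) 1) y₀ := by
    have h1 : MDifferentiableAt 𝓘(ℝ, EG) 𝓘(ℝ, EG →L[ℝ] EG) (Ad EG : G → EG →L[ℝ] EG)
      ((chartAt EG (1 : G)).symm y₀) := (contMDiff_Ad EG).mdifferentiableAt (by simp)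
    have h3 := mdifferentiableAt_chartAt_symm (chartOne_mem_target EG (G := G))
    have h2 := tmap_comp h1 h3
    have h4 : DifferentiableAt ℝ (fun z => Ad EG ((chartAt EG (1 : G)).symm z)) y₀ :=
      (MDifferentiableAt.comp y₀ h1 h3).differentiableAt
    have h5 : tmap EG EG (chartAt EG (1 : G)).symm (chartOne EG G) = ContinuousLinearMap.id ℝ EG :=
      tmap_chart_symm_self (E := EG) (1 : G)
    rw [h5, chartAt_symm_chartOne, tmap_eq_fderiv] at h2
    have h6 := h4.hasFDerivAt
    rw [h2] at h6
    exact h6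
  -- This is the identity (g k g⁻¹) g = g k, differentiated at k = 1 and read in the chart.
  have hprod : (fun z => (fderiv ℝ m (y₀, z)).comp (.inl ℝ EG EG)
      (Ad EG ((chartAt EG (1 : G)).symm z) C)) =ᶠ[𝓝 y₀] fun z => fderiv ℝ m (z, y₀) (0, C) := by
    filter_upwards [ht] with z hz
    have hs := (chartAt EG (1 : G)).map_target hz
    have h1 := tmap_chart_leftMul EG hs C
    have h2 := tmap_chart_rightMul EG hs (Ad EG ((chartAt EG (1 : G)).symm z) C)
    rw [(chartAt EG (1 : G)).right_inv hz] at h1 h2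
    set g := (chartAt EG (1 : G)).symm z
    have h3 := tmap_comp_apply (g := fun k : G => k * g) (f := fun k : G => g * k * g⁻¹) (x := 1)
      (mdifferentiableAt_mul_right EG _ _) (mdifferentiableAt_conj EG _ _) C
    simp only [mul_one, mul_inv_cancel, inv_mul_cancel_right] at h3
    refine Eq.trans h2.symm (Eq.trans ?_ h1)
    exact congrArg _ h3.symm
  -- Differentiating `hprod` along `A`, the product rule on the left gives a mixed second derivative
  -- of `m` plus the derivative of `Ad`. By symmetry of second derivatives the result is the
  -- antisymmetrized mixed derivative in `hbr`.
  have h1 := hR.clm_apply (hAd.clm_apply (hasFDerivAt_const C y₀))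
  have h2 := (hL 0 C).congr_of_eventuallyEq hprod
  have h3 := DFunLike.congr_fun (h1.unique h2) A
  have hid : ∀ v, fderiv ℝ m (y₀, y₀) (v, 0) = v := fun v => by
    have h := tmap_chart_rightMul EG (mem_chart_source EG (1 : G)) v
    simp only [mul_one, tmap_id] at h
    refine h.symm.trans ?_
    exact DFunLike.congr_fun (tmap_chart_self (E := EG) (1 : G)) v
  have hone : Ad EG ((chartAt EG (1 : G)).symm y₀) C = C := by
    rw [hy₀, chartAt_symm_chartOne, Ad_one]
    rfl
  simp [hid, hone] at h3
  rw [hbr, ← h3, hsymm (0, A)]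
  abel

end Bracket

variable {EX EG EP X G P : Type*}
  [NormedAddCommGroup EX] [NormedSpace ℝ EX] [NormedAddCommGroup EG] [NormedSpace ℝ EG]
  [NormedAddCommGroup EP] [NormedSpace ℝ EP]
  [TopologicalSpace X] [ChartedSpace EX X] [TopologicalSpace G] [ChartedSpace EG G] [Group G]
  [TopologicalSpace P] [ChartedSpace EP P]

/-! ### The action on a principal bundle and its derivative -/

namespace PrincipalBundle

variable (B : PrincipalBundle EX EG EP X G P)

theorem contMDiff_act_right (g : G) :
    ContMDiff 𝓘(ℝ, EP) 𝓘(ℝ, EP) ∞ (fun u => B.act u g) :=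
  B.contMDiff_act.comp (contMDiff_id.prodMk contMDiff_const)

theorem contMDiff_orbit (u : P) : ContMDiff 𝓘(ℝ, EG) 𝓘(ℝ, EP) ∞ (fun g => B.act u g) :=
  B.contMDiff_act.comp (contMDiff_const.prodMk contMDiff_id)

theorem mdifferentiableAt_act_right (g : G) (u : P) :
    MDifferentiableAt 𝓘(ℝ, EP) 𝓘(ℝ, EP) (fun u => B.act u g) u :=
  (B.contMDiff_act_right g).mdifferentiableAt (by simp)

theorem mdifferentiableAt_orbit (u : P) (g : G) :
    MDifferentiableAt 𝓘(ℝ, EG) 𝓘(ℝ, EP) (fun g => B.act u g) g :=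
  (B.contMDiff_orbit u).mdifferentiableAt (by simp)

theorem mdifferentiableAt_proj (u : P) : MDifferentiableAt 𝓘(ℝ, EP) 𝓘(ℝ, EX) B.proj u :=
  B.contMDiff_proj.mdifferentiableAt (by simp)

theorem fundamental_zero (u : P) : B.fundamental u 0 = 0 := map_zero _

theorem tmap_act_one (u : P) (v : EP) : tmap EP EP (fun u => B.act u 1) u v = v := by
  simp only [B.act_one, tmap_id]
  rfl

theorem tmap_proj_tmap_act (g : G) (u : P) (v : EP) :
    tmap EP EX B.proj (B.act u g) (tmap EP EP (fun u => B.act u g) u v) =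
      tmap EP EX B.proj u v := by
  rw [← tmap_comp_apply (g := B.proj) (B.mdifferentiableAt_proj _)
    (B.mdifferentiableAt_act_right g _)]
  simp only [B.proj_act]

theorem tmap_proj_fundamental (u : P) (A : EG) : tmap EP EX B.proj u (B.fundamental u A) = 0 := by
  have h := tmap_comp_apply (g := B.proj) (f := fun g => B.act u g) (x := (1 : G))
    (B.mdifferentiableAt_proj _) (B.mdifferentiableAt_orbit u _) A
  simp only [B.proj_act, B.act_one, tmap_const] at h
  exact h.symm

variable [LieGroup 𝓘(ℝ, EG) ∞ G]

/-- Seen from u·g the orbit map is h ↦ (u·g)·(g⁻¹h), so its derivative is a fundamental vector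
generated by the Maurer-Cartan value of `w`. -/
theorem tmap_orbit (u : P) (g : G) (w : EG) :
    tmap EG EP (fun h => B.act u h) g w = B.fundamental (B.act u g) (leftMul EG g⁻¹ g w) := by
  have h1 : (fun h => B.act u h) = fun h => B.act (B.act u g) (g⁻¹ * h) := by
    funext h
    rw [← B.act_mul, mul_inv_cancel_left]
  have h2 := tmap_comp_apply (g := fun h => B.act (B.act u g) h) (f := fun h => g⁻¹ * h) (x := g)
    (B.mdifferentiableAt_orbit _ _) (mdifferentiableAt_mul_left EG _ _) w
  rw [inv_mul_cancel] at h2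
  rw [h1]
  exact h2

/-- The product rule for f·g: the derivative of the action is the sum of its partial derivatives,
and the one along G is vertical with generator g⁻¹ dg. All inhomogeneous gauge terms come from this
summand. -/
theorem tmap_act {E M : Type*} [NormedAddCommGroup E] [NormedSpace ℝ E] [TopologicalSpace M]
    [ChartedSpace E M] {f : M → P} {g : M → G} {x : M}
    (hf : MDifferentiableAt 𝓘(ℝ, E) 𝓘(ℝ, EP) f x) (hg : MDifferentiableAt 𝓘(ℝ, E) 𝓘(ℝ, EG) g x)
    (v : E) : tmap E EP (fun y => B.act (f y) (g y)) x v =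
      tmap EP EP (fun u => B.act u (g x)) (f x) (tmap E EP f x v) +
        B.fundamental (B.act (f x) (g x)) (leftMul EG (g x)⁻¹ (g x) (tmap E EG g x v)) := by
  rw [← tmap_orbit]
  have h1 : MDifferentiableAt (𝓘(ℝ, EP).prod 𝓘(ℝ, EG)) 𝓘(ℝ, EP) (fun q : P × G => B.act q.1 q.2)
    (f x, g x) := B.contMDiff_act.mdifferentiableAt (by simp)
  have h2 := (h1.hasMFDerivAt.comp x (hf.hasMFDerivAt.prodMk hg.hasMFDerivAt)).mfderiv
  exact (DFunLike.congr_fun h2 v).trans (mfderiv_prod_eq_add_apply h1)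

end PrincipalBundle

/-! ### Canonical sections, transition functions and vertical vectors -/

namespace TrivCover

variable {B : PrincipalBundle EX EG EP X G P} {ι : Type*} (T : TrivCover B ι)

/-- The group component of the local trivialization over `U_i`. -/
def fib (i : ι) (u : P) : G := (T.triv i u).2

theorem isOpen_U (i : ι) : IsOpen (T.U i) := (T.triv i).open_baseSet

variable {T} {i j : ι} {x : X} {u : P}

theorem mem_source (h : B.proj u ∈ T.U i) : u ∈ (T.triv i).source := (T.triv i).mem_source.2 h

theorem proj_sec (h : x ∈ T.U i) : B.proj (T.sec i x) = x := (T.triv i).proj_symm_apply' h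

theorem fib_sec (h : x ∈ T.U i) : T.fib i (T.sec i x) = 1 :=
  congrArg Prod.snd ((T.triv i).apply_symm_apply' h)

theorem fib_act (h : B.proj u ∈ T.U i) (g : G) : T.fib i (B.act u g) = T.fib i u * g :=
  T.equivariant i u (mem_source h) g

theorem eq_of_fib_eq {u' : P} (hu : B.proj u ∈ T.U i) (h : B.proj u' = B.proj u)
    (h' : T.fib i u' = T.fib i u) : u' = u := by
  apply (T.triv i).injOn (mem_source (by rwa [h])) (mem_source hu)
  change T.triv i u' = T.triv i u
  rw [← (T.triv i).mk_proj_snd' hu, ← (T.triv i).mk_proj_snd' (by rwa [h]), h]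
  exact congrArg _ h'

theorem act_sec_fib (h : B.proj u ∈ T.U i) : B.act (T.sec i (B.proj u)) (T.fib i u) = u := by
  have h1 := proj_sec h
  apply eq_of_fib_eq h
  · rw [B.proj_act, h1]
  · rw [fib_act (by rwa [h1]), fib_sec h, one_mul]

theorem act_sec_trans (hi : x ∈ T.U i) (hj : x ∈ T.U j) :
    B.act (T.sec i x) (T.trans i j x) = T.sec j x := by
  have h := act_sec_fib (T := T) (i := i) (u := T.sec j x) (by rwa [proj_sec hj])
  rwa [proj_sec hj] at h

theorem trans_mul_fib (hi : B.proj u ∈ T.U i) (hj : B.proj u ∈ T.U j) :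
    T.trans j i (B.proj u) * T.fib i u = T.fib j u := by
  conv_rhs => rw [← act_sec_fib hi, fib_act (by rwa [proj_sec hi])]
  rfl

theorem trans_eq_inv (hi : x ∈ T.U i) (hj : x ∈ T.U j) : T.trans j i x = (T.trans i j x)⁻¹ := by
  have h := trans_mul_fib (T := T) (i := i) (j := j) (u := T.sec j x) (by rwa [proj_sec hj])
    (by rwa [proj_sec hj])
  rw [proj_sec hj, fib_sec hj] at h
  exact eq_inv_of_mul_eq_one_left h

theorem contMDiffAt_sec (h : x ∈ T.U i) : ContMDiffAt 𝓘(ℝ, EX) 𝓘(ℝ, EP) ∞ (T.sec i) x := by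
  have h1 : ((x, (1 : G)) : X × G) ∈ (T.triv i).target := (T.triv i).mem_target.2 h
  have h2 := (T.contMDiffOn_symm i).contMDiffAt ((T.triv i).open_target.mem_nhds h1)
  exact ContMDiffAt.comp x h2 (contMDiffAt_id.prodMk contMDiffAt_const)

theorem contMDiffAt_fib (h : B.proj u ∈ T.U i) :
    ContMDiffAt 𝓘(ℝ, EP) 𝓘(ℝ, EG) ∞ (T.fib i) u :=
  ContMDiffAt.comp u contMDiffAt_snd
    ((T.contMDiffOn i).contMDiffAt ((T.triv i).open_source.mem_nhds (mem_source h)))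

theorem mdifferentiableAt_sec (h : x ∈ T.U i) : MDifferentiableAt 𝓘(ℝ, EX) 𝓘(ℝ, EP) (T.sec i) x :=
  (contMDiffAt_sec h).mdifferentiableAt (by simp)

theorem mdifferentiableAt_fib (h : B.proj u ∈ T.U i) :
    MDifferentiableAt 𝓘(ℝ, EP) 𝓘(ℝ, EG) (T.fib i) u :=
  (contMDiffAt_fib h).mdifferentiableAt (by simp)

theorem mdifferentiableAt_trans (hi : x ∈ T.U i) (hj : x ∈ T.U j) :
    MDifferentiableAt 𝓘(ℝ, EX) 𝓘(ℝ, EG) (T.trans i j) x :=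
  MDifferentiableAt.comp x (g := T.fib i) (mdifferentiableAt_fib (by rwa [proj_sec hj]))
    (mdifferentiableAt_sec hj)

theorem tmap_proj_tmap_sec (h : x ∈ T.U i) (v : EX) :
    tmap EP EX B.proj (T.sec i x) (tmap EX EP (T.sec i) x v) = v := by
  rw [← tmap_comp_apply (g := B.proj) (B.mdifferentiableAt_proj _) (mdifferentiableAt_sec h),
    tmap_congr (g := fun y => y), tmap_id]
  · rfl
  · filter_upwards [(T.isOpen_U i).mem_nhds h] with y hy using proj_sec hy

variable [LieGroup 𝓘(ℝ, EG) ∞ G]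

theorem eventually_proj_mem (h : B.proj u ∈ T.U i) : ∀ᶠ w in 𝓝 u, B.proj w ∈ T.U i :=
  (B.contMDiff_proj.continuous.isOpen_preimage _ (T.isOpen_U i)).mem_nhds h

/-- Every tangent vector of `P` is the sum of a translate of a vector tangent to the image of the
canonical section and of a vertical vector. -/
theorem tangent_decomposition (h : B.proj u ∈ T.U i) (v : EP) :
    v =
      tmap EP EP (fun w => B.act w (T.fib i u)) (T.sec i (B.proj u))
        (tmap EX EP (T.sec i) (B.proj u) (tmap EP EX B.proj u v)) +
      B.fundamental u (leftMul EG (T.fib i u)⁻¹ (T.fib i u) (tmap EP EG (T.fib i) u v)) := by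
  have h1 := B.tmap_act (f := fun w => T.sec i (B.proj w)) (g := T.fib i) (x := u)
    (MDifferentiableAt.comp u (g := T.sec i) (mdifferentiableAt_sec h) (B.mdifferentiableAt_proj u))
    (mdifferentiableAt_fib h) v
  rw [act_sec_fib h, tmap_comp_apply (g := T.sec i) (mdifferentiableAt_sec h)
    (B.mdifferentiableAt_proj u)] at h1
  rw [← h1, tmap_congr (g := fun w => w), tmap_id]
  · rfl
  · filter_upwards [eventually_proj_mem h] with w hw using act_sec_fib hw

/-- In `tangent_decomposition` the first summand depends only on dπ(v). Conditions on vertical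
vectors can therefore be checked on fundamental ones. -/
theorem vertical_eq_fundamental (h : B.proj u ∈ T.U i) {v : EP} (hv : tmap EP EX B.proj u v = 0) :
    v = B.fundamental u (leftMul EG (T.fib i u)⁻¹ (T.fib i u) (tmap EP EG (T.fib i) u v)) := by
  have h1 := tangent_decomposition h v
  rwa [hv, map_zero, map_zero, zero_add] at h1

/-- The product rule applied to σ_j = σ_i·γ_ij. Both transformation laws follow: a horizontal form
does not see the vertical summand, while a connection form returns its generator. -/
theorem tmap_sec_eq (hi : x ∈ T.U i) (hj : x ∈ T.U j) (v : EX) :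
    tmap EX EP (T.sec j) x v =
      tmap EP EP (fun u => B.act u (T.trans i j x)) (T.sec i x) (tmap EX EP (T.sec i) x v) +
        B.fundamental (T.sec j x) (T.gaugeTerm i j x v) := by
  have h1 := B.tmap_act (f := T.sec i) (g := T.trans i j) (x := x) (mdifferentiableAt_sec hi)
    (mdifferentiableAt_trans hi hj) v
  rw [act_sec_trans hi hj] at h1
  rw [gaugeTerm, trans_eq_inv hi hj, ← h1]
  refine DFunLike.congr_fun (tmap_congr ?_) v
  filter_upwards [(T.isOpen_U i).mem_nhds hi, (T.isOpen_U j).mem_nhds hj] with y hyi hyj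
  exact (act_sec_trans hyi hyj).symm

/-- The local Maurer-Cartan form `g_i⁻¹ dg_i` reproduces fundamental vectors. -/
theorem leftMul_tmap_fib_fundamental (h : B.proj u ∈ T.U i) (A : EG) :
    leftMul EG (T.fib i u)⁻¹ (T.fib i u) (tmap EP EG (T.fib i) u (B.fundamental u A)) = A := by
  have h1 := tmap_comp_apply (g := T.fib i) (f := fun g => B.act u g) (x := (1 : G))
    (mdifferentiableAt_fib (by rwa [B.proj_act])) (B.mdifferentiableAt_orbit u _) A
  rw [B.act_one] at h1
  simp only [fib_act h] at h1
  have h2 : tmap EP EG (T.fib i) u (B.fundamental u A) = leftMul EG (T.fib i u) 1 A := h1.symm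
  have h3 := leftMul_inv_leftMul EG (T.fib i u) 1 A
  rw [mul_one] at h3
  rw [h2, h3]

/-- The local Maurer-Cartan form `g_i⁻¹ dg_i` is equivariant. -/
theorem leftMul_tmap_fib_tmap_act (h : B.proj u ∈ T.U i) (g : G) (v : EP) :
    leftMul EG (T.fib i (B.act u g))⁻¹ (T.fib i (B.act u g))
      (tmap EP EG (T.fib i) (B.act u g) (tmap EP EP (fun w => B.act w g) u v)) =
      Ad EG g⁻¹ (leftMul EG (T.fib i u)⁻¹ (T.fib i u) (tmap EP EG (T.fib i) u v)) := by
  rw [← tmap_comp_apply (g := T.fib i) (mdifferentiableAt_fib (by rwa [B.proj_act]))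
    (B.mdifferentiableAt_act_right g u), fib_act h, ← leftMul_inv_tmap_mul_right,
    ← tmap_comp_apply (g := fun k => k * g) (mdifferentiableAt_mul_right EG _ _)
    (mdifferentiableAt_fib h)]
  congr 1
  refine DFunLike.congr_fun (tmap_congr ?_) v
  filter_upwards [eventually_proj_mem h] with w hw using fib_act hw g

end TrivCover

/-! ### Horizontal equivariant forms and the associated bundle -/

section Horizontal

variable {E F V : Type*} [NormedAddCommGroup E] [NormedSpace ℝ E]
  [NormedAddCommGroup F] [NormedSpace ℝ F] [NormedAddCommGroup V] [NormedSpace ℝ V] {p : ℕ}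

/-- An alternating form that vanishes on the kernel of `L` depends only on the images under `L`. -/
theorem eq_of_forall_apply_eq {f : E [⋀^Fin p]→L[ℝ] V} {L : E →L[ℝ] F}
    (hf : ∀ v : Fin p → E, (∃ k, L (v k) = 0) → f v = 0) {v w : Fin p → E}
    (h : ∀ k, L (v k) = L (w k)) : f v = f w := by
  -- Expanding v = w + (v - w) over subsets of slots, every term except f(w) has some argument v k -
  -- w k in the kernel of `L`.
  have h1 := f.map_add_univ w (v - w)
  rw [add_sub_cancel, Finset.sum_eq_single Finset.univ] at h1
  · simpa using h1
  · intro s _ hs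
    obtain ⟨k, hk⟩ : ∃ k, k ∉ s := by
      by_contra! hc
      exact hs (Finset.eq_univ_iff_forall.2 hc)
    refine hf _ ⟨k, ?_⟩
    rw [Finset.piecewise_eq_of_notMem _ _ _ hk, Pi.sub_apply, map_sub, h, sub_self]
  · exact fun h => (h (Finset.mem_univ _)).elim

theorem fin_one_eq (v : Fin 1 → E) : v = ![v 0] := by
  ext k
  fin_cases k
  rfl

theorem fin_zero_eq (v : Fin 0 → E) : v = ![] := Subsingleton.elim _ _

/-- A `1`-form at a point, as a linear map. -/
def toLin (f : E [⋀^Fin 1]→L[ℝ] V) : E →L[ℝ] V :=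
  (ContinuousAlternatingMap.ofSubsingleton ℝ E V (0 : Fin 1)).symm f

theorem apply_one (f : E [⋀^Fin 1]→L[ℝ] V) (v : E) : f ![v] = toLin f v := by
  change f ![v] = f (fun _ => v)
  congr 1
  ext k
  fin_cases k
  rfl

end Horizontal

section TensorialForms

variable {V : Type*} [NormedAddCommGroup V] [NormedSpace ℝ V] {p : ℕ}
  {B : PrincipalBundle EX EG EP X G P} {ι : Type*} (T : TrivCover B ι)
  {a : G → V →L[ℝ] V}

theorem PrincipalBundle.tensorial_apply_tmap_act {φ : Form EP P p V}
    (hφ : φ ∈ B.tensorialForms a p) (g : G) (u : P) (v : Fin p → EP) :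
    φ (B.act u g) (fun k => tmap EP EP (fun u => B.act u g) u (v k)) = a g⁻¹ (φ u v) :=
  DFunLike.congr_fun (hφ.2.2 g u) v

namespace TrivCover

/-- The pullbacks of a form on `P` along the canonical sections, extended by zero. -/
def baseForms (φ : Form EP P p V) (i : ι) : Form EX X p V :=
  (T.U i).indicator (pull EX EP (T.sec i) φ)

theorem baseForms_of_mem (φ : Form EP P p V) {i : ι} {x : X} (hx : x ∈ T.U i) :
    T.baseForms φ i x = pull EX EP (T.sec i) φ x := indicator_of_mem hx _

theorem baseForms_of_notMem (φ : Form EP P p V) {i : ι} {x : X} (hx : x ∉ T.U i) :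
    T.baseForms φ i x = 0 := indicator_of_notMem hx _

theorem represents_baseForms (φ : Form EP P p V) : T.Represents (T.baseForms φ) φ :=
  fun _ _ hx => T.baseForms_of_mem φ hx

theorem baseForms_eventuallyEq (φ : Form EP P p V) {i : ι} {x : X} (hx : x ∈ T.U i) :
    T.baseForms φ i =ᶠ[𝓝 x] pull EX EP (T.sec i) φ := by
  filter_upwards [(T.isOpen_U i).mem_nhds hx] with y hy using T.baseForms_of_mem φ hy

theorem eq_baseForms {φ : ι → Form EX X p V} {φ' : Form EP P p V} (h : T.Represents φ φ')
    (h0 : ∀ i, ∀ x, x ∉ T.U i → φ i x = 0) : φ = T.baseForms φ' := by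
  funext i x
  by_cases hx : x ∈ T.U i
  · rw [h i x hx, T.baseForms_of_mem φ' hx]
  · rw [h0 i x hx, T.baseForms_of_notMem φ' hx]

theorem baseForms_add (φ ψ : Form EP P p V) :
    T.baseForms (φ + ψ) = T.baseForms φ + T.baseForms ψ := by
  funext i x
  by_cases hx : x ∈ T.U i
  · simp only [Pi.add_apply, T.baseForms_of_mem _ hx]
    rfl
  · simp only [Pi.add_apply, T.baseForms_of_notMem _ hx, add_zero]

theorem baseForms_smul (c : ℝ) (φ : Form EP P p V) :
    T.baseForms (c • φ) = c • T.baseForms φ := by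
  funext i x
  by_cases hx : x ∈ T.U i
  · simp only [Pi.smul_apply, T.baseForms_of_mem _ hx]
    rfl
  · simp only [Pi.smul_apply, T.baseForms_of_notMem _ hx, smul_zero]

section Manifold

variable [IsManifold 𝓘(ℝ, EX) ∞ X] [IsManifold 𝓘(ℝ, EP) ∞ P]
  [FiniteDimensional ℝ EX] [FiniteDimensional ℝ EP] [FiniteDimensional ℝ V]

theorem formSmoothAt_of_mem {φ : Form EP P p V} (h : φ ∈ formsOn EP p V (univ : Set P)) (u : P) :
    FormSmoothAt φ u := ((mem_formsOn_iff isOpen_univ).1 h).1 u (mem_univ u)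

theorem formSmoothAt_baseForms {φ : Form EP P p V} (h : φ ∈ formsOn EP p V (univ : Set P)) {i : ι}
    {x : X} (hx : x ∈ T.U i) : FormSmoothAt (T.baseForms φ i) x :=
  (FormSmoothAt.pull (contMDiffAt_sec hx) (formSmoothAt_of_mem h _)).congr
    (T.baseForms_eventuallyEq φ hx)

theorem baseForms_mem_formsOn {φ : Form EP P p V} (h : φ ∈ formsOn EP p V (univ : Set P)) (i : ι) :
    T.baseForms φ i ∈ formsOn EX p V (T.U i) :=
  (mem_formsOn_iff (T.isOpen_U i)).2 ⟨fun _ hx => T.formSmoothAt_baseForms h hx,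
    fun _ hx => T.baseForms_of_notMem φ hx⟩

variable [LieGroup 𝓘(ℝ, EG) ∞ G]

/-- By `tmap_sec_eq`, dσ_j(v) and the translate of dσ_i(v) by γ_ij differ by a vertical vector.
Horizontality ignores it and equivariance evaluates the translate. -/
theorem baseForms_mem_assocForms {φ : Form EP P p V} (hφ : φ ∈ B.tensorialForms a p) :
    T.baseForms φ ∈ T.assocForms a p := by
  refine ⟨T.baseForms_mem_formsOn hφ.1, fun i j x ⟨hi, hj⟩ => ?_⟩
  ext v
  rw [T.baseForms_of_mem φ hi, T.baseForms_of_mem φ hj, trans_eq_inv hi hj]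
  simp only [pull_apply, ContinuousLinearMap.compContinuousAlternatingMap_coe, Function.comp_apply]
  rw [← B.tensorial_apply_tmap_act hφ, act_sec_trans hi hj]
  refine eq_of_forall_apply_eq (hφ.2.1 _) fun k => ?_
  rw [tmap_sec_eq hi hj, map_add, B.tmap_proj_fundamental, add_zero]

/-- The index of a chosen trivialization around `x`. -/
def index (x : X) : ι := (T.covers x).choose

theorem mem_U_index (x : X) : x ∈ T.U (T.index x) := (T.covers x).choose_spec

/-- The horizontal equivariant form on `P` corresponding to a family of local forms. -/
def totalForm (a : G → V →L[ℝ] V) (φ : ι → Form EX X p V) : Form EP P p V := fun u =>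
  (a (T.fib (T.index (B.proj u)) u)⁻¹).compContinuousAlternatingMap
    (pull EP EX B.proj (φ (T.index (B.proj u))) u)

/-- Since g_j = γ_ji g_i, the factor a(g_j⁻¹) undoes the transition law of the local forms, so the
index is immaterial. `totalForm` picks its index pointwise without any continuity; smoothness is
read off after replacing that index by a fixed one. -/
theorem totalForm_eq (ha : SmoothRep EG a) {φ : ι → Form EX X p V} (hφ : φ ∈ T.assocForms a p)
    {i : ι} {u : P} (hi : B.proj u ∈ T.U i) : T.totalForm a φ u =
      (a (T.fib i u)⁻¹).compContinuousAlternatingMap (pull EP EX B.proj (φ i) u) := by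
  have hj := T.mem_U_index (B.proj u)
  set j := T.index (B.proj u) with hj'
  rw [totalForm, ← hj']
  ext v
  simp only [pull, hφ.2 i j _ ⟨hi, hj⟩, ← trans_mul_fib hi hj, mul_inv_rev, ha.mul]
  simp only [ContinuousLinearMap.compContinuousAlternatingMap_coe, Function.comp_apply,
    ContinuousAlternatingMap.compContinuousLinearMap_apply, ContinuousLinearMap.comp_apply,
    ha.inv_apply_apply]

theorem totalForm_mem (ha : SmoothRep EG a) {φ : ι → Form EX X p V} (hφ : φ ∈ T.assocForms a p) :
    T.totalForm a φ ∈ B.tensorialForms a p := by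
  refine ⟨(mem_formsOn_iff isOpen_univ).2 ⟨fun u _ => ?_, fun u hu => (hu (mem_univ u)).elim⟩,
    fun u v ⟨k, hk⟩ => ?_, fun g u => ?_⟩
  · have hi := T.mem_U_index (B.proj u)
    set i := T.index (B.proj u)
    have h1 : FormSmoothAt (φ i) (B.proj u) :=
      ((mem_formsOn_iff (T.isOpen_U i)).1 (hφ.1 i)).1 _ hi
    have h2 := FormSmoothAt.pull (B.contMDiff_proj u) h1
    have h3 : ContMDiffAt 𝓘(ℝ, EP) 𝓘(ℝ, V →L[ℝ] V) ∞ (fun w => a (T.fib i w)⁻¹) u :=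
      ContMDiffAt.comp u (ha.smooth _) (contMDiffAt_fib hi).inv
    refine (h2.comp_clm h3).congr ?_
    filter_upwards [eventually_proj_mem hi] with w hw using T.totalForm_eq ha hφ hw
  · have h1 : pull EP EX B.proj (φ (T.index (B.proj u))) u v = 0 := by
      rw [pull_apply]
      exact (φ _ _).map_coord_zero k hk
    rw [totalForm]
    simp only [ContinuousLinearMap.compContinuousAlternatingMap_coe, Function.comp_apply, h1,
      map_zero]
  · have hi := T.mem_U_index (B.proj u)
    set i := T.index (B.proj u)
    ext v
    rw [pull_apply, T.totalForm_eq ha hφ (i := i) (by rwa [B.proj_act]), T.totalForm_eq ha hφ hi,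
      fib_act hi, mul_inv_rev, ha.mul]
    simp only [ContinuousLinearMap.compContinuousAlternatingMap_coe, Function.comp_apply,
      ContinuousLinearMap.comp_apply, pull_apply, B.tmap_proj_tmap_act, B.proj_act]

theorem represents_totalForm (ha : SmoothRep EG a) {φ : ι → Form EX X p V}
    (hφ : φ ∈ T.assocForms a p) : T.Represents φ (T.totalForm a φ) := by
  intro i x hx
  ext v
  rw [pull_apply, T.totalForm_eq ha hφ (i := i) (by rwa [proj_sec hx]), fib_sec hx, inv_one, ha.one]
  simp only [ContinuousLinearMap.compContinuousAlternatingMap_coe, Function.comp_apply,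
    ContinuousLinearMap.id_apply, pull_apply, tmap_proj_tmap_sec hx, proj_sec hx]

/-- Each u is σ_i(π(u))·g_i(u), and up to vertical vectors each tangent vector at u is the translate
of one tangent to the section. Equivariance and horizontality thus leave no freedom. -/
theorem eq_totalForm {φ : ι → Form EX X p V} {φ' : Form EP P p V}
    (hφ' : φ' ∈ B.tensorialForms a p) (h : T.Represents φ φ') : φ' = T.totalForm a φ := by
  funext u
  ext v
  have hi := T.mem_U_index (B.proj u)
  rw [totalForm]
  set i := T.index (B.proj u)
  simp only [ContinuousLinearMap.compContinuousAlternatingMap_coe, Function.comp_apply]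
  rw [pull_apply, h i _ hi, pull_apply, ← B.tensorial_apply_tmap_act hφ', act_sec_fib hi]
  refine eq_of_forall_apply_eq (hφ'.2.1 _) fun k => ?_
  conv_lhs => rw [tangent_decomposition hi (v k), map_add, B.tmap_proj_fundamental, add_zero]

theorem eq_zero_of_notMem {φ : ι → Form EX X p V} (hφ : φ ∈ T.assocForms a p) {i : ι} {x : X}
    (hx : x ∉ T.U i) : φ i x = 0 := (hφ.1 i).2 x hx

/-- Horizontal equivariant forms on `P` are forms on `X` with values in the associated bundle. -/
def tensorialEquiv (ha : SmoothRep EG a) (p : ℕ) :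
    B.tensorialForms a p ≃ₗ[ℝ] T.assocForms a p where
  toFun φ := ⟨T.baseForms φ.1, T.baseForms_mem_assocForms φ.2⟩
  map_add' φ ψ := Subtype.ext (T.baseForms_add φ.1 ψ.1)
  map_smul' c φ := Subtype.ext (T.baseForms_smul c φ.1)
  invFun φ := ⟨T.totalForm a φ.1, T.totalForm_mem ha φ.2⟩
  left_inv φ := Subtype.ext (T.eq_totalForm φ.2 (T.represents_baseForms φ.1)).symm
  right_inv φ := Subtype.ext (T.eq_baseForms (T.represents_totalForm ha φ.2)
    fun _ _ => T.eq_zero_of_notMem φ.2).symm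

end Manifold

end TrivCover

end TensorialForms

/-! ### The Maurer-Cartan form and existence of connections -/

section MaurerCartan

variable (EG G) in
/-- The left Maurer-Cartan form. -/
def maurerCartan : Form EG G 1 EG := fun g =>
  ContinuousAlternatingMap.ofSubsingleton ℝ EG EG (0 : Fin 1) (leftMul EG g⁻¹ g)

variable [LieGroup 𝓘(ℝ, EG) ∞ G] [FiniteDimensional ℝ EG]

/-- In a chart with inverse `s` the form is, on the diagonal z = y, the derivative in y of the
jointly smooth map s(z)⁻¹ s(y). -/
theorem formSmoothAt_maurerCartan (g₀ : G) : FormSmoothAt (maurerCartan EG G) g₀ := by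
  let y₀ := chartAt EG g₀ g₀
  have hy₀ : y₀ ∈ (chartAt EG g₀).target := (chartAt EG g₀).map_source (mem_chart_source EG g₀)
  let s : EG → G := (chartAt EG g₀).symm
  let m : EG × EG → EG := fun w => chartAt EG (1 : G) ((s w.1)⁻¹ * s w.2)
  have hm : ∀ y ∈ (chartAt EG g₀).target, ContDiffAt ℝ ∞ m (y, y) := by
    intro y hy
    refine (ContMDiffAt.comp (y, y) (contMDiffAt_chartAt ?_)
      (ContMDiffAt.mul (contMDiffAt_chart_symm_fst EG (z := (y, y)) (g₀ := g₀) hy).inv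
        (contMDiffAt_chart_symm_snd EG (z := (y, y)) (g₀ := g₀) hy))).contDiffAt
    simp
  have hA : ∀ y ∈ (chartAt EG g₀).target, ∀ A, leftMul EG (s y)⁻¹ (s y) (tmap EG EG s y A) =
      fderiv ℝ m (y, y) (0, A) := by
    intro y hy A
    have hs : MDifferentiableAt 𝓘(ℝ, EG) 𝓘(ℝ, EG) s y := mdifferentiableAt_chartAt_symm hy
    have h1 := DFunLike.congr_fun (fderiv_partial_right ((hm y hy).differentiableAt (by simp))) A
    have h2 := tmap_comp_apply (g := chartAt EG (1 : G)) (f := fun w => (s y)⁻¹ * s w) (x := y)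
      (mdifferentiableAt_chartAt (by simp))
      (MDifferentiableAt.comp y (mdifferentiableAt_mul_left EG _ _) hs) A
    rw [inv_mul_cancel, tmap_chart_self, tmap_mul_left EG hs, tmap_eq_fderiv] at h2
    exact h2.symm.trans h1
  refine contDiffAt_alternating fun v => ?_
  have h1 : ContDiffAt ℝ ∞ (fun y => fderiv ℝ m (y, y) (0, v 0)) y₀ := by
    have h2 : ContDiffAt ℝ ∞ (fderiv ℝ m) (y₀, y₀) := (hm y₀ hy₀).fderiv_right (by simp)
    have h3 : ContDiffAt ℝ ∞ (fun y => fderiv ℝ m (y, y)) y₀ :=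
      ContDiffAt.comp y₀ h2 (contDiffAt_id.prodMk contDiffAt_id)
    exact h3.clm_apply contDiffAt_const
  refine h1.congr_of_eventuallyEq ?_
  filter_upwards [(chartAt EG g₀).open_target.mem_nhds hy₀] with y hy
  exact hA y hy (v 0)

end MaurerCartan

section FiniteSums

variable {E M V : Type*} [NormedAddCommGroup E] [NormedSpace ℝ E] [TopologicalSpace M]
  [ChartedSpace E M] [NormedAddCommGroup V] [NormedSpace ℝ V] {p : ℕ}

theorem FormSmoothAt.zero (x : M) : FormSmoothAt (0 : Form E M p V) x := by
  refine ContDiffAt.congr_of_eventuallyEq (contDiffAt_const (c := 0))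
    (Eventually.of_forall fun y => ?_)
  ext v
  simp [inChart, pull_apply]

theorem FormSmoothAt.sum {κ : Type*} (s : Finset κ) {φ : κ → Form E M p V} {x : M}
    (h : ∀ k ∈ s, FormSmoothAt (φ k) x) : FormSmoothAt (∑ k ∈ s, φ k) x := by
  classical
  induction s using Finset.induction_on with
  | empty => exact FormSmoothAt.zero x
  | insert k s hk ih =>
    rw [Finset.sum_insert hk]
    exact (h k (Finset.mem_insert_self k s)).add
      (ih fun l hl => h l (Finset.mem_insert_of_mem hl))

end FiniteSums

section Connections

variable {B : PrincipalBundle EX EG EP X G P} {ι : Type*} (T : TrivCover B ι)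
  [LieGroup 𝓘(ℝ, EG) ∞ G]

theorem PrincipalBundle.connection_fundamental {θ : Form EP P 1 EG} (hθ : θ ∈ B.connections)
    (u : P) (A : EG) : toLin (θ u) (B.fundamental u A) = A := by
  rw [← apply_one]
  exact hθ.2.2 u A

theorem PrincipalBundle.connection_tmap_act {θ : Form EP P 1 EG} (hθ : θ ∈ B.connections)
    (g : G) (u : P) (v : EP) :
    toLin (θ (B.act u g)) (tmap EP EP (fun u => B.act u g) u v) = Ad EG g⁻¹ (toLin (θ u) v) :=
  DFunLike.congr_fun (hθ.2.1 g u) (fun _ => v)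

namespace TrivCover

section LocalConnections

variable [IsManifold 𝓘(ℝ, EX) ∞ X] [IsManifold 𝓘(ℝ, EP) ∞ P]
  [FiniteDimensional ℝ EX] [FiniteDimensional ℝ EP] [FiniteDimensional ℝ EG]

/-- A principal bundle has a connection. -/
theorem nonempty_connections (T : TrivCover B ι) [T2Space X] [SecondCountableTopology X] :
    B.connections.Nonempty := by
  have : LocallyCompactSpace X := ChartedSpace.locallyCompactSpace EX X
  obtain ⟨f, hf⟩ := SmoothPartitionOfUnity.exists_isSubordinate 𝓘(ℝ, EX) (isClosed_univ (X := X))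
    T.U T.isOpen_U (fun x _ => mem_iUnion.2 (T.covers x))
  have hsup : ∀ i x, f i x ≠ 0 → x ∈ T.U i := fun i x h => hf i (subset_tsupport _ h)
  let μ : ι → Form EP P 1 EG := fun i => pull EP EG (T.fib i) (maurerCartan EG G)
  have hμ : ∀ i u v, μ i u v =
      leftMul EG (T.fib i u)⁻¹ (T.fib i u) (tmap EP EG (T.fib i) u (v 0)) := fun _ _ _ => rfl
  -- Over `T.U i` the form `μ i` satisfies the conditions on a connection. These conditions are
  -- affine, so they survive averaging with weights that are constant on fibres and sum to one.
  -- Elsewhere the values of `μ i` are meaningless, but there the weight is zero.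
  let θ : Form EP P 1 EG := fun u => ∑ᶠ i, f i (B.proj u) • μ i u
  have hfin : ∀ x : X, ∃ s : Finset ι, ∀ᶠ y in 𝓝 x,
      ∑ i ∈ s, f i y = 1 ∧ Function.support (fun i => f i y) ⊆ s := fun x => by
    exact f.toPartitionOfUnity.exists_finset_nhds x
  have hsum : ∀ (s : Finset ι) (u : P), Function.support (fun i => f i (B.proj u)) ⊆ s →
      θ u = ∑ i ∈ s, f i (B.proj u) • μ i u := fun s u hs => by
    refine finsum_eq_sum_of_support_subset _ fun i hi => hs fun h => hi ?_
    simp only [h, zero_smul]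
  have happly : ∀ (u : P) (v : Fin 1 → EP) (c : EG), (∀ i, B.proj u ∈ T.U i → μ i u v = c) →
      θ u v = c := fun u v c h => by
    obtain ⟨s, hs⟩ := hfin (B.proj u)
    obtain ⟨hs1, hs2⟩ := hs.self_of_nhds
    rw [hsum s u hs2, ContinuousAlternatingMap.sum_apply]
    calc ∑ i ∈ s, (f i (B.proj u) • μ i u) v = ∑ i ∈ s, f i (B.proj u) • c := by
          refine Finset.sum_congr rfl fun i _ => ?_
          by_cases h0 : f i (B.proj u) = 0
          · simp [h0]
          · rw [ContinuousAlternatingMap.smul_apply, h i (hsup i _ h0)]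
      _ = c := by rw [← Finset.sum_smul, hs1, one_smul]
  refine ⟨θ, (mem_formsOn_iff isOpen_univ).2 ⟨fun u _ => ?_, fun u hu => (hu (mem_univ u)).elim⟩,
    fun g u => ?_, fun u A => ?_⟩
  · obtain ⟨s, hs⟩ := hfin (B.proj u)
    have h1 : FormSmoothAt (∑ i ∈ s, fun w => f i (B.proj w) • μ i w) u := by
      refine FormSmoothAt.sum s fun i _ => ?_
      by_cases hi : B.proj u ∈ T.U i
      · have h2 : FormSmoothAt (μ i) u :=
          FormSmoothAt.pull (contMDiffAt_fib hi) (formSmoothAt_maurerCartan _)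
        exact h2.smul (ContMDiffAt.comp u (f i).contMDiff.contMDiffAt (B.contMDiff_proj u))
      -- Here `μ i` need not be smooth, but `u` has a neighbourhood that projects off the support of
      -- `f i`.
      · refine (FormSmoothAt.zero u).congr ?_
        have h2 : (tsupport (f i))ᶜ ∈ 𝓝 (B.proj u) :=
          (isClosed_tsupport _).isOpen_compl.mem_nhds fun h => hi (hf i h)
        filter_upwards [B.contMDiff_proj.continuous.continuousAt.preimage_mem_nhds h2] with w hw
        rw [image_eq_zero_of_notMem_tsupport hw, zero_smul]
        rfl
    refine h1.congr ?_
    filter_upwards [B.contMDiff_proj.continuous.continuousAt.eventually hs] with w hw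
    rw [hsum s w hw.2, Finset.sum_apply]
  · obtain ⟨s, hs⟩ := hfin (B.proj u)
    have hs2 := hs.self_of_nhds.2
    ext v
    rw [pull_apply, hsum s (B.act u g) (by rwa [B.proj_act])]
    simp only [ContinuousLinearMap.compContinuousAlternatingMap_coe, Function.comp_apply]
    rw [hsum s u hs2, ContinuousAlternatingMap.sum_apply, ContinuousAlternatingMap.sum_apply,
      map_sum]
    refine Finset.sum_congr rfl fun i _ => ?_
    rw [B.proj_act, ContinuousAlternatingMap.smul_apply, ContinuousAlternatingMap.smul_apply,
      map_smul]
    by_cases h0 : f i (B.proj u) = 0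
    · rw [h0, zero_smul, zero_smul]
    · rw [hμ, hμ, leftMul_tmap_fib_tmap_act (hsup i _ h0)]
  · exact happly _ _ _ fun i hi => by
      rw [hμ]
      exact leftMul_tmap_fib_fundamental hi A

end LocalConnections

end TrivCover

end Connections

/-! ### Smooth vector fields in charts -/

section VectorFields

variable {E M : Type*} [NormedAddCommGroup E] [NormedSpace ℝ E] [TopologicalSpace M]
  [ChartedSpace E M] [IsManifold 𝓘(ℝ, E) ∞ M]

/-- The trivialization of the tangent bundle over a chart domain is the derivative of the chart.
Both sides thus concern the same coordinate function, once on the manifold and once in the chart. -/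
theorem contMDiffAt_vectorField_iff (Z : Π x : M, TangentSpace 𝓘(ℝ, E) x) (x₀ : M) :
    ContMDiffAt 𝓘(ℝ, E) (𝓘(ℝ, E).prod 𝓘(ℝ, E)) ∞ (fun x => TotalSpace.mk' E x (Z x)) x₀ ↔
      ContDiffAt ℝ ∞ (vfInChart x₀ Z) (chartAt E x₀ x₀) := by
  have : IsManifold 𝓘(ℝ, E) 1 M := IsManifold.of_le (n := ∞) (by simp)
  have hx := mem_chart_source E x₀
  have hx' := (chartAt E x₀).map_source hx
  have hs : ContMDiffAt 𝓘(ℝ, E) 𝓘(ℝ, E) ∞ (chartAt E x₀).symm (chartAt E x₀ x₀) :=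
    contMDiffAt_chartAt_symm hx'
  have h1 : (fun x => (trivializationAt E (TangentSpace 𝓘(ℝ, E)) x₀ ⟨x, Z x⟩).2) =ᶠ[𝓝 x₀]
      fun x => tmap E E (chartAt E x₀) x (Z x) := by
    filter_upwards [(chartAt E x₀).open_source.mem_nhds hx] with x hxs
    have h2 := TangentBundle.continuousLinearMapAt_trivializationAt (I := 𝓘(ℝ, E)) hxs
    have h3 := DFunLike.congr_fun h2 (Z x)
    refine Eq.trans ?_ h3
    refine (Trivialization.continuousLinearMapAt_apply_of_mem ℝ
      (trivializationAt E (TangentSpace 𝓘(ℝ, E) : M → Type _) x₀) ?_ (Z x)).symm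
    exact hxs
  rw [contMDiffAt_section, h1.contMDiffAt_iff]
  constructor
  · intro h
    refine (ContMDiffAt.comp (chartAt E x₀ x₀) (g := fun x => tmap E E (chartAt E x₀) x (Z x))
      ?_ hs).contDiffAt
    rwa [(chartAt E x₀).left_inv hx]
  · intro h
    refine (ContMDiffAt.comp x₀ h.contMDiffAt (contMDiffAt_chartAt hx)).congr_of_eventuallyEq ?_
    filter_upwards [(chartAt E x₀).open_source.mem_nhds hx] with x hxs
    simp only [Function.comp, vfInChart]
    rw [(chartAt E x₀).left_inv hxs]

theorem VF.contDiffAt_inChart (ξ : VF E M) (x₀ : M) :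
    ContDiffAt ℝ ∞ (vfInChart x₀ ξ.val) (chartAt E x₀ x₀) :=
  (contMDiffAt_vectorField_iff (fun x => ξ x) x₀).1 (ξ.contMDiff x₀)

/-- The smooth vector field with given values. -/
def VF.ofSmooth (Z : M → E) (h : ∀ x₀, ContDiffAt ℝ ∞ (vfInChart x₀ Z) (chartAt E x₀ x₀)) :
    VF E M where
  toFun := Z
  contMDiff_toFun x₀ := (contMDiffAt_vectorField_iff Z x₀).2 (h x₀)

theorem VF.val_add (ξ η : VF E M) (x : M) : (ξ + η).val x = ξ.val x + η.val x := rfl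

theorem VF.val_smul (c : ℝ) (ξ : VF E M) (x : M) : (c • ξ).val x = c • ξ.val x := rfl

theorem VF.ext_val {ξ η : VF E M} (h : ∀ x, ξ.val x = η.val x) : ξ = η :=
  ContMDiffSection.ext h

end VectorFields

/-! ### The splitting of tangent spaces by a connection -/

section Splitting

variable {B : PrincipalBundle EX EG EP X G P} {ι : Type*}
  [IsManifold 𝓘(ℝ, EX) ∞ X] [IsManifold 𝓘(ℝ, EP) ∞ P] [LieGroup 𝓘(ℝ, EG) ∞ G]
  [FiniteDimensional ℝ EX] [FiniteDimensional ℝ EP] [FiniteDimensional ℝ EG]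
  {θ : Form EP P 1 EG}

/-- Horizontal and vertical component of tangent vectors of `P` for a connection `θ`. -/
def PrincipalBundle.splitMap (B : PrincipalBundle EX EG EP X G P) (θ : Form EP P 1 EG) (u : P) :
    EP →L[ℝ] EX × EG := (tmap EP EX B.proj u).prod (toLin (θ u))

theorem TrivCover.splitMap_injective (T : TrivCover B ι) (hθ : θ ∈ B.connections) (u : P) :
    Function.Injective (B.splitMap θ u) := by
  refine (injective_iff_map_eq_zero _).2 fun v hv => ?_
  have h1 : tmap EP EX B.proj u v = 0 := congrArg Prod.fst hv
  have h2 : toLin (θ u) v = 0 := congrArg Prod.snd hv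
  have h3 := vertical_eq_fundamental (T.mem_U_index (B.proj u)) h1
  rw [h3, B.connection_fundamental hθ] at h2
  rw [h3, h2, B.fundamental_zero]

theorem TrivCover.splitMap_surjective (T : TrivCover B ι) (hθ : θ ∈ B.connections) (u : P) :
    Function.Surjective (B.splitMap θ u) := by
  rintro ⟨v, A⟩
  have hi := T.mem_U_index (B.proj u)
  set i := T.index (B.proj u)
  -- Some vector over `v`: the one tangent to the canonical section, translated to `u`. A
  -- fundamental vector then corrects its θ-component without changing its projection.
  let w : EP := tmap EP EP (fun w => B.act w (T.fib i u)) (T.sec i (B.proj u))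
    (tmap EX EP (T.sec i) (B.proj u) v)
  have hw : tmap EP EX B.proj u w = v := by
    have h := B.tmap_proj_tmap_act (T.fib i u) (T.sec i (B.proj u))
      (tmap EX EP (T.sec i) (B.proj u) v)
    rwa [act_sec_fib hi, tmap_proj_tmap_sec hi] at h
  refine ⟨w + B.fundamental u (A - toLin (θ u) w), ?_⟩
  refine Prod.ext ?_ ?_
  · change tmap EP EX B.proj u (_ + _) = v
    rw [map_add, B.tmap_proj_fundamental, add_zero, hw]
  · change toLin (θ u) (_ + _) = A
    rw [map_add, B.connection_fundamental hθ, add_sub_cancel]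

/-- The decomposition of tangent vectors of `P` defined by a connection. -/
def TrivCover.splitEquiv (T : TrivCover B ι) (hθ : θ ∈ B.connections) (u : P) :
    EP ≃L[ℝ] EX × EG :=
  (LinearEquiv.ofBijective (B.splitMap θ u : EP →ₗ[ℝ] EX × EG)
    ⟨T.splitMap_injective hθ u, T.splitMap_surjective hθ u⟩).toContinuousLinearEquiv

theorem TrivCover.coe_splitEquiv (T : TrivCover B ι) (hθ : θ ∈ B.connections) (u : P) :
    (T.splitEquiv hθ u : EP →L[ℝ] EX × EG) = B.splitMap θ u := rfl

theorem contDiffAt_clm_of_apply {H F V : Type*} [NormedAddCommGroup H] [NormedSpace ℝ H]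
    [NormedAddCommGroup F] [NormedSpace ℝ F] [FiniteDimensional ℝ F] [NormedAddCommGroup V]
    [NormedSpace ℝ V] {n : WithTop ℕ∞} {A : H → F →L[ℝ] V} {y : H}
    (h : ∀ v, ContDiffAt ℝ n (fun z => A z v) y) : ContDiffAt ℝ n A y := by
  let d := Module.finrank ℝ F
  have hd : d = Module.finrank ℝ (Fin d → ℝ) := (Module.finrank_fin_fun ℝ).symm
  let e₁ := ContinuousLinearEquiv.ofFinrankEq hd
  let e₂ := (e₁.arrowCongr (1 : V ≃L[ℝ] V)).trans (ContinuousLinearEquiv.piRing (Fin d))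
  rw [← Function.id_comp A, ← e₂.symm_comp_self]
  exact e₂.symm.contDiff.contDiffAt.comp y (contDiffAt_pi.2 fun i => h _)

/-- A vector field on `P` is smooth if its horizontal and vertical components are. -/
theorem TrivCover.contDiffAt_of_splitMap (T : TrivCover B ι) (hθ : θ ∈ B.connections) {Z : P → EP}
    {ξ : VF EX X} (hξ : ∀ u, tmap EP EX B.proj u (Z u) = ξ.val (B.proj u))
    {f : Form EP P 0 EG} (hf : f ∈ formsOn EP 0 EG (univ : Set P))
    (hZ : ∀ u, toLin (θ u) (Z u) = f u ![]) (u₀ : P) :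
    ContDiffAt ℝ ∞ (vfInChart u₀ Z) (chartAt EP u₀ u₀) := by
  set y₀ := chartAt EP u₀ u₀ with hy₀
  let s : EP → P := (chartAt EP u₀).symm
  let c := chartAt EX (B.proj u₀)
  have hus := mem_chart_source EP u₀
  have hyt : y₀ ∈ (chartAt EP u₀).target := (chartAt EP u₀).map_source hus
  have hsy : s y₀ = u₀ := (chartAt EP u₀).left_inv hus
  have hs : ContMDiffAt 𝓘(ℝ, EP) 𝓘(ℝ, EP) ∞ s y₀ := contMDiffAt_chartAt_symm hyt
  have hπs : ContMDiffAt 𝓘(ℝ, EP) 𝓘(ℝ, EX) ∞ (fun y => B.proj (s y)) y₀ :=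
    ContMDiffAt.comp y₀ (B.contMDiff_proj _) hs
  have hF : ContDiffAt ℝ ∞ (fun y => c (B.proj (s y))) y₀ := by
    refine (ContMDiffAt.comp y₀ (contMDiffAt_chartAt ?_) hπs).contDiffAt
    rw [hsy]
    exact mem_chart_source EX _
  -- The coordinate expression of (dπ, θ). In the chart, `Z` solves a linear system with the smooth
  -- matrix `A` and smooth right-hand side `r`, and inversion is smooth at an invertible matrix.
  let A : EP → EP →L[ℝ] EX × EG := fun y =>
    (fderiv ℝ (fun y => c (B.proj (s y))) y).prod (toLin (inChart u₀ θ y))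
  have hA : ContDiffAt ℝ ∞ A y₀ := by
    have h1 : ContDiffAt ℝ ∞ (fderiv ℝ (fun y => c (B.proj (s y)))) y₀ := hF.fderiv_right (by simp)
    have h2 : ContDiffAt ℝ ∞ (inChart u₀ θ) y₀ := TrivCover.formSmoothAt_of_mem hθ.1 u₀
    exact contDiffAt_clm_of_apply fun v => (h1.clm_apply contDiffAt_const).prodMk
      (contDiffAt_alternating_apply (w := fun _ _ => v) h2 fun _ => contDiffAt_const)
  have hA₀ : A y₀ = T.splitEquiv hθ u₀ := by
    rw [T.coe_splitEquiv]
    ext v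
    · change fderiv ℝ (fun y => c (B.proj (s y))) y₀ v = tmap EP EX B.proj u₀ v
      have h1 := tmap_comp_apply (g := c) (f := fun y => B.proj (s y)) (x := y₀)
        (mdifferentiableAt_chartAt (by rw [hsy]; exact mem_chart_source EX _))
        (hπs.mdifferentiableAt (by simp)) v
      have h2 := tmap_comp_apply (g := B.proj) (f := s) (x := y₀) (B.mdifferentiableAt_proj _)
        (hs.mdifferentiableAt (by simp)) v
      have h3 : tmap EP EP s y₀ = ContinuousLinearMap.id ℝ EP := tmap_chart_symm_self u₀
      rw [h2, h3, hsy, tmap_chart_self, tmap_eq_fderiv] at h1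
      exact h1
    · have h3 : tmap EP EP s y₀ = ContinuousLinearMap.id ℝ EP := tmap_chart_symm_self u₀
      change θ (s y₀) (fun _ => tmap EP EP s y₀ v) = θ u₀ (fun _ => v)
      rw [h3, hsy]
      rfl
  let r : EP → EX × EG := fun y => (vfInChart (B.proj u₀) ξ.val (c (B.proj (s y))), f (s y) ![])
  have hr : ContDiffAt ℝ ∞ r y₀ := by
    have h1 : ContDiffAt ℝ ∞ (vfInChart (B.proj u₀) ξ.val) (c (B.proj (s y₀))) := by
      rw [hsy]
      exact ξ.contDiffAt_inChart _
    have h2 : ContDiffAt ℝ ∞ (inChart u₀ f) y₀ := TrivCover.formSmoothAt_of_mem hf u₀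
    have h3 := contDiffAt_alternating_apply (w := ![]) h2 fun k => k.elim0
    refine (ContDiffAt.comp y₀ h1 hF).prodMk (h3.congr_of_eventuallyEq ?_)
    exact Eventually.of_forall fun y => congrArg (f (s y)) (Subsingleton.elim _ _)
  have hAZ : ∀ᶠ y in 𝓝 y₀, A y (vfInChart u₀ Z y) = r y := by
    have h1 : ∀ᶠ y in 𝓝 y₀, B.proj (s y) ∈ c.source := by
      refine hπs.continuousAt.preimage_mem_nhds (c.open_source.mem_nhds ?_)
      rw [hsy]
      exact mem_chart_source EX _
    filter_upwards [h1, (chartAt EP u₀).open_target.mem_nhds hyt] with y hy hyt'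
    have hsd : MDifferentiableAt 𝓘(ℝ, EP) 𝓘(ℝ, EP) s y := mdifferentiableAt_chartAt_symm hyt'
    have hback : tmap EP EP s y (vfInChart u₀ Z y) = Z (s y) := by
      have h2 := tmap_chart_symm_tmap_chart ((chartAt EP u₀).map_target hyt') (Z (s y))
      rwa [(chartAt EP u₀).right_inv hyt'] at h2
    refine Prod.ext ?_ ?_
    · change fderiv ℝ (fun y => c (B.proj (s y))) y (vfInChart u₀ Z y) = _
      have h2 := tmap_comp_apply (g := c) (f := fun y => B.proj (s y)) (x := y)
        (mdifferentiableAt_chartAt hy)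
        (MDifferentiableAt.comp y (B.mdifferentiableAt_proj _) hsd) (vfInChart u₀ Z y)
      have h3 := tmap_comp_apply (g := B.proj) (f := s) (x := y) (B.mdifferentiableAt_proj _)
        hsd (vfInChart u₀ Z y)
      rw [h3, hback, hξ, tmap_eq_fderiv] at h2
      rw [h2]
      change _ = tmap EX EX c (c.symm (c (B.proj (s y)))) (ξ.val (c.symm (c (B.proj (s y)))))
      rw [c.left_inv hy]
    · change θ (s y) (fun _ => tmap EP EP s y (vfInChart u₀ Z y)) = f (s y) ![]
      rw [hback, ← hZ]
      rfl
  have hinv : ContDiffAt ℝ ∞ (fun y => (A y).inverse (r y)) y₀ := by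
    refine ContDiffAt.clm_apply (ContDiffAt.comp y₀ (g := ContinuousLinearMap.inverse) ?_ hA) hr
    rw [hA₀]
    exact contDiffAt_map_inverse _
  refine hinv.congr_of_eventuallyEq ?_
  -- `ContinuousLinearMap.inverse` is a true inverse only on invertible maps, which form an open
  -- set.
  have hAe : ∀ᶠ y in 𝓝 y₀, A y ∈ range ((↑) : (EP ≃L[ℝ] EX × EG) → EP →L[ℝ] EX × EG) := by
    refine hA.continuousAt.preimage_mem_nhds ?_
    rw [hA₀]
    exact ContinuousLinearEquiv.nhds _
  filter_upwards [hAZ, hAe] with y hy hye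
  obtain ⟨e, he⟩ := hye
  rw [← hy, ← he, ContinuousLinearMap.inverse_equiv]
  exact (e.symm_apply_apply _).symm

end Splitting

/-! ### Connections on P and gauge fields on X -/

section Affine

variable {B : PrincipalBundle EX EG EP X G P} {ι : Type*}

namespace TrivCover

/-- Together with `connection_sub_mem` this is the affine structure that reduces the correspondence
for connections to the linear one for horizontal equivariant forms. -/
theorem connection_add_mem {θ : Form EP P 1 EG} (hθ : θ ∈ B.connections) {φ : Form EP P 1 EG}
    (hφ : φ ∈ B.tensorialForms (Ad EG) 1) : θ + φ ∈ B.connections := by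
  refine ⟨add_mem hθ.1 hφ.1, fun g u => ?_, fun u A => ?_⟩
  · ext v
    have h := DFunLike.congr_fun (hθ.2.1 g u) v
    have h' := DFunLike.congr_fun (hφ.2.2 g u) v
    simp only [pull_apply, ContinuousLinearMap.compContinuousAlternatingMap_coe,
      Function.comp_apply, Pi.add_apply, ContinuousAlternatingMap.add_apply, map_add] at h h' ⊢
    rw [h, h']
  · rw [Pi.add_apply, ContinuousAlternatingMap.add_apply, hθ.2.2,
      hφ.2.1 u _ ⟨0, B.tmap_proj_fundamental u A⟩, add_zero]

variable (T : TrivCover B ι)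

theorem baseForms_one_apply (φ : Form EP P 1 EG) {i : ι} {x : X} (hx : x ∈ T.U i) (v : EX) :
    toLin (T.baseForms φ i x) v = toLin (φ (T.sec i x)) (tmap EX EP (T.sec i) x v) := by
  rw [T.baseForms_of_mem φ hx]
  rfl

theorem gaugeFields_sub_mem {η η' : ι → Form EX X 1 EG} (h : η ∈ T.gaugeFields)
    (h' : η' ∈ T.gaugeFields) : η - η' ∈ T.assocForms (Ad EG) 1 := by
  refine ⟨fun i => sub_mem (h.1 i) (h'.1 i), fun i j x hx => ?_⟩
  ext v
  rw [fin_one_eq v]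
  simp only [Pi.sub_apply, ContinuousAlternatingMap.sub_apply, h.2 i j x hx, h'.2 i j x hx,
    ContinuousLinearMap.compContinuousAlternatingMap_coe, Function.comp_apply, map_sub]
  abel

end TrivCover

end Affine

section Correspondences

variable {B : PrincipalBundle EX EG EP X G P} {ι : Type*}
  [IsManifold 𝓘(ℝ, EX) ∞ X] [IsManifold 𝓘(ℝ, EP) ∞ P] [LieGroup 𝓘(ℝ, EG) ∞ G]
  [FiniteDimensional ℝ EX] [FiniteDimensional ℝ EP] [FiniteDimensional ℝ EG]
  {θ θ' : Form EP P 1 EG}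

namespace TrivCover

variable (T : TrivCover B ι)

theorem connection_sub_mem (T : TrivCover B ι) (hθ : θ ∈ B.connections) (hθ' : θ' ∈ B.connections) :
    θ - θ' ∈ B.tensorialForms (Ad EG) 1 := by
  refine ⟨sub_mem hθ.1 hθ'.1, fun u v ⟨k, hk⟩ => ?_, fun g u => ?_⟩
  · obtain rfl : k = 0 := Subsingleton.elim _ _
    rw [fin_one_eq v, apply_one,
      vertical_eq_fundamental (T.mem_U_index (B.proj u)) hk, ← apply_one, Pi.sub_apply,
      ContinuousAlternatingMap.sub_apply, hθ.2.2, hθ'.2.2, sub_self]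
  · ext v
    have h := DFunLike.congr_fun (hθ.2.1 g u) v
    have h' := DFunLike.congr_fun (hθ'.2.1 g u) v
    simp only [pull_apply, ContinuousLinearMap.compContinuousAlternatingMap_coe,
      Function.comp_apply, Pi.sub_apply, ContinuousAlternatingMap.sub_apply, map_sub] at h h' ⊢
    rw [h, h']

/-- Of the two summands in `tmap_sec_eq`, the translate gives the adjoint term by equivariance and
the fundamental vector returns the gauge term. -/
theorem baseForms_mem_gaugeFields (hθ : θ ∈ B.connections) : T.baseForms θ ∈ T.gaugeFields := by
  refine ⟨T.baseForms_mem_formsOn hθ.1, fun i j x ⟨hi, hj⟩ v => ?_⟩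
  rw [apply_one, apply_one, T.baseForms_one_apply θ hi, T.baseForms_one_apply θ hj,
    tmap_sec_eq hi hj, map_add, B.connection_fundamental hθ, trans_eq_inv hi hj,
    ← B.connection_tmap_act hθ, act_sec_trans hi hj]

variable [T2Space X] [SecondCountableTopology X]

/-- A chosen connection. -/
def someConnection : Form EP P 1 EG := T.nonempty_connections.some

theorem someConnection_mem : T.someConnection ∈ B.connections := T.nonempty_connections.some_mem

/-- Connections on `P` are families of local gauge fields on `X`. -/
def connectionEquiv : B.connections ≃ T.gaugeFields where
  toFun θ := ⟨T.baseForms θ.1, T.baseForms_mem_gaugeFields θ.2⟩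
  -- A gauge field is not tensorial; its difference from the gauge field of a reference connection
  -- is, and can be extended to P.
  invFun η := ⟨T.someConnection + T.totalForm (Ad EG) (η.1 - T.baseForms T.someConnection),
    connection_add_mem T.someConnection_mem (T.totalForm_mem (smoothRep_Ad EG)
      (T.gaugeFields_sub_mem η.2 (T.baseForms_mem_gaugeFields T.someConnection_mem)))⟩
  left_inv θ := by
    apply Subtype.ext
    have h1 := T.connection_sub_mem θ.2 T.someConnection_mem
    have h2 : T.baseForms θ.1 - T.baseForms T.someConnection =
        T.baseForms (θ.1 - T.someConnection) := by
      rw [sub_eq_iff_eq_add, ← T.baseForms_add, sub_add_cancel]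
    change T.someConnection + T.totalForm (Ad EG) (T.baseForms θ.1 - _) = θ.1
    rw [h2, ← T.eq_totalForm h1 (T.represents_baseForms _), add_sub_cancel]
  right_inv η := by
    apply Subtype.ext
    have h1 := T.gaugeFields_sub_mem η.2 (T.baseForms_mem_gaugeFields T.someConnection_mem)
    change T.baseForms (T.someConnection + _) = η.1
    rw [T.baseForms_add, ← T.eq_baseForms (T.represents_totalForm (smoothRep_Ad EG) h1)
      fun _ _ => T.eq_zero_of_notMem h1, add_sub_cancel]

/-- Pairs on the total space are pairs on the base. -/
def pairEquiv : B.TotalPair ≃ T.BasePair :=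
  T.connectionEquiv.prodCongr
    ((LinearEquiv.refl ℝ (VF EX X)).arrowCongr (T.tensorialEquiv (smoothRep_Ad EG) 0)).toEquiv

end TrivCover

/-! ### Lifts and their vertical components -/

section Lifts

theorem contr_zero_apply {E M V : Type*} [NormedAddCommGroup E] [NormedSpace ℝ E]
    [NormedAddCommGroup V] [NormedSpace ℝ V] (Z : M → E) (φ : Form E M 1 V) (x : M)
    (v : Fin 0 → E) : contr Z φ x v = toLin (φ x) (Z x) := by
  rw [fin_zero_eq v, ← apply_one]
  rfl

theorem form_zero_ext {E M V : Type*} [NormedAddCommGroup E] [NormedSpace ℝ E]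
    [NormedAddCommGroup V] [NormedSpace ℝ V] {φ ψ : Form E M 0 V}
    (h : ∀ x, φ x ![] = ψ x ![]) : φ = ψ := by
  funext x
  ext v
  rw [fin_zero_eq v]
  exact h x

/-- The contraction of an equivariant form with an invariant vector field is equivariant. -/
theorem PrincipalBundle.pull_act_contr {V : Type*} [NormedAddCommGroup V] [NormedSpace ℝ V]
    {p : ℕ} {φ : Form EP P (p + 1) V} {A : V →L[ℝ] V} {g : G} {u : P}
    (hφ : pull EP EP (fun u => B.act u g) φ u = A.compContinuousAlternatingMap (φ u))
    {Z : VF EP P} (hZ : Z ∈ B.invariantVF) :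
    pull EP EP (fun u => B.act u g) (contr Z.val φ) u =
      A.compContinuousAlternatingMap (contr Z.val φ u) := by
  ext v
  -- By invariance the translate of Z(u) is Z(u·g), so the inserted argument is translated together
  -- with the others.
  have h := DFunLike.congr_fun hφ (Matrix.vecCons (Z.val u) v)
  refine Eq.trans ?_ h
  rw [pull_apply, pull_apply, contr, ContinuousAlternatingMap.curryLeft_apply_apply, ← hZ g u]
  congr 1
  ext k
  refine Fin.cases ?_ (fun k => ?_) k <;> rfl

theorem contr_mem_tensorialForms (hθ : θ ∈ B.connections) (Z : B.invariantVF) :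
    contr Z.1.val θ ∈ B.tensorialForms (Ad EG) 0 := by
  refine ⟨(mem_formsOn_iff isOpen_univ).2 ⟨fun u _ => ?_, fun u hu => (hu (mem_univ u)).elim⟩,
    fun u v ⟨k, _⟩ => k.elim0, fun g u => B.pull_act_contr (hθ.2.1 g u) Z.2⟩
  exact (TrivCover.formSmoothAt_of_mem hθ.1 u).contr (Z.1.contDiffAt_inChart u)

variable (T : TrivCover B ι)

/-- The value at `u` of the lift of `ξ` with vertical component `f`. -/
def TrivCover.liftVec (hθ : θ ∈ B.connections) (ξ : VF EX X) (f : Form EP P 0 EG) (u : P) : EP :=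
  (T.splitEquiv hθ u).symm (ξ.val (B.proj u), f u ![])

theorem TrivCover.splitMap_liftVec (hθ : θ ∈ B.connections) (ξ : VF EX X) (f : Form EP P 0 EG)
    (u : P) : B.splitMap θ u (T.liftVec hθ ξ f u) = (ξ.val (B.proj u), f u ![]) :=
  (T.splitEquiv hθ u).apply_symm_apply _

/-- The lift of `ξ` with vertical component `f`. -/
def TrivCover.liftVF (hθ : θ ∈ B.connections) (ξ : VF EX X) (f : B.tensorialForms (Ad EG) 0) :
    B.invariantVF where
  val := VF.ofSmooth (T.liftVec hθ ξ f.1) (T.contDiffAt_of_splitMap hθ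
    (fun u => congrArg Prod.fst (T.splitMap_liftVec hθ ξ f.1 u)) f.2.1
    (fun u => congrArg Prod.snd (T.splitMap_liftVec hθ ξ f.1 u)))
  property g u := by
    change tmap EP EP (fun u => B.act u g) u (T.liftVec hθ ξ f.1 u) =
      T.liftVec hθ ξ f.1 (B.act u g)
    apply T.splitMap_injective hθ
    rw [T.splitMap_liftVec]
    have h := T.splitMap_liftVec hθ ξ f.1 u
    refine Prod.ext ?_ ?_
    · change tmap EP EX B.proj (B.act u g) _ = ξ.val (B.proj (B.act u g))
      rw [B.tmap_proj_tmap_act, B.proj_act]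
      exact congrArg Prod.fst h
    · change toLin (θ (B.act u g)) _ = f.1 (B.act u g) ![]
      have h1 := B.tensorial_apply_tmap_act f.2 g u ![]
      rw [fin_zero_eq (fun k => _)] at h1
      rw [B.connection_tmap_act hθ, h1]
      exact congrArg (Ad EG g⁻¹) (congrArg Prod.snd h)

/-- For a given connection, lifts are determined by their vertical components. -/
def TrivCover.liftsEquiv (hθ : θ ∈ B.connections) :
    B.lifts ≃ (VF EX X →ₗ[ℝ] B.tensorialForms (Ad EG) 0) where
  toFun l :=
    { toFun := fun ξ => ⟨contr (l.1 ξ).1.val θ, contr_mem_tensorialForms hθ (l.1 ξ)⟩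
      map_add' := fun ξ η => Subtype.ext <| form_zero_ext fun u => by
        refine (contr_zero_apply _ _ _ _).trans ?_
        rw [map_add]
        exact (map_add (toLin (θ u)) ((l.1 ξ).1.val u) ((l.1 η).1.val u)).trans
          (congrArg₂ (· + ·) (contr_zero_apply _ _ _ _).symm (contr_zero_apply _ _ _ _).symm)
      map_smul' := fun c ξ => Subtype.ext <| form_zero_ext fun u => by
        refine (contr_zero_apply _ _ _ _).trans ?_
        rw [map_smul]
        exact (map_smul (toLin (θ u)) c ((l.1 ξ).1.val u)).trans
          (congrArg (c • ·) (contr_zero_apply _ _ _ _).symm) }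
  invFun m := ⟨
    { toFun := fun ξ => T.liftVF hθ ξ (m ξ)
      map_add' := fun ξ η => Subtype.ext <| VF.ext_val fun u => by
        rw [map_add]
        exact map_add (T.splitEquiv hθ u).symm (ξ.val (B.proj u), (m ξ).1 u ![])
          (η.val (B.proj u), (m η).1 u ![])
      map_smul' := fun c ξ => Subtype.ext <| VF.ext_val fun u => by
        rw [map_smul]
        exact map_smul (T.splitEquiv hθ u).symm c (ξ.val (B.proj u), (m ξ).1 u ![]) },
    fun ξ u => congrArg Prod.fst (T.splitMap_liftVec hθ ξ (m ξ).1 u)⟩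
  left_inv l := Subtype.ext <| LinearMap.ext fun ξ => Subtype.ext <| VF.ext_val fun u => by
    apply T.splitMap_injective hθ u
    refine (T.splitMap_liftVec hθ ξ _ u).trans (Prod.ext (l.2 ξ u).symm ?_)
    exact contr_zero_apply _ _ _ _
  right_inv m := LinearMap.ext fun ξ => Subtype.ext <| form_zero_ext fun u => by
    refine (contr_zero_apply _ _ _ _).trans ?_
    exact congrArg Prod.snd (T.splitMap_liftVec hθ ξ (m ξ).1 u)

theorem TrivCover.liftsEquiv_apply (hθ : θ ∈ B.connections) (l : B.lifts) (ξ : VF EX X) :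
    (T.liftsEquiv hθ l ξ).1 = contr (l.1 ξ).1.val θ := rfl

theorem TrivCover.existsUnique_lift (T : TrivCover B ι) (q : B.TotalPair) :
    ∃! l : B.lifts, ∀ ξ, contr (l.1 ξ).1.val q.1.1 = (q.2 ξ).1 := by
  refine ⟨(T.liftsEquiv q.1.2).symm q.2, fun ξ => ?_, fun l hl => ?_⟩
  · rw [← T.liftsEquiv_apply q.1.2, Equiv.apply_symm_apply]
  · rw [Equiv.eq_symm_apply]
    exact LinearMap.ext fun ξ => Subtype.ext (hl ξ)

end Lifts

end Correspondences

/-! ### Correction terms, classes of pairs and lifts -/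

section BaseData

variable {B : PrincipalBundle EX EG EP X G P} {ι : Type*}
  [IsManifold 𝓘(ℝ, EX) ∞ X] [IsManifold 𝓘(ℝ, EP) ∞ P]
  [FiniteDimensional ℝ EX] [FiniteDimensional ℝ EG]

namespace TrivCover

variable (T : TrivCover B ι)

theorem contr_mem_formsOn {θ : ι → Form EX X 1 EG} (hθ : θ ∈ T.gaugeFields) (ξ : VF EX X) (i : ι) :
    contr ξ.val (θ i) ∈ formsOn EX 0 EG (T.U i) := by
  have h := (mem_formsOn_iff (T.isOpen_U i)).1 (hθ.1 i)
  refine (mem_formsOn_iff (T.isOpen_U i)).2 ⟨fun x hx =>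
    (h.1 x hx).contr (ξ.contDiffAt_inChart x), fun x hx => ?_⟩
  rw [contr, h.2 x hx]
  rfl

variable {T} in
theorem correction_apply {b : T.corrections} {ξ : VF EX X} {i : ι} {x : X} (hx : x ∉ T.U i) :
    (b.1 i ξ).1 x = 0 := (b.1 i ξ).2.2 x hx

theorem corrections_ext {b b' : T.corrections}
    (h : ∀ i ξ, ∀ x ∈ T.U i, (b.1 i ξ).1 x ![] = (b'.1 i ξ).1 x ![]) : b = b' := by
  refine Subtype.ext <| funext fun i => LinearMap.ext fun ξ => Subtype.ext <|
    form_zero_ext fun x => ?_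
  by_cases hx : x ∈ T.U i
  · exact h i ξ x hx
  · rw [correction_apply hx, correction_apply hx]

/-- For a given gauge field, correction terms are sections of the adjoint bundle. -/
def correctionEquiv {θ : ι → Form EX X 1 EG} (hθ : θ ∈ T.gaugeFields) :
    (VF EX X →ₗ[ℝ] T.assocForms (Ad EG) 0) ≃ T.corrections where
  toFun m := ⟨fun i =>
    { toFun := fun ξ => ⟨contr ξ.val (θ i) - (m ξ).1 i,
        sub_mem (T.contr_mem_formsOn hθ ξ i) ((m ξ).2.1 i)⟩
      map_add' := fun ξ η => Subtype.ext <| form_zero_ext fun x => by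
        have h1 : contr (ξ + η).val (θ i) x ![] =
            contr ξ.val (θ i) x ![] + contr η.val (θ i) x ![] := by
          simp only [contr_zero_apply, VF.val_add, map_add]
        change contr (ξ + η).val (θ i) x ![] - (m (ξ + η)).1 i x ![] =
          (contr ξ.val (θ i) x ![] - (m ξ).1 i x ![]) + (contr η.val (θ i) x ![] - (m η).1 i x ![])
        rw [h1, map_add]
        change _ - ((m ξ).1 i x ![] + (m η).1 i x ![]) = _
        abel
      map_smul' := fun c ξ => Subtype.ext <| form_zero_ext fun x => by
        have h1 : contr (c • ξ).val (θ i) x ![] = c • contr ξ.val (θ i) x ![] := by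
          simp only [contr_zero_apply, VF.val_smul, map_smul]
        change contr (c • ξ).val (θ i) x ![] - (m (c • ξ)).1 i x ![] =
          c • (contr ξ.val (θ i) x ![] - (m ξ).1 i x ![])
        rw [h1, map_smul, smul_sub]
        rfl },
    fun i j ξ x hx => by
      change contr ξ.val (θ j) x ![] - (m ξ).1 j x ![] =
        Ad EG (T.trans j i x) (contr ξ.val (θ i) x ![] - (m ξ).1 i x ![]) + _
      have h1 := hθ.2 i j x hx (ξ.val x)
      rw [apply_one, apply_one] at h1
      have h2 : (m ξ).1 j x ![] = Ad EG (T.trans j i x) ((m ξ).1 i x ![]) :=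
        DFunLike.congr_fun ((m ξ).2.2 i j x hx) ![]
      rw [contr_zero_apply, contr_zero_apply, h1, h2, map_sub]
      abel⟩
  invFun b :=
    { toFun := fun ξ => ⟨fun i => contr ξ.val (θ i) - (b.1 i ξ).1, fun i =>
        sub_mem (T.contr_mem_formsOn hθ ξ i) (b.1 i ξ).2, fun i j x hx => by
          ext v
          rw [fin_zero_eq v]
          change contr ξ.val (θ j) x ![] - (b.1 j ξ).1 x ![] =
            Ad EG (T.trans j i x) (contr ξ.val (θ i) x ![] - (b.1 i ξ).1 x ![])
          have h1 := hθ.2 i j x hx (ξ.val x)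
          rw [apply_one, apply_one] at h1
          rw [b.2 i j ξ x hx, contr_zero_apply, contr_zero_apply, h1, map_sub]
          abel⟩
      map_add' := fun ξ η => Subtype.ext <| funext fun i => form_zero_ext fun x => by
        have h1 : contr (ξ + η).val (θ i) x ![] =
            contr ξ.val (θ i) x ![] + contr η.val (θ i) x ![] := by
          simp only [contr_zero_apply, VF.val_add, map_add]
        change contr (ξ + η).val (θ i) x ![] - (b.1 i (ξ + η)).1 x ![] =
          (contr ξ.val (θ i) x ![] - (b.1 i ξ).1 x ![]) +
            (contr η.val (θ i) x ![] - (b.1 i η).1 x ![])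
        rw [h1, map_add]
        change _ - ((b.1 i ξ).1 x ![] + (b.1 i η).1 x ![]) = _
        abel
      map_smul' := fun c ξ => Subtype.ext <| funext fun i => form_zero_ext fun x => by
        have h1 : contr (c • ξ).val (θ i) x ![] = c • contr ξ.val (θ i) x ![] := by
          simp only [contr_zero_apply, VF.val_smul, map_smul]
        change contr (c • ξ).val (θ i) x ![] - (b.1 i (c • ξ)).1 x ![] =
          c • (contr ξ.val (θ i) x ![] - (b.1 i ξ).1 x ![])
        rw [h1, map_smul, smul_sub]
        rfl }
  left_inv m := LinearMap.ext fun ξ => Subtype.ext <| funext fun i => sub_sub_cancel _ _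
  right_inv b := Subtype.ext <| funext fun i => LinearMap.ext fun ξ => Subtype.ext <|
    sub_sub_cancel _ _

/-- The correction terms attached to a class of pairs. -/
def classCorrection : Quotient T.pairSetoid → T.corrections :=
  Quotient.lift (fun q => T.correctionEquiv q.1.2 q.2) fun q q' h => by
    refine T.corrections_ext fun i ξ x hx => ?_
    exact DFunLike.congr_fun (h ξ i x hx) ![]

theorem classCorrection_mk (q : T.BasePair) :
    T.classCorrection ⟦q⟧ = T.correctionEquiv q.1.2 q.2 := rfl

variable [FiniteDimensional ℝ EP] [LieGroup 𝓘(ℝ, EG) ∞ G]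
  [T2Space X] [SecondCountableTopology X]

/-- Classes of pairs are correction terms. -/
def classEquiv : Quotient T.pairSetoid ≃ T.corrections :=
  Equiv.ofBijective T.classCorrection <| by
    constructor
    · rintro ⟨q⟩ ⟨q'⟩ h
      refine Quotient.sound fun ξ i x _ => ?_
      have h1 : T.correctionEquiv q.1.2 q.2 = T.correctionEquiv q'.1.2 q'.2 := h
      have h2 : ((T.correctionEquiv q.1.2 q.2).1 i ξ).1 x =
        ((T.correctionEquiv q'.1.2 q'.2).1 i ξ).1 x := by rw [h1]
      exact h2
    · intro b
      -- Every connection occurs in every class, so the existence of one connection already gives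
      -- surjectivity.
      have hθ := T.baseForms_mem_gaugeFields T.someConnection_mem
      refine ⟨⟦(⟨_, hθ⟩, (T.correctionEquiv hθ).symm b)⟧, ?_⟩
      rw [classCorrection_mk]
      exact (T.correctionEquiv hθ).apply_symm_apply b

theorem classEquiv_mk (q : T.BasePair) :
    T.classEquiv ⟦q⟧ = T.correctionEquiv q.1.2 q.2 := rfl

theorem classEquiv_existsUnique (θ : T.gaugeFields) (b : T.corrections) :
    ∃! m, T.classEquiv ⟦(θ, m)⟧ = b := by
  simp only [classEquiv_mk]
  exact (T.correctionEquiv θ.2).bijective.existsUnique b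

/-- Lifts are correction terms. -/
def liftCorrectionEquiv : B.lifts ≃ T.corrections :=
  ((T.liftsEquiv T.someConnection_mem).trans
    ((LinearEquiv.refl ℝ (VF EX X)).arrowCongr
      (T.tensorialEquiv (smoothRep_Ad EG) 0)).toEquiv).trans
    (T.correctionEquiv (T.baseForms_mem_gaugeFields T.someConnection_mem))

theorem liftCorrectionEquiv_apply_some (l : B.lifts) (ξ : VF EX X) {i : ι} {x : X}
    (hx : x ∈ T.U i) : ((T.liftCorrectionEquiv l).1 i ξ).1 x ![] =
      toLin (T.someConnection (T.sec i x)) (tmap EX EP (T.sec i) x (ξ.val x)) -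
        toLin (T.someConnection (T.sec i x)) ((l.1 ξ).1.val (T.sec i x)) := by
  change contr ξ.val (T.baseForms T.someConnection i) x ![] -
    T.baseForms (contr (l.1 ξ).1.val T.someConnection) i x ![] = _
  rw [contr_zero_apply, T.baseForms_one_apply _ hx, T.baseForms_of_mem _ hx, pull_apply,
    contr_zero_apply]

/-- The correction term measures the deviation of the lift from the canonical section. -/
theorem fundamental_liftCorrection (l : B.lifts) (ξ : VF EX X) {i : ι} {x : X}
    (hx : x ∈ T.U i) : B.fundamental (T.sec i x) (((T.liftCorrectionEquiv l).1 i ξ).1 x ![]) =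
      tmap EX EP (T.sec i) x (ξ.val x) - (l.1 ξ).1.val (T.sec i x) := by
  -- Both sides project to zero, so it is enough to compare their components under the connection
  -- used in the construction.
  apply T.splitMap_injective T.someConnection_mem
  refine Prod.ext ?_ ?_
  · change tmap EP EX B.proj (T.sec i x) _ = tmap EP EX B.proj (T.sec i x) _
    rw [B.tmap_proj_fundamental, map_sub, tmap_proj_tmap_sec hx, l.2, proj_sec hx, sub_self]
  · change toLin (T.someConnection (T.sec i x)) _ = toLin (T.someConnection (T.sec i x)) _
    rw [B.connection_fundamental T.someConnection_mem, T.liftCorrectionEquiv_apply_some l ξ hx,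
      map_sub]

/-- The right-hand side of `fundamental_liftCorrection` involves no connection. Applying θ to that
identity therefore gives B_ξ = ι_ξ ω - λ_ξ for an arbitrary connection, not only for the chosen one.
-/
theorem liftCorrectionEquiv_apply {θ : Form EP P 1 EG} (hθ : θ ∈ B.connections) (l : B.lifts)
    (ξ : VF EX X) {i : ι} {x : X} (hx : x ∈ T.U i) :
    ((T.liftCorrectionEquiv l).1 i ξ).1 x ![] =
      toLin (T.baseForms θ i x) (ξ.val x) - toLin (θ (T.sec i x)) ((l.1 ξ).1.val (T.sec i x)) := by
  have h := congrArg (toLin (θ (T.sec i x))) (T.fundamental_liftCorrection l ξ hx)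
  rwa [B.connection_fundamental hθ, map_sub, ← T.baseForms_one_apply θ hx] at h

/-- The forward direction is `liftCorrectionEquiv_apply`. Conversely, the pair determines some lift;
by the forward direction it has the same correction term as `l`, hence equals `l`. -/
theorem lift_iff_class (q : B.TotalPair) (l : B.lifts) :
    (∀ ξ, contr (l.1 ξ).1.val q.1.1 = (q.2 ξ).1) ↔
      T.liftCorrectionEquiv l = T.classEquiv ⟦T.pairEquiv q⟧ := by
  have h : ∀ l : B.lifts, (∀ ξ, contr (l.1 ξ).1.val q.1.1 = (q.2 ξ).1) →
      T.liftCorrectionEquiv l = T.classEquiv ⟦T.pairEquiv q⟧ := fun l hl => by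
    refine T.corrections_ext fun i ξ x hx => ?_
    rw [T.liftCorrectionEquiv_apply q.1.2 l ξ hx]
    change _ = contr ξ.val (T.baseForms q.1.1 i) x ![] - T.baseForms (q.2 ξ).1 i x ![]
    rw [contr_zero_apply, T.baseForms_of_mem (q.2 ξ).1 hx, pull_apply, ← hl, contr_zero_apply]
  refine ⟨h l, fun hl => ?_⟩
  obtain ⟨l', hl', -⟩ := T.existsUnique_lift q
  rw [T.liftCorrectionEquiv.injective (hl.trans (h l' hl').symm)]
  exact hl'

theorem represents_pairEquiv (q : B.TotalPair) : T.Represents (T.pairEquiv q).1.1 q.1.1 ∧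
    ∀ ξ, T.Represents ((T.pairEquiv q).2 ξ).1 (q.2 ξ).1 :=
  ⟨T.represents_baseForms q.1.1, fun ξ => T.represents_baseForms (q.2 ξ).1⟩

end TrivCover

end BaseData

/-! ### The exterior derivative on fundamental vectors -/

section FundamentalDerivative

variable {B : PrincipalBundle EX EG EP X G P} {V : Type*} [NormedAddCommGroup V] [NormedSpace ℝ V]
  {p : ℕ}

variable (EG G) in
/-- A curve in `G` through `1` with velocity `A`. -/
def curveOne (A : EG) (t : ℝ) : G := (chartAt EG (1 : G)).symm (chartOne EG G + t • A)

theorem curveOne_zero [LieGroup 𝓘(ℝ, EG) ∞ G] (A : EG) : curveOne EG G A 0 = 1 := by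
  rw [curveOne, zero_smul, add_zero, chartAt_symm_chartOne]

theorem eventually_contMDiffAt_curveOne [LieGroup 𝓘(ℝ, EG) ∞ G] (A : EG) :
    ∀ᶠ t in 𝓝 (0 : ℝ), ContMDiffAt 𝓘(ℝ, ℝ) 𝓘(ℝ, EG) ∞ (curveOne EG G A) t := by
  have hc : ContDiff ℝ ∞ fun t : ℝ => chartOne EG G + t • A := by fun_prop
  have h0 : chartOne EG G + (0 : ℝ) • A ∈ (chartAt EG (1 : G)).target := by
    rw [zero_smul, add_zero]
    exact chartOne_mem_target EG
  filter_upwards [hc.continuous.continuousAt.preimage_mem_nhds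
    ((chartAt EG (1 : G)).open_target.mem_nhds h0)] with t ht
  exact ContMDiffAt.comp t (contMDiffAt_chartAt_symm ht) hc.contMDiff.contMDiffAt

theorem tmap_curveOne [LieGroup 𝓘(ℝ, EG) ∞ G] (A : EG) :
    tmap ℝ EG (curveOne EG G A) 0 1 = A := by
  have hc : ContDiff ℝ ∞ fun t : ℝ => chartOne EG G + t • A := by fun_prop
  have h0 : chartOne EG G + (0 : ℝ) • A = chartOne EG G := by rw [zero_smul, add_zero]
  have h1 := tmap_comp_apply (g := (chartAt EG (1 : G)).symm)
    (f := fun t : ℝ => chartOne EG G + t • A) (x := (0 : ℝ))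
    (by rw [h0]; exact mdifferentiableAt_chartAt_symm (chartOne_mem_target EG))
    (hc.contMDiff.mdifferentiableAt (by simp)) 1
  have h2 : tmap ℝ EG (fun t : ℝ => chartOne EG G + t • A) 0 1 = A := by
    rw [tmap_eq_fderiv, fderiv_const_add]
    have h3 := ((hasFDerivAt_id (𝕜 := ℝ) (0 : ℝ)).smul_const A).fderiv
    exact (DFunLike.congr_fun h3 1).trans (one_smul ℝ A)
  rw [h2, h0, chartOne, tmap_chart_symm_self] at h1
  exact h1

/-- Differentiating a(c(t)⁻¹) a(c(t)) = 1 at t = 0 yields the sign, with no need for the derivative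
of inversion in G. -/
theorem SmoothRep.hasDerivAt_curveOne_inv [LieGroup 𝓘(ℝ, EG) ∞ G] {a : G → V →L[ℝ] V}
    (ha : SmoothRep EG a) (A : EG) :
    HasDerivAt (fun t => a (curveOne EG G A t)⁻¹) (-tmap EG (V →L[ℝ] V) a 1 A) 0 := by
  have hc := (eventually_contMDiffAt_curveOne (G := G) A).self_of_nhds
  have h1 : DifferentiableAt ℝ (fun t => a (curveOne EG G A t)) 0 :=
    (ContMDiffAt.comp (0 : ℝ) ha.smooth.contMDiffAt hc).contDiffAt.differentiableAt (by simp)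
  have h2 : DifferentiableAt ℝ (fun t => a (curveOne EG G A t)⁻¹) 0 :=
    (ContMDiffAt.comp (0 : ℝ) ha.smooth.contMDiffAt hc.inv).contDiffAt.differentiableAt (by simp)
  have h3 : deriv (fun t => a (curveOne EG G A t)) 0 = tmap EG (V →L[ℝ] V) a 1 A := by
    have h4 := tmap_comp_apply (g := a) (f := curveOne EG G A) (x := (0 : ℝ))
      (ha.smooth.mdifferentiableAt (by simp)) (hc.mdifferentiableAt (by simp)) 1
    rw [tmap_curveOne, curveOne_zero, tmap_eq_fderiv] at h4
    rw [← h4, fderiv_apply_one_eq_deriv]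
  have h5 := h2.hasDerivAt.clm_comp h1.hasDerivAt
  have h6 : (fun t => (a (curveOne EG G A t)⁻¹).comp (a (curveOne EG G A t))) =
      fun _ => ContinuousLinearMap.id ℝ V := by
    funext t
    rw [← ha.mul, inv_mul_cancel, ha.one]
  rw [h6, h3, curveOne_zero, inv_one, ha.one] at h5
  have h7 := h5.unique (hasDerivAt_const _ _)
  simp only [ContinuousLinearMap.comp_id, ContinuousLinearMap.id_comp] at h7
  rw [← eq_neg_of_add_eq_zero_left h7]
  exact h2.hasDerivAt

/-- The exterior derivative of an equivariant form whose contraction with a fundamental vector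
field is constant. -/
theorem d_apply_fundamental [FiniteDimensional ℝ EP] [FiniteDimensional ℝ V]
    [IsManifold 𝓘(ℝ, EP) ∞ P] [LieGroup 𝓘(ℝ, EG) ∞ G]
    {a : G → V →L[ℝ] V} (ha : SmoothRep EG a) {φ : Form EP P p V}
    (hφ : φ ∈ formsOn EP p V (univ : Set P))
    (heq : ∀ (g : G) (u : P), pull EP EP (fun u => B.act u g) φ u =
      (a g⁻¹).compContinuousAlternatingMap (φ u)) (A : EG)
    (hA : ∀ (u u' : P) (v v' : Fin p → EP) (k : Fin p), v k = B.fundamental u A →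
      v' k = B.fundamental u' A → φ u v = φ u' v') (u : P) (v : Fin p → EP) :
    d φ u (Matrix.vecCons (B.fundamental u A) v) = -tmap EG (V →L[ℝ] V) a 1 A (φ u v) := by
  let y₀ := chartAt EP u u
  have hy₀ : y₀ ∈ (chartAt EP u).target := (chartAt EP u).map_source (mem_chart_source EP u)
  have hsy₀ : (chartAt EP u).symm y₀ = u := (chartAt EP u).left_inv (mem_chart_source EP u)
  let c := curveOne EG G A
  -- Moves the point with coordinates y along the curve c. At t = 0 the time direction maps to A^#,
  -- and at the coordinates of u a vector (0, w) maps to w. After pullback along `f`, the exterior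
  -- derivative is an explicit alternating sum on a vector space.
  let f : ℝ × EP → P := fun z => B.act ((chartAt EP u).symm z.2) (c z.1)
  have hfst : ContMDiff 𝓘(ℝ, ℝ × EP) 𝓘(ℝ, ℝ) ∞ (fun z : ℝ × EP => z.1) := contDiff_fst.contMDiff
  have hsnd : ContMDiff 𝓘(ℝ, ℝ × EP) 𝓘(ℝ, EP) ∞ (fun z : ℝ × EP => z.2) := contDiff_snd.contMDiff
  have hs : ∀ z : ℝ × EP, z.2 ∈ (chartAt EP u).target → ContMDiffAt 𝓘(ℝ, ℝ × EP) 𝓘(ℝ, EP) ∞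
      (fun z : ℝ × EP => (chartAt EP u).symm z.2) z := fun z hz =>
    ContMDiffAt.comp z (contMDiffAt_chartAt_symm hz) hsnd.contMDiffAt
  have hc : ∀ᶠ t in 𝓝 (0 : ℝ), ∀ y : EP, ContMDiffAt 𝓘(ℝ, ℝ × EP) 𝓘(ℝ, EG) ∞
      (fun z : ℝ × EP => c z.1) (t, y) := by
    filter_upwards [eventually_contMDiffAt_curveOne (G := G) A] with t ht y
    exact ContMDiffAt.comp (t, y) (g := c) ht hfst.contMDiffAt
  have hf : ContMDiffAt 𝓘(ℝ, ℝ × EP) 𝓘(ℝ, EP) ∞ f (0, y₀) :=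
    B.contMDiff_act.contMDiffAt.comp (0, y₀) ((hs _ hy₀).prodMk (hc.self_of_nhds y₀))
  have hf0 : ∀ y, f (0, y) = (chartAt EP u).symm y := fun y => by
    change B.act _ (curveOne EG G A 0) = _
    rw [curveOne_zero, B.act_one]
  have hts : ∀ (t : ℝ) (y : EP), y ∈ (chartAt EP u).target → ∀ w : ℝ × EP,
      tmap (ℝ × EP) EP (fun z : ℝ × EP => (chartAt EP u).symm z.2) (t, y) w =
        tmap EP EP (chartAt EP u).symm y w.2 := fun t y hy w => by
    have h := tmap_comp_apply (g := (chartAt EP u).symm) (f := fun z : ℝ × EP => z.2) (x := (t, y))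
      (mdifferentiableAt_chartAt_symm hy) (hsnd.mdifferentiableAt (by simp)) w
    rw [h, tmap_eq_fderiv, fderiv_snd]
    rfl
  have htc : ∀ᶠ t in 𝓝 (0 : ℝ), ∀ (y : EP) (w : ℝ × EP),
      tmap (ℝ × EP) EG (fun z : ℝ × EP => c z.1) (t, y) w = tmap ℝ EG c t w.1 := by
    filter_upwards [eventually_contMDiffAt_curveOne (G := G) A] with t ht y w
    have h := tmap_comp_apply (g := c) (f := fun z : ℝ × EP => z.1) (x := (t, y))
      (ht.mdifferentiableAt (by simp)) (hfst.mdifferentiableAt (by simp)) w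
    rw [h, tmap_eq_fderiv, fderiv_fst]
    rfl
  have htf : ∀ᶠ t in 𝓝 (0 : ℝ), ∀ y : EP, y ∈ (chartAt EP u).target → ∀ w : ℝ × EP,
      tmap (ℝ × EP) EP f (t, y) w = tmap EP EP (fun u => B.act u (c t)) ((chartAt EP u).symm y)
        (tmap EP EP (chartAt EP u).symm y w.2) +
        B.fundamental (f (t, y)) (leftMul EG (c t)⁻¹ (c t) (tmap ℝ EG c t w.1)) := by
    filter_upwards [hc, htc] with t ht ht' y hy w
    rw [← hts t y hy w, ← ht' y w]
    exact B.tmap_act ((hs (t, y) hy).mdifferentiableAt (by simp))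
      ((ht y).mdifferentiableAt (by simp)) w
  have htf1 : ∀ y : EP, y ∈ (chartAt EP u).target →
      tmap (ℝ × EP) EP f (0, y) (1, 0) = B.fundamental (f (0, y)) A := fun y hy => by
    rw [htf.self_of_nhds y hy, map_zero, map_zero, zero_add, tmap_curveOne]
    change B.fundamental _ (leftMul EG (curveOne EG G A 0)⁻¹ (curveOne EG G A 0) A) = _
    rw [curveOne_zero, inv_one, leftMul_one]
    rfl
  have htf2 : ∀ᶠ t in 𝓝 (0 : ℝ), ∀ w : EP,
      tmap (ℝ × EP) EP f (t, y₀) (0, w) = tmap EP EP (fun u => B.act u (c t)) u w := by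
    filter_upwards [htf] with t ht w
    rw [ht y₀ hy₀, map_zero, map_zero, B.fundamental_zero, add_zero, tmap_chart_symm_self, hsy₀]
    rfl
  have hsm := TrivCover.formSmoothAt_of_mem hφ (f (0, y₀))
  have hψ := (contDiffAt_pull hf hsm).differentiableAt (by simp)
  have h1 := DFunLike.congr_fun (extDeriv_pull hf hsm)
    (Matrix.vecCons ((1, 0) : ℝ × EP) (fun k => (0, v k)))
  have hdiff : ∀ w : Fin p → ℝ × EP,
      DifferentiableAt ℝ (fun z => pull (ℝ × EP) EP f φ z w) (0, y₀) := fun w =>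
    (contDiffAt_alternating_apply (w := fun k _ => w k) (contDiffAt_pull hf hsm)
      fun _ => contDiffAt_const).differentiableAt (by simp)
  -- Only the time derivative survives. Each other term differentiates along the slice t = 0 with
  -- the time direction among the arguments; it maps to A^#, so by `hA` the differentiated function
  -- is locally constant.
  rw [extDeriv_apply hψ, Fin.sum_univ_succ, Finset.sum_eq_zero, add_zero] at h1
  · have h2 : pull (ℝ × EP) EP f (d φ) (0, y₀)
        (Matrix.vecCons ((1, 0) : ℝ × EP) (fun k => (0, v k))) =
        d φ u (Matrix.vecCons (B.fundamental u A) v) := by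
      rw [pull_apply, hf0, hsy₀]
      congr 1
      funext k
      refine Fin.cases ?_ (fun k => ?_) k
      · exact (htf1 y₀ hy₀).trans (by rw [hf0, hsy₀]; rfl)
      · refine (htf2.self_of_nhds (v k)).trans ?_
        change tmap EP EP (fun u => B.act u (curveOne EG G A 0)) u _ = _
        rw [curveOne_zero, B.tmap_act_one]
        rfl
    rw [← h2, ← h1]
    have h3 := ((hdiff fun k => (0, v k)).hasFDerivAt.comp_hasDerivAt (0 : ℝ)
      ((hasDerivAt_id (0 : ℝ)).prodMk (hasDerivAt_const (0 : ℝ) y₀)))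
    -- With y fixed, `f` follows the orbit of u, and the pulled-back form is R_{c(t)}^* φ at u,
    -- which equivariance evaluates.
    have h4 : (fun z => pull (ℝ × EP) EP f φ z (fun k => (0, v k))) ∘ (fun t : ℝ => (id t, y₀))
        =ᶠ[𝓝 0] fun t => a (c t)⁻¹ (φ u v) := by
      filter_upwards [htf2] with t ht
      have h5 : f (t, y₀) = B.act u (c t) := congrArg (fun u => B.act u (c t)) hsy₀
      change pull (ℝ × EP) EP f φ (t, y₀) (fun k => (0, v k)) = _
      rw [pull_apply, h5]
      simp only [ht]
      exact DFunLike.congr_fun (heq (c t) u) v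
    have h6 := (ha.hasDerivAt_curveOne_inv A).clm_apply (hasDerivAt_const (0 : ℝ) (φ u v))
    have h7 := h3.unique (h6.congr_of_eventuallyEq h4)
    simp only [map_zero, add_zero] at h7
    rw [Fin.val_zero, pow_zero, one_smul]
    exact h7
  · intro k _
    have h2 := fderiv_partial_right (hdiff (k.succ.removeNth
      (Matrix.vecCons ((1, 0) : ℝ × EP) (fun k => (0, v k)))))
    have h3 := DFunLike.congr_fun h2 (v k)
    have h4 : (fun y => pull (ℝ × EP) EP f φ (0, y) (k.succ.removeNth
        (Matrix.vecCons ((1, 0) : ℝ × EP) (fun k => (0, v k))))) =ᶠ[𝓝 y₀]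
        fun _ => pull (ℝ × EP) EP f φ (0, y₀) (k.succ.removeNth
        (Matrix.vecCons ((1, 0) : ℝ × EP) (fun k => (0, v k)))) := by
      filter_upwards [(chartAt EP u).open_target.mem_nhds hy₀] with y hy
      cases p with
      | zero => exact k.elim0
      | succ q =>
        exact hA _ _ _ _ 0 (htf1 y hy) (htf1 y₀ hy₀)
    rw [h4.fderiv_eq, fderiv_const_apply] at h3
    exact (congrArg (fun w => (-1) ^ k.succ.val • w) h3.symm).trans (smul_zero _)

end FundamentalDerivative

/-! ### Lie derivatives of equivariant forms along invariant fields -/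

section ExteriorDerivative

variable {E M V : Type*} [NormedAddCommGroup E] [NormedSpace ℝ E] [TopologicalSpace M]
  [ChartedSpace E M] [NormedAddCommGroup V] [NormedSpace ℝ V] {p : ℕ}

theorem d_comp_clm (A : V →L[ℝ] V) {φ : Form E M p V} {x : M} (hφ : FormSmoothAt φ x) :
    d (fun y => A.compContinuousAlternatingMap (φ y)) x =
      A.compContinuousAlternatingMap (d φ x) := by
  have h0 : ContDiffAt ℝ ∞ (inChart x φ) (chartAt E x x) := hφ
  have h1 : ContDiffAt ℝ ∞ (fun y => A.compContinuousAlternatingMap (inChart x φ y))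
      (chartAt E x x) :=
    (ContinuousLinearMap.compContinuousAlternatingMapCLM ℝ E V V (Fin p)
      A).contDiff.contDiffAt.comp _ h0
  have h2 : extDeriv (fun y => A.compContinuousAlternatingMap (inChart x φ y)) (chartAt E x x) =
      A.compContinuousAlternatingMap (extDeriv (inChart x φ) (chartAt E x x)) := by
    ext v
    rw [extDeriv_apply (h1.differentiableAt (by simp)),
      ContinuousLinearMap.compContinuousAlternatingMap_coe, Function.comp_apply,
      extDeriv_apply (h0.differentiableAt (by simp)), map_sum]
    refine Finset.sum_congr rfl fun k _ => ?_
    have h3 : DifferentiableAt ℝ (fun y => inChart x φ y (k.removeNth v)) (chartAt E x x) :=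
      (contDiffAt_alternating_apply (w := fun j _ => k.removeNth v j) h0
        fun _ => contDiffAt_const).differentiableAt (by simp)
    have h4 := (A.hasFDerivAt.comp _ h3.hasFDerivAt).fderiv
    rw [map_zsmul]
    exact congrArg (fun w => (-1) ^ k.val • w) (DFunLike.congr_fun h4 (v k))
  ext v
  exact DFunLike.congr_fun h2 _

theorem FormSmoothAt.lieD [FiniteDimensional ℝ E] [FiniteDimensional ℝ V]
    [IsManifold 𝓘(ℝ, E) ∞ M] {Z : M → E}
    (hZ : ∀ x, ContDiffAt ℝ ∞ (vfInChart x Z) (chartAt E x x)) :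
    ∀ {p : ℕ} {φ : Form E M p V}, (∀ x, FormSmoothAt φ x) → ∀ x, FormSmoothAt (lieD Z φ) x
  | 0, _, hφ, x => (FormSmoothAt.d (Eventually.of_forall hφ)).contr (hZ x)
  | _ + 1, _, hφ, x =>
    (FormSmoothAt.d (Eventually.of_forall fun y => (hφ y).contr (hZ y))).add
      ((FormSmoothAt.d (Eventually.of_forall hφ)).contr (hZ x))

end ExteriorDerivative

section Vertical

variable {B : PrincipalBundle EX EG EP X G P} {V : Type*} [NormedAddCommGroup V] [NormedSpace ℝ V]
  {a : G → V →L[ℝ] V} {p : ℕ}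

variable (B a) in
/-- Smooth equivariant forms whose values on fundamental vectors do not depend on the other
arguments. Examples are the horizontal equivariant forms and the connection forms. -/
structure PrincipalBundle.QuasiTensorial (φ : Form EP P p V) : Prop where
  mem : φ ∈ formsOn EP p V (univ : Set P)
  pull_act : ∀ (g : G) (u : P), pull EP EP (fun u => B.act u g) φ u =
    (a g⁻¹).compContinuousAlternatingMap (φ u)
  vertical : ∀ (A : EG) (u u' : P) (v v' : Fin p → EP) (k : Fin p), v k = B.fundamental u A →
    v' k = B.fundamental u' A → φ u v = φ u' v'

open PrincipalBundle

theorem quasiTensorial_of_tensorial {φ : Form EP P p V} (hφ : φ ∈ B.tensorialForms a p) :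
    B.QuasiTensorial a φ where
  mem := hφ.1
  pull_act := hφ.2.2
  vertical A u u' v v' k h h' := by
    rw [hφ.2.1 u v ⟨k, by rw [h, B.tmap_proj_fundamental]⟩,
      hφ.2.1 u' v' ⟨k, by rw [h', B.tmap_proj_fundamental]⟩]

theorem quasiTensorial_of_connection {θ : Form EP P 1 EG} (hθ : θ ∈ B.connections) :
    B.QuasiTensorial (Ad EG) θ where
  mem := hθ.1
  pull_act := hθ.2.1
  vertical A u u' v v' k h h' := by
    obtain rfl : k = 0 := Subsingleton.elim _ _
    rw [fin_one_eq v, fin_one_eq v', h, h', hθ.2.2, hθ.2.2]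

namespace PrincipalBundle.QuasiTensorial

variable [IsManifold 𝓘(ℝ, EX) ∞ X] [IsManifold 𝓘(ℝ, EP) ∞ P] [LieGroup 𝓘(ℝ, EG) ∞ G]
  [FiniteDimensional ℝ EP] [FiniteDimensional ℝ V]
  [FiniteDimensional ℝ EX] [FiniteDimensional ℝ EG]

/-- Makes `d_fundamental` available for ι_Z φ, the form under the exterior derivative in the first
term of L_Z φ. -/
theorem contr {φ : Form EP P (p + 1) V} (hφ : B.QuasiTensorial a φ) {Z : VF EP P}
    (hZ : Z ∈ B.invariantVF) : B.QuasiTensorial a (contr Z.val φ) where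
  mem := (mem_formsOn_iff isOpen_univ).2 ⟨fun u _ =>
    (TrivCover.formSmoothAt_of_mem hφ.mem u).contr (Z.contDiffAt_inChart u),
    fun u hu => (hu (mem_univ u)).elim⟩
  pull_act g u := B.pull_act_contr (hφ.pull_act g u) hZ
  vertical A u u' _ _ k h h' := hφ.vertical A u u' _ _ k.succ h h'

theorem pull_act_d {φ : Form EP P p V} (hφ : B.QuasiTensorial a φ) (g : G) (u : P) :
    pull EP EP (fun u => B.act u g) (d φ) u = (a g⁻¹).compContinuousAlternatingMap (d φ u) := by
  rw [← d_pull (B.contMDiff_act_right g).contMDiffAt (TrivCover.formSmoothAt_of_mem hφ.mem _),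
    ← d_comp_clm _ (TrivCover.formSmoothAt_of_mem hφ.mem u)]
  exact d_congr (Eventually.of_forall fun u => hφ.pull_act g u)

theorem pull_act_lieD {Z : VF EP P} (hZ : Z ∈ B.invariantVF) (g : G) (u : P) :
    ∀ {p : ℕ} {φ : Form EP P p V}, B.QuasiTensorial a φ →
      pull EP EP (fun u => B.act u g) (lieD Z.val φ) u =
        (a g⁻¹).compContinuousAlternatingMap (lieD Z.val φ u)
  | 0, _, hφ => B.pull_act_contr (hφ.pull_act_d g u) hZ
  | _ + 1, _, hφ => by
    have h1 := (hφ.contr hZ).pull_act_d g u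
    have h2 := B.pull_act_contr (hφ.pull_act_d g u) hZ
    ext v
    have h3 := congrArg₂ (· + ·) (DFunLike.congr_fun h1 v) (DFunLike.congr_fun h2 v)
    exact h3.trans (map_add (a g⁻¹) _ _).symm

theorem d_fundamental (ha : SmoothRep EG a) {φ : Form EP P p V} (hφ : B.QuasiTensorial a φ) (u : P)
    (A : EG) (v : Fin p → EP) : d φ u (Matrix.vecCons (B.fundamental u A) v) =
      -tmap EG (V →L[ℝ] V) a 1 A (φ u v) :=
  d_apply_fundamental ha hφ.mem hφ.pull_act A (hφ.vertical A) u v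

/-- By `d_fundamental`, d(ι_Z φ) contributes -a'(A) φ(Z, v). In dφ(Z, A^#, v), moving A^# to the
front changes the sign, so ι_Z dφ contributes the opposite. -/
theorem lieD_fundamental (ha : SmoothRep EG a) {φ : Form EP P (p + 1) V}
    (hφ : B.QuasiTensorial a φ) {Z : VF EP P} (hZ : Z ∈ B.invariantVF) (u : P) (A : EG)
    (v : Fin p → EP) : lieD Z.val φ u (Matrix.vecCons (B.fundamental u A) v) = 0 := by
  have h1 := (hφ.contr hZ).d_fundamental ha u A v
  have h2 := hφ.d_fundamental ha u A (Matrix.vecCons (Z.val u) v)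
  have h3 := (d φ u).map_swap (Matrix.vecCons (B.fundamental u A) (Matrix.vecCons (Z.val u) v))
    (i := 0) (j := 1) (by simp)
  have h4 : Matrix.vecCons (B.fundamental u A) (Matrix.vecCons (Z.val u) v) ∘ Equiv.swap 0 1 =
      Matrix.vecCons (Z.val u) (Matrix.vecCons (B.fundamental u A) v) := by
    funext k
    refine Fin.cases ?_ (fun k => Fin.cases ?_ (fun k => ?_) k) k
    · simp
    · exact congrArg _ (Equiv.swap_apply_right _ _)
    · exact congrArg _ (Equiv.swap_apply_of_ne_of_ne (Fin.succ_ne_zero _)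
        fun h => Fin.succ_ne_zero k (Fin.succ_injective _ h))
  rw [h4] at h3
  replace h3 : d φ u (Matrix.vecCons (Z.val u) (Matrix.vecCons (B.fundamental u A) v)) =
    -d φ u (Matrix.vecCons (B.fundamental u A) (Matrix.vecCons (Z.val u) v)) := h3
  rw [h2] at h3
  change d (CovLie.contr Z.val φ) u _ + d φ u (Matrix.vecCons (Z.val u) _) = 0
  rw [h1, h3, neg_neg]
  exact neg_add_cancel _

/-- A vertical vector is fundamental, and a transposition brings it to the first slot, where
`lieD_fundamental` applies. The form itself need not be horizontal, so connection forms are covered.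
-/
theorem lieD_mem {ι : Type*} (T : TrivCover B ι) (ha : SmoothRep EG a) {Z : VF EP P}
    (hZ : Z ∈ B.invariantVF) {φ : Form EP P p V} (hφ : B.QuasiTensorial a φ) :
    lieD Z.val φ ∈ B.tensorialForms a p := by
  refine ⟨(mem_formsOn_iff isOpen_univ).2 ⟨fun u _ => FormSmoothAt.lieD
    (fun u => Z.contDiffAt_inChart u) (fun u => TrivCover.formSmoothAt_of_mem hφ.mem u) u,
    fun u hu => (hu (mem_univ u)).elim⟩, fun u v ⟨k, hk⟩ => ?_, fun g u => pull_act_lieD hZ g u hφ⟩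
  cases p with
  | zero => exact k.elim0
  | succ p =>
    have h1 := hφ.lieD_fundamental ha hZ u
      (leftMul EG (T.fib (T.index (B.proj u)) u)⁻¹ (T.fib (T.index (B.proj u)) u)
        (tmap EP EG (T.fib (T.index (B.proj u))) u (v k))) (fun j => (v ∘ Equiv.swap 0 k) j.succ)
    rw [← TrivCover.vertical_eq_fundamental (T.mem_U_index (B.proj u)) hk] at h1
    have h2 : Matrix.vecCons (v k) (fun j => (v ∘ Equiv.swap 0 k) j.succ) = v ∘ Equiv.swap 0 k := by
      funext j
      refine Fin.cases ?_ (fun j => rfl) j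
      exact congrArg v (Equiv.swap_apply_left 0 k).symm
    rw [h2] at h1
    by_cases h0 : 0 = k
    · rwa [← h0, Equiv.swap_self] at h1
    · have h3 := (lieD Z.val φ u).map_swap v h0
      replace h3 : lieD Z.val φ u (v ∘ Equiv.swap 0 k) = -lieD Z.val φ u v := h3
      rwa [h1, eq_comm, neg_eq_zero] at h3

end PrincipalBundle.QuasiTensorial

end Vertical

/-! ### Algebra of wedge products and contractions -/

section Wedge

variable {E M V W : Type*} [NormedAddCommGroup E] [NormedSpace ℝ E] [TopologicalSpace M]
  [ChartedSpace E M] [NormedAddCommGroup V] [NormedSpace ℝ V] [NormedAddCommGroup W]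
  [NormedSpace ℝ W] {p : ℕ}

theorem wedge₁_apply (b : W →L[ℝ] V →L[ℝ] V) (θ : Form E M 1 W) (φ : Form E M p V) (x : M)
    (v : Fin (p + 1) → E) : wedge₁ b θ φ x v =
      ∑ k : Fin (p + 1), (-1) ^ k.val • b (toLin (θ x) (v k)) (φ x (k.removeNth v)) := by
  rw [wedge₁, ContinuousAlternatingMap.alternatizeUncurryFin_apply]
  rfl

theorem wedge₀_apply (b : W →L[ℝ] V →L[ℝ] V) (f : Form E M 0 W) (φ : Form E M p V) (x : M)
    (v : Fin p → E) : wedge₀ b f φ x v = b (f x ![]) (φ x v) := rfl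

theorem contr_apply (ξ : M → E) (φ : Form E M (p + 1) V) (x : M) (v : Fin p → E) :
    contr ξ φ x v = φ x (Matrix.vecCons (ξ x) v) := rfl

theorem contr_wedge₁_zero (b : W →L[ℝ] V →L[ℝ] V) (θ : Form E M 1 W) (φ : Form E M 0 V) (ξ : M → E)
    (x : M) : contr ξ (wedge₁ b θ φ) x = wedge₀ b (contr ξ θ) φ x := by
  ext v
  rw [contr_apply, wedge₁_apply, wedge₀_apply, contr_zero_apply, Fin.sum_univ_succ,
    Finset.univ_eq_empty, Finset.sum_empty, add_zero, fin_zero_eq v, Fin.val_zero, pow_zero,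
    one_smul]
  rfl

/-- In the alternating sum for ι_ξ(θ ∧ φ), the term k = 0 inserts ξ into θ. The others insert it
into φ with the sign shifted by one, hence cancel against θ ∧ ι_ξ φ. -/
theorem contr_wedge₁_add (b : W →L[ℝ] V →L[ℝ] V) (θ : Form E M 1 W) (φ : Form E M (p + 1) V)
    (ξ : M → E) (x : M) : contr ξ (wedge₁ b θ φ) x + wedge₁ b θ (contr ξ φ) x =
      wedge₀ b (contr ξ θ) φ x := by
  ext v
  rw [ContinuousAlternatingMap.add_apply, contr_apply, wedge₁_apply, wedge₁_apply, wedge₀_apply,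
    contr_zero_apply, Fin.sum_univ_succ, Fin.val_zero, pow_zero, one_smul, add_assoc,
    ← Finset.sum_add_distrib, Finset.sum_eq_zero, add_zero]
  · rfl
  · intro k _
    have h : k.succ.removeNth (Matrix.vecCons (ξ x) v) =
        Matrix.vecCons (ξ x) (k.removeNth v) := by
      funext j
      refine Fin.cases ?_ (fun j => ?_) j
      · rfl
      · simp [Fin.removeNth]
    rw [h, contr_apply, Fin.val_succ, pow_succ, mul_neg_one, neg_smul]
    exact neg_add_cancel _

theorem contr_add (ξ : M → E) (φ ψ : Form E M (p + 1) V) (x : M) :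
    contr ξ (φ + ψ) x = contr ξ φ x + contr ξ ψ x := by
  ext v
  rfl

theorem wedge₁_sub (b : W →L[ℝ] V →L[ℝ] V) (θ : Form E M 1 W) (φ ψ : Form E M p V) (x : M) :
    wedge₁ b θ (φ - ψ) x = wedge₁ b θ φ x - wedge₁ b θ ψ x := by
  ext v
  simp only [ContinuousAlternatingMap.sub_apply, wedge₁_apply, Pi.sub_apply, map_sub, smul_sub,
    Finset.sum_sub_distrib]

/-- The covariant form of Cartan's formula. -/
theorem lieCov_eq (b : W →L[ℝ] V →L[ℝ] V) (θ : Form E M 1 W) (ξ : M → E) :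
    ∀ {p : ℕ} (φ : Form E M p V) (x : M),
      lieCov b θ ξ φ x = lieD ξ φ x + wedge₀ b (contr ξ θ) φ x
  | 0, φ, x => by
    change contr ξ (d φ + wedge₁ b θ φ) x = contr ξ (d φ) x + _
    rw [contr_add, contr_wedge₁_zero]
  | _ + 1, φ, x => by
    change contr ξ (d φ + wedge₁ b θ φ) x + (d (contr ξ φ) x + wedge₁ b θ (contr ξ φ) x) =
      d (contr ξ φ) x + contr ξ (d φ) x + _
    rw [contr_add, ← contr_wedge₁_add]
    abel

variable {b : W →L[ℝ] W →L[ℝ] W}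

theorem wedge₀_one (hb : ∀ A C, b A C = -b C A) (θ : Form E M 1 W) (f : Form E M 0 W) (x : M) :
    wedge₀ b f θ x = -wedge₁ b θ f x := by
  ext v
  rw [wedge₀_apply, ContinuousAlternatingMap.neg_apply, wedge₁_apply, Fin.sum_univ_succ,
    Finset.univ_eq_empty, Finset.sum_empty, add_zero, Fin.val_zero, pow_zero, one_smul, ← hb,
    fin_one_eq v, apply_one, fin_zero_eq (Fin.removeNth 0 ![v 0])]
  rfl

/-- For θ ∧ θ antisymmetry makes the two contributions of the contraction rule equal, so ι_ξ[θ ∧ θ]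
= -2[θ ∧ ι_ξ θ], and the factor ½ of the curvature removes the 2. -/
theorem contr_curv (hb : ∀ A C, b A C = -b C A) (θ : Form E M 1 W) (ξ : M → E) (x : M) :
    contr ξ (curv b θ) x = contr ξ (d θ) x - wedge₁ b θ (contr ξ θ) x := by
  have h := contr_wedge₁_add b θ θ ξ x
  rw [wedge₀_one hb] at h
  have h1 : contr ξ (wedge₁ b θ θ) x = (-2 : ℝ) • wedge₁ b θ (contr ξ θ) x := by
    rw [eq_sub_of_add_eq h]
    module
  have h2 : contr ξ ((1 / 2 : ℝ) • wedge₁ b θ θ) x = (1 / 2 : ℝ) • contr ξ (wedge₁ b θ θ) x := by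
    ext v
    rfl
  rw [curv, contr_add, h2, h1, smul_smul]
  module

end Wedge

theorem bracket_neg [FiniteDimensional ℝ EG] [LieGroup 𝓘(ℝ, EG) ∞ G] (A C : EG) :
    bracket EG G A C = -bracket EG G C A := by
  have : LieGroup 𝓘(ℝ, EG) (minSmoothness ℝ 3) G := by
    rw [minSmoothness_of_isRCLikeNormedField]; infer_instance
  have : CompleteSpace EG := FiniteDimensional.complete ℝ EG
  exact (lie_skew (L := GroupLieAlgebra 𝓘(ℝ, EG) G) A C).symm

/-! ### Lie derivatives pulled back along the canonical sections -/

section Base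

variable {B : PrincipalBundle EX EG EP X G P} {ι : Type*}
  [IsManifold 𝓘(ℝ, EX) ∞ X] [IsManifold 𝓘(ℝ, EP) ∞ P] [LieGroup 𝓘(ℝ, EG) ∞ G]
  [FiniteDimensional ℝ EX] [FiniteDimensional ℝ EP] [FiniteDimensional ℝ EG]
  [T2Space X] [SecondCountableTopology X]
  {V : Type*} [NormedAddCommGroup V] [NormedSpace ℝ V] [FiniteDimensional ℝ V]
  {a : G → V →L[ℝ] V} {p : ℕ}

namespace TrivCover

variable (T : TrivCover B ι)

theorem d_baseForms {φ : Form EP P p V} (hφ : φ ∈ formsOn EP p V (univ : Set P)) {i : ι} {x : X}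
    (hx : x ∈ T.U i) : d (T.baseForms φ i) x = pull EX EP (T.sec i) (d φ) x := by
  rw [← d_pull (contMDiffAt_sec hx) (formSmoothAt_of_mem hφ _)]
  exact d_congr (T.baseForms_eventuallyEq φ hx)

/-- Substitutes ξ~ = dσ_i(ξ) - B_ξ^# into the first argument. The other arguments are already
tangent to the section. -/
theorem pull_sec_contr (l : B.lifts) (ξ : VF EX X) (φ : Form EP P (p + 1) V) {i : ι} {x : X}
    (hx : x ∈ T.U i) (v : Fin p → EX) :
    pull EX EP (T.sec i) (contr (l.1 ξ).1.val φ) x v =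
      pull EX EP (T.sec i) φ x (Matrix.vecCons (ξ.val x) v) -
        φ (T.sec i x) (Matrix.vecCons
          (B.fundamental (T.sec i x) (((T.liftCorrectionEquiv l).1 i ξ).1 x ![]))
          (fun k => tmap EX EP (T.sec i) x (v k))) := by
  have h := T.fundamental_liftCorrection l ξ hx
  rw [eq_sub_iff_add_eq, ← eq_sub_iff_add_eq'] at h
  rw [pull_apply, contr_apply, h, pull_apply]
  have h1 : (fun k => tmap EX EP (T.sec i) x (Matrix.vecCons (ξ.val x) v k)) =
      Matrix.vecCons (tmap EX EP (T.sec i) x (ξ.val x)) (fun k => tmap EX EP (T.sec i) x (v k)) := by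
    funext k
    refine Fin.cases rfl (fun _ => rfl) k
  rw [h1]
  have h2 := map_sub (φ (T.sec i x)).curryLeft (tmap EX EP (T.sec i) x (ξ.val x))
    (B.fundamental (T.sec i x) (((T.liftCorrectionEquiv l).1 i ξ).1 x ![]))
  exact DFunLike.congr_fun h2 _

/-- The minus sign of the substitution meets that of dφ(A^#, ·) = -a'(A) φ, whence +B_ξ ∧ φ, for
matter fields and connections alike. -/
theorem pull_sec_contr_d (ha : SmoothRep EG a) (l : B.lifts) (ξ : VF EX X) {φ : Form EP P p V}
    (hφ : B.QuasiTensorial a φ) {i : ι} {x : X} (hx : x ∈ T.U i) :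
    pull EX EP (T.sec i) (contr (l.1 ξ).1.val (d φ)) x = contr ξ.val (d (T.baseForms φ i)) x +
      wedge₀ (tmap EG (V →L[ℝ] V) a 1) ((T.liftCorrectionEquiv l).1 i ξ).1 (T.baseForms φ i) x := by
  ext v
  rw [T.pull_sec_contr l ξ _ hx, hφ.d_fundamental ha, ← T.d_baseForms hφ.mem hx, sub_neg_eq_add,
    ContinuousAlternatingMap.add_apply, contr_apply, wedge₀_apply, T.baseForms_of_mem _ hx]
  rfl

/-- A horizontal form does not see B_ξ^#, so ι_{ξ~} φ pulls back to ι_ξ φ_i, and the correction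
arises only from the term ι d. -/
theorem baseForms_lieD (ha : SmoothRep EG a) (l : B.lifts) (ξ : VF EX X) :
    ∀ {p : ℕ} {φ : Form EP P p V}, φ ∈ B.tensorialForms a p → ∀ {i : ι} {x : X}, x ∈ T.U i →
      pull EX EP (T.sec i) (lieD (l.1 ξ).1.val φ) x = (lieD ξ.val (T.baseForms φ i) +
        wedge₀ (tmap EG (V →L[ℝ] V) a 1) ((T.liftCorrectionEquiv l).1 i ξ).1
          (T.baseForms φ i)) x
  | 0, _, hφ, _, _, hx => T.pull_sec_contr_d ha l ξ (quasiTensorial_of_tensorial hφ) hx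
  | p + 1, φ, hφ, i, x, hx => by
    have hq := quasiTensorial_of_tensorial hφ
    have h1 := T.pull_sec_contr_d ha l ξ hq hx
    have h2 : T.baseForms (contr (l.1 ξ).1.val φ) i =ᶠ[𝓝 x] contr ξ.val (T.baseForms φ i) := by
      filter_upwards [(T.isOpen_U i).mem_nhds hx] with y hy
      ext v
      rw [T.baseForms_of_mem _ hy, T.pull_sec_contr l ξ φ hy, contr_apply, T.baseForms_of_mem _ hy,
        hφ.2.1 _ (Matrix.vecCons (B.fundamental _ _) _) ⟨0, B.tmap_proj_fundamental _ _⟩, sub_zero]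
    have h3 := (T.d_baseForms (hq.contr (l.1 ξ).2).mem hx).symm.trans (d_congr h2)
    ext v
    have h4 := congrArg₂ (· + ·) (DFunLike.congr_fun h3 v) (DFunLike.congr_fun h1 v)
    exact h4.trans (add_assoc _ _ _).symm

/-- Now θ(B_ξ^#) = B_ξ, so ι_{ξ~} θ pulls back to ι_ξ θ_i - B_ξ, which adds -dB_ξ. The term ι d adds
[B_ξ ∧ θ_i] = -[θ_i ∧ B_ξ], and the two combine to the covariant derivative. -/
theorem baseForms_lieD_connection (l : B.lifts) (ξ : VF EX X) {θ : Form EP P 1 EG}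
    (hθ : θ ∈ B.connections) {i : ι} {x : X} (hx : x ∈ T.U i) :
    pull EX EP (T.sec i) (lieD (l.1 ξ).1.val θ) x = (lieD ξ.val (T.baseForms θ i) -
      dcov (bracket EG G) (T.baseForms θ i) ((T.liftCorrectionEquiv l).1 i ξ).1) x := by
  have hq := quasiTensorial_of_connection hθ
  have hbr : tmap EG (EG →L[ℝ] EG) (Ad EG : G → EG →L[ℝ] EG) 1 = bracket EG G := by
    ext A C
    exact tmap_Ad_apply EG A C
  have h1 := T.pull_sec_contr_d (smoothRep_Ad EG) l ξ hq hx
  rw [hbr, wedge₀_one (bracket_neg (EG := EG) (G := G))] at h1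
  have h2 : T.baseForms (contr (l.1 ξ).1.val θ) i =ᶠ[𝓝 x]
      contr ξ.val (T.baseForms θ i) - ((T.liftCorrectionEquiv l).1 i ξ).1 := by
    filter_upwards [(T.isOpen_U i).mem_nhds hx] with y hy
    ext v
    rw [fin_zero_eq v, Pi.sub_apply, ContinuousAlternatingMap.sub_apply, T.baseForms_of_mem _ hy,
      T.pull_sec_contr l ξ θ hy, contr_apply, T.baseForms_of_mem _ hy]
    congr 1
    refine Eq.trans (congrArg (θ (T.sec i y)) ?_)
      (hθ.2.2 (T.sec i y) (((T.liftCorrectionEquiv l).1 i ξ).1 y ![]))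
    funext k
    rw [Subsingleton.elim k 0]
    rfl
  have h3 := (T.d_baseForms (hq.contr (l.1 ξ).2).mem hx).symm.trans (d_congr h2)
  have hb := ((mem_formsOn_iff (T.isOpen_U i)).1 (((T.liftCorrectionEquiv l).1 i ξ).2)).1 x hx
  rw [d_sub ((T.formSmoothAt_baseForms hθ.1 hx).contr (ξ.contDiffAt_inChart x)) hb] at h3
  change pull EX EP (T.sec i) (d (contr (l.1 ξ).1.val θ) + contr (l.1 ξ).1.val (d θ)) x = _
  have h4 : pull EX EP (T.sec i) (d (contr (l.1 ξ).1.val θ) + contr (l.1 ξ).1.val (d θ)) x =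
      pull EX EP (T.sec i) (d (contr (l.1 ξ).1.val θ)) x +
        pull EX EP (T.sec i) (contr (l.1 ξ).1.val (d θ)) x := by
    ext v
    rfl
  rw [h4, h3, h1]
  change _ = (d (contr ξ.val (T.baseForms θ i)) x + contr ξ.val (d (T.baseForms θ i)) x) -
    (d _ x + wedge₁ _ _ _ x)
  abel

end TrivCover

end Base

/-! ### Covariant Lie derivatives as sections over X -/

section CovariantLie

variable {B : PrincipalBundle EX EG EP X G P} {ι : Type*}
  [IsManifold 𝓘(ℝ, EX) ∞ X] [IsManifold 𝓘(ℝ, EP) ∞ P] [LieGroup 𝓘(ℝ, EG) ∞ G]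
  [FiniteDimensional ℝ EX] [FiniteDimensional ℝ EP] [FiniteDimensional ℝ EG]
  [T2Space X] [SecondCountableTopology X]
  {V : Type*} [NormedAddCommGroup V] [NormedSpace ℝ V] [FiniteDimensional ℝ V]
  {a : G → V →L[ℝ] V} {p : ℕ}

namespace TrivCover

variable (T : TrivCover B ι)

theorem correction_eq_of_class {q : T.BasePair} {l : B.lifts}
    (h : T.classEquiv ⟦q⟧ = T.liftCorrectionEquiv l) (i : ι) (ξ : VF EX X) :
    ((T.liftCorrectionEquiv l).1 i ξ).1 = contr ξ.val (q.1.1 i) - (q.2 ξ).1 i := by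
  rw [← h]
  rfl

/-- The covariant Lie derivative of a matter field. -/
def covLieMatter (ha : SmoothRep EG a) (l : B.lifts) (ξ : VF EX X) (φ : T.assocForms a p) :
    T.assocForms a p :=
  T.tensorialEquiv ha p ⟨lieD (l.1 ξ).1.val ((T.tensorialEquiv ha p).symm φ).1,
    (quasiTensorial_of_tensorial ((T.tensorialEquiv ha p).symm φ).2).lieD_mem T ha (l.1 ξ).2⟩

/-- The form on P that represents `φ` is unique by `eq_totalForm`, and local forms vanish off their
domains, so the result is determined; `lieD_mem` gives existence. -/
theorem isCovLieMatter_iff (ha : SmoothRep EG a) (l : B.lifts) (ξ : VF EX X)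
    (φ ψ : T.assocForms a p) : T.IsCovLieMatter l a ξ φ ψ ↔ ψ = T.covLieMatter ha l ξ φ := by
  constructor
  · rintro ⟨φ', hφ', h, -, hψ⟩
    refine Subtype.ext ?_
    rw [T.eq_totalForm hφ' h] at hψ
    exact T.eq_baseForms hψ fun _ _ => T.eq_zero_of_notMem ψ.2
  · rintro rfl
    have hφ' := T.totalForm_mem ha φ.2
    exact ⟨T.totalForm a φ.1, hφ', T.represents_totalForm ha φ.2,
      (quasiTensorial_of_tensorial hφ').lieD_mem T ha (l.1 ξ).2, T.represents_baseForms _⟩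

theorem covLieMatter_apply (ha : SmoothRep EG a) (l : B.lifts) (ξ : VF EX X)
    (φ : T.assocForms a p) {i : ι} {x : X} (hx : x ∈ T.U i) :
    (T.covLieMatter ha l ξ φ).1 i x = (lieD ξ.val (φ.1 i) +
      wedge₀ (tmap EG (V →L[ℝ] V) a 1) ((T.liftCorrectionEquiv l).1 i ξ).1 (φ.1 i)) x := by
  have hφ' := T.totalForm_mem ha φ.2
  have h := T.eq_baseForms (T.represents_totalForm ha φ.2) fun _ _ => T.eq_zero_of_notMem φ.2
  refine (T.baseForms_of_mem _ hx).trans ((T.baseForms_lieD ha l ξ hφ' hx).trans ?_)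
  rw [← h]

/-- With B_ξ = ι_ξ ω - λ_ξ, the part (ι_ξ ω) ∧ φ is exactly what `lieCov_eq` adds to the Lie
derivative. -/
theorem covLieMatter_apply_of_class (ha : SmoothRep EG a) (l : B.lifts) (ξ : VF EX X)
    (φ : T.assocForms a p) {q : T.BasePair} (h : T.classEquiv ⟦q⟧ = T.liftCorrectionEquiv l)
    {i : ι} {x : X} (hx : x ∈ T.U i) : (T.covLieMatter ha l ξ φ).1 i x =
      (lieCov (tmap EG (V →L[ℝ] V) a 1) (q.1.1 i) ξ.val (φ.1 i) -
        wedge₀ (tmap EG (V →L[ℝ] V) a 1) ((q.2 ξ).1 i) (φ.1 i)) x := by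
  rw [T.covLieMatter_apply ha l ξ φ hx, T.correction_eq_of_class h, Pi.sub_apply, lieCov_eq,
    Pi.add_apply, add_sub_assoc]
  congr 1
  ext v
  rw [ContinuousAlternatingMap.sub_apply]
  simp only [wedge₀_apply, Pi.sub_apply, ContinuousAlternatingMap.sub_apply, map_sub,
    sub_apply]

/-- The covariant Lie derivative of a connection. -/
def covLieConnection (l : B.lifts) (ξ : VF EX X) (θ : T.gaugeFields) :
    T.assocForms (Ad EG) 1 :=
  T.tensorialEquiv (smoothRep_Ad EG) 1 ⟨lieD (l.1 ξ).1.val (T.connectionEquiv.symm θ).1,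
    (quasiTensorial_of_connection (T.connectionEquiv.symm θ).2).lieD_mem T (smoothRep_Ad EG)
      (l.1 ξ).2⟩

theorem baseForms_connectionEquiv_symm (θ : T.gaugeFields) :
    T.baseForms (T.connectionEquiv.symm θ).1 = θ.1 :=
  congrArg Subtype.val (T.connectionEquiv.apply_symm_apply θ)

theorem isCovLieConnection_iff (l : B.lifts) (ξ : VF EX X) (θ : T.gaugeFields)
    (ψ : T.assocForms (Ad EG) 1) :
    T.IsCovLieConnection l ξ θ ψ ↔ ψ = T.covLieConnection l ξ θ := by
  constructor
  · rintro ⟨θ', hθ', h, -, hψ⟩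
    have h1 : T.connectionEquiv.symm θ = ⟨θ', hθ'⟩ :=
      (Equiv.symm_apply_eq _).2 (Subtype.ext (T.eq_baseForms h fun i => (θ.2.1 i).2))
    refine Subtype.ext ?_
    change ψ.1 = T.baseForms (lieD (l.1 ξ).1.val (T.connectionEquiv.symm θ).1)
    rw [h1]
    exact T.eq_baseForms hψ fun _ _ => T.eq_zero_of_notMem ψ.2
  · rintro rfl
    refine ⟨(T.connectionEquiv.symm θ).1, (T.connectionEquiv.symm θ).2, fun i x hx => ?_,
      (quasiTensorial_of_connection (T.connectionEquiv.symm θ).2).lieD_mem T (smoothRep_Ad EG)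
        (l.1 ξ).2, T.represents_baseForms _⟩
    rw [← T.baseForms_of_mem _ hx, T.baseForms_connectionEquiv_symm]

theorem covLieConnection_apply (l : B.lifts) (ξ : VF EX X) (θ : T.gaugeFields) {i : ι} {x : X}
    (hx : x ∈ T.U i) : (T.covLieConnection l ξ θ).1 i x = (lieD ξ.val (θ.1 i) -
      dcov (bracket EG G) (θ.1 i) ((T.liftCorrectionEquiv l).1 i ξ).1) x := by
  refine (T.baseForms_of_mem _ hx).trans
    ((T.baseForms_lieD_connection l ξ (T.connectionEquiv.symm θ).2 hx).trans ?_)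
  rw [T.baseForms_connectionEquiv_symm]

/-- In L_ξ ω - d^ω(ι_ξ ω - λ_ξ) the terms d(ι_ξ ω) cancel, and ι_ξ dω - [ω ∧ ι_ξ ω] is the
contracted curvature by `contr_curv`. -/
theorem covLieConnection_apply_of_class (l : B.lifts) (ξ : VF EX X) (θ : T.gaugeFields)
    {m : VF EX X →ₗ[ℝ] T.assocForms (Ad EG) 0}
    (h : T.classEquiv ⟦(θ, m)⟧ = T.liftCorrectionEquiv l) {i : ι} {x : X} (hx : x ∈ T.U i) :
    (T.covLieConnection l ξ θ).1 i x = (contr ξ.val (curv (bracket EG G) (θ.1 i)) +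
      dcov (bracket EG G) (θ.1 i) ((m ξ).1 i)) x := by
  have h1 := ((mem_formsOn_iff (T.isOpen_U i)).1 (T.contr_mem_formsOn θ.2 ξ i)).1 x hx
  have h2 := ((mem_formsOn_iff (T.isOpen_U i)).1 ((m ξ).2.1 i)).1 x hx
  rw [T.covLieConnection_apply l ξ θ hx, T.correction_eq_of_class h, Pi.add_apply,
    contr_curv (bracket_neg (EG := EG) (G := G))]
  change (d (contr ξ.val (θ.1 i)) x + contr ξ.val (d (θ.1 i)) x) -
    (d (contr ξ.val (θ.1 i) - (m ξ).1 i) x + wedge₁ _ _ (contr ξ.val (θ.1 i) - (m ξ).1 i) x) =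
      _ + (d ((m ξ).1 i) x + wedge₁ _ _ ((m ξ).1 i) x)
  rw [d_sub h1 h2, wedge₁_sub]
  abel

end TrivCover

end CovariantLie

end CovLie

end

theorem mainTheorem3
    {EX EG EP X G P ι : Type*}
    [NormedAddCommGroup EX] [NormedSpace ℝ EX] [FiniteDimensional ℝ EX]
    [NormedAddCommGroup EG] [NormedSpace ℝ EG] [FiniteDimensional ℝ EG]
    [NormedAddCommGroup EP] [NormedSpace ℝ EP] [FiniteDimensional ℝ EP]
    [TopologicalSpace X] [ChartedSpace EX X] [IsManifold 𝓘(ℝ, EX) ∞ X]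
    [T2Space X] [SecondCountableTopology X]
    [TopologicalSpace G] [ChartedSpace EG G] [Group G] [LieGroup 𝓘(ℝ, EG) ∞ G]
    [T2Space G] [SecondCountableTopology G]
    [TopologicalSpace P] [ChartedSpace EP P] [IsManifold 𝓘(ℝ, EP) ∞ P]
    [T2Space P] [SecondCountableTopology P]
    (B : CovLie.PrincipalBundle EX EG EP X G P) (T : CovLie.TrivCover B ι) :
    ∃ (Φ : B.lifts ≃ T.corrections) (Ψ : Quotient T.pairSetoid ≃ T.corrections)
      (Θ : B.TotalPair ≃ T.BasePair),
      -- the covariant Lie derivatives of matter fields, by all three descriptions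
      (∀ (V : Type*) [NormedAddCommGroup V] [NormedSpace ℝ V] [FiniteDimensional ℝ V]
        (ρ : G →* (V →L[ℝ] V)), ContMDiff 𝓘(ℝ, EG) 𝓘(ℝ, V →L[ℝ] V) ∞ (fun g => ρ g) →
        ∀ (p : ℕ) (l : B.lifts) (ξ : CovLie.VF EX X) (φ : T.assocForms (fun g => ρ g) p),
        ∃ ψ : T.assocForms (fun g => ρ g) p,
          (∀ ψ', T.IsCovLieMatter l (fun g => ρ g) ξ φ ψ' ↔ ψ' = ψ) ∧
          (∀ i, ∀ x ∈ T.U i, ψ.1 i x =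
            (CovLie.lieD ξ.val (φ.1 i) +
              CovLie.wedge₀ (CovLie.derivedRep EG ρ) ((Φ l).1 i ξ).1 (φ.1 i)) x) ∧
          (∀ q : T.BasePair, Ψ ⟦q⟧ = Φ l → ∀ i, ∀ x ∈ T.U i, ψ.1 i x =
            (CovLie.lieCov (CovLie.derivedRep EG ρ) (q.1.1 i) ξ.val (φ.1 i) -
              CovLie.wedge₀ (CovLie.derivedRep EG ρ) ((q.2 ξ).1 i) (φ.1 i)) x)) ∧
      -- the covariant Lie derivatives of connections, by all three descriptions
      (∀ (l : B.lifts) (ξ : CovLie.VF EX X) (θ : T.gaugeFields),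
        ∃ ψ : T.assocForms (CovLie.Ad EG) 1,
          (∀ ψ', T.IsCovLieConnection l ξ θ ψ' ↔ ψ' = ψ) ∧
          (∀ i, ∀ x ∈ T.U i, ψ.1 i x =
            (CovLie.lieD ξ.val (θ.1 i) -
              CovLie.dcov (CovLie.bracket EG G) (θ.1 i) ((Φ l).1 i ξ).1) x) ∧
          (∀ m, Ψ ⟦(θ, m)⟧ = Φ l → ∀ i, ∀ x ∈ T.U i, ψ.1 i x =
            (CovLie.contr ξ.val (CovLie.curv (CovLie.bracket EG G) (θ.1 i)) +
              CovLie.dcov (CovLie.bracket EG G) (θ.1 i) ((m ξ).1 i)) x)) ∧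
      -- pairs on the base and correction terms
      (∀ (q : T.BasePair) (ξ : CovLie.VF EX X), ∀ i, ∀ x ∈ T.U i,
        ((Ψ ⟦q⟧).1 i ξ).1 x = q.diff ξ i x) ∧
      (∀ (θ : T.gaugeFields) (b : T.corrections), ∃! m, Ψ ⟦(θ, m)⟧ = b) ∧
      -- pairs on the total space and pairs on the base
      (∀ q : B.TotalPair, T.Represents (Θ q).1.1 q.1.1 ∧
        ∀ ξ, T.Represents ((Θ q).2 ξ).1 (q.2 ξ).1) ∧
      -- pairs on the total space determine lifts
      (∀ q : B.TotalPair, ∃! l : B.lifts,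
        ∀ ξ, CovLie.contr (l.1 ξ).1.val q.1.1 = (q.2 ξ).1) ∧
      (∀ (q : B.TotalPair) (l : B.lifts),
        (∀ ξ, CovLie.contr (l.1 ξ).1.val q.1.1 = (q.2 ξ).1) ↔ Φ l = Ψ ⟦Θ q⟧) := by
  refine ⟨T.liftCorrectionEquiv, T.classEquiv, T.pairEquiv, ?_, fun l ξ θ => ?_,
    fun q ξ i x _ => rfl,
    T.classEquiv_existsUnique, T.represents_pairEquiv, T.existsUnique_lift, T.lift_iff_class⟩
  · intro V _ _ _ ρ hρ p l ξ φ
    have ha : CovLie.SmoothRep EG (fun g => ρ g) := ⟨map_one ρ, map_mul ρ, hρ⟩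
    exact ⟨T.covLieMatter ha l ξ φ, T.isCovLieMatter_iff ha l ξ φ,
      fun i x hx => T.covLieMatter_apply ha l ξ φ hx,
      fun q h i x hx => T.covLieMatter_apply_of_class ha l ξ φ h hx⟩
  · exact ⟨T.covLieConnection l ξ θ, T.isCovLieConnection_iff l ξ θ,
      fun i x hx => T.covLieConnection_apply l ξ θ hx,
      fun m h i x hx => T.covLieConnection_apply_of_class l ξ θ h hx⟩
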